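/- Fix $E>0$, $\alpha,\beta\in(0,1)$, and $\rho_0:[0,1]\to[0,1]$ of class $C^4([0,1])$ with $\rho_0(0)=\alpha$ and $\rho_0(1)=\beta$. Let $\rho(t,x)$ be the unique (continuous) weak solution on $[0,\infty)\times[0,1]$ of the viscous Burgers equation $$\partial_t\rho=\partial_x^2\rho-E\,\partial_x[\rho(1-\rho)],\qquad \rho(t,0)=\alpha,\quad \rho(t,1)=\beta,\qquad \rho(0,\cdot)=\rho_0,$$ that is, $\rho$ is continuous on $[0,\infty)\times[0,1]$, takes these boundary and initial values, and for every $t\ge 0$ and every $G\in C^2([0,1])$ with $G(0)=G(1)=0$, $$\int_0^1\rho(t,x)G(x)\,dx-\int_0^1\rho_0(x)G(x)\,dx=\int_0^t\Big\{\int_0^1\rho(s,x)\,G''(x)\,dx+\alpha G'(0)-\beta G'(1)+E\int_0^1\rho(s,x)[1-\rho(s,x)]\,G'(x)\,dx\Big\}ds.$$ For $N\ge 1$ put $(\nabla_N^+f)(j)=N[f(j+1)-f(j)]$, $(\nabla_N^-f)(j)=N[f(j)-f(j-1)]$, $(\Delta_Nf)(j)=N^2[f(j+1)+f(j-1)-2f(j)]$,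 and let $\gamma=\gamma_N<0$ be given by $e^{-\gamma/N}=1+E/N$. For $N\ge 2$, let $\Omega=\Omega^N$ act on functions $f:\{0,\dots,N-1\}\to\mathbb R$ by $$(\Omega f)(0)=-\alpha EN f(0)+N(\nabla_N^+f)(0),$$ $$(\Omega f)(j)=(\Delta_Nf)(j)-E(\nabla_N^-f)(j),\quad 1\le j\le N-2,$$ $$(\Omega f)(N-1)=\beta EN f(N-1)-N\Big(1+\frac EN\Big)(\nabla_N^-f)(N-1).$$ Let $\lambda_t=\lambda_t^N$, $t\ge0$, be the solution of $\partial_t\lambda_t=\Omega\lambda_t$ on $\{0,\dots,N-1\}$ with $\lambda_0(j)=\exp\{-(\gamma/N)\sum_{k=1}^j\rho_0(k/N)\}$, and set $$r_t(j)=-\frac1\gamma\,[\nabla_N^-\ln\lambda_t](j),\qquad 1\le j\le N-1.$$ Then, for each $T>0$, $$\sup_{N\ge1}\ \sup_{0\le t\le T}\ \max_{1\le j\le N-1} N\,\big|r_t(j)-\rho(t,j/N)\big|<\infty$$ (for $N=1$ there is no $j$ and nothing is claimed). -/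

import Mathlib

open scoped BigOperators

noncomputable section

namespace BurgersProxy

/-- The discrete gradient `(∇⁺_N f)(j) = N [f(j+1) - f(j)]`. -/
def gradPlus (N : ℕ) (f : ℕ → ℝ) (j : ℕ) : ℝ :=
  (N : ℝ) * (f (j + 1) - f j)

/-- The discrete gradient `(∇⁻_N f)(j) = -N [f(j-1) - f(j)]`; it is only used for `j ≥ 1`. -/
def gradMinus (N : ℕ) (f : ℕ → ℝ) (j : ℕ) : ℝ :=
  -(N : ℝ) * (f (j - 1) - f j)

/-- The discrete Laplacian `(Δ_N f)(j) = N² [f(j+1) + f(j-1) - 2 f(j)]`, used for `j ≥ 1`. -/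
def discreteLaplacian (N : ℕ) (f : ℕ → ℝ) (j : ℕ) : ℝ :=
  (N : ℝ) ^ 2 * (f (j + 1) + f (j - 1) - 2 * f j)

/-- The operator `Ω = Ω^N` on functions on `Λ_N = {0, …, N-1}`. A function on `Λ_N` is represented
by a function on `ℕ`; for `N ≥ 2` and `j < N` only its values on `Λ_N` enter. -/
def Omega (E α β : ℝ) (N : ℕ) (f : ℕ → ℝ) (j : ℕ) : ℝ :=
  if j = 0 then
    -α * E * N * f 0 + N * gradPlus N f 0
  else if j = N - 1 then
    β * E * N * f (N - 1) - N * (1 + E / N) * gradMinus N f (N - 1)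
  else
    discreteLaplacian N f j - E * gradMinus N f j

/-- The constant `γ = γ_N`, determined by `exp (-γ / N) = 1 + E / N`. -/
def gam (E : ℝ) (N : ℕ) : ℝ := -(N : ℝ) * Real.log (1 + E / N)

theorem exp_neg_gam_div {E : ℝ} (hE : 0 < E) {N : ℕ} (hN : 1 ≤ N) :
    Real.exp (-gam E N / N) = 1 + E / N := by
  have hN' : (0 : ℝ) < N := by exact_mod_cast hN
  have h : -gam E N / N = Real.log (1 + E / N) := by
    unfold gam
    field_simp
    try ring
  rw [h, Real.exp_log (by positivity)]

/-- `lam t j`, `t ≥ 0`, `j ∈ {0, …, N-1}`, solves the linear system `∂_t λ_t = Ω λ_t` with initial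
condition `λ_0(j) = exp (-(γ/N) ∑_{k=1}^j ρ₀(k/N))`. At `t = 0` the derivative is one-sided. -/
structure IsSemidiscreteSolution (E α β : ℝ) (ρ₀ : ℝ → ℝ) (N : ℕ) (lam : ℝ → ℕ → ℝ) : Prop where
  initial : ∀ j < N, lam 0 j =
    Real.exp (-(gam E N / N) * ∑ k ∈ Finset.Icc 1 j, ρ₀ ((k : ℝ) / N))
  evolution : ∀ t : ℝ, 0 ≤ t → ∀ j < N,
    HasDerivWithinAt (fun s => lam s j) (Omega E α β N (lam t) j) (Set.Ici 0) t

/-- The proxy `r_t(j) = -γ⁻¹ [∇⁻_N ln λ_t](j)`, `1 ≤ j ≤ N-1`, as a functional of `λ_t`. -/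
def proxy (E : ℝ) (N : ℕ) (l : ℕ → ℝ) (j : ℕ) : ℝ :=
  -(1 / gam E N) * gradMinus N (fun i => Real.log (l i)) j

/-- The flux nonlinearity `b(ρ) = ρ (1 - ρ)`. -/
def flux (u : ℝ) : ℝ := u * (1 - u)

/-- `ρ` is a (continuous version of a) weak solution on `[0, ∞) × [0, 1]` of the viscous Burgers
equation `∂_t ρ = ∂_x² ρ - E ∂_x b(ρ)` with boundary conditions `ρ(t,0) = α`, `ρ(t,1) = β` and
initial condition `ρ₀`: the equation is tested against `C²` functions vanishing at `0` and `1`. -/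
structure IsWeakBurgersSolution (E α β : ℝ) (ρ₀ : ℝ → ℝ) (ρ : ℝ → ℝ → ℝ) : Prop where
  continuousOn : ContinuousOn (fun p : ℝ × ℝ => ρ p.1 p.2) (Set.Ici 0 ×ˢ Set.Icc 0 1)
  left : ∀ t, 0 ≤ t → ρ t 0 = α
  right : ∀ t, 0 ≤ t → ρ t 1 = β
  initial : ∀ x ∈ Set.Icc (0 : ℝ) 1, ρ 0 x = ρ₀ x
  weak : ∀ G : ℝ → ℝ, ContDiff ℝ 2 G → G 0 = 0 → G 1 = 0 → ∀ t, 0 ≤ t →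
    (∫ x in (0 : ℝ)..1, ρ t x * G x) - ∫ x in (0 : ℝ)..1, ρ₀ x * G x =
      ∫ s in (0 : ℝ)..t,
        ((∫ x in (0 : ℝ)..1, ρ s x * deriv (deriv G) x)
          + α * deriv G 0 - β * deriv G 1
          + E * ∫ x in (0 : ℝ)..1, flux (ρ s x) * deriv G x)

end BurgersProxy

end

/-!
`Ω` is a discrete heat operator, and `λ_t` a discrete Hopf-Cole transform: the density

  `q_j = N (λ_j - λ_{j-1}) / (E λ_{j-1})`, with `q_0 = α` and `q_N = β`,

differs from the proxy `r_t(j) = ln (λ_j / λ_{j-1}) / ln (1 + E / N)` by `O(1/N)`. It therefore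
suffices to compare `q` with the weak solution, and no regularity of the latter is used: the
convergence rate comes from comparing the semidiscrete solutions on the grids of `N` and of `2N`
cells, and the weak solution is identified only in the limit.

*A priori estimates.* All bounds come from maximum principles. Written with the Neumann-type
operator `neumannOp`, `Ω` differs from a heat operator by the Robin terms `-α E N f(0)` and
`β E N f(N-1)`. Explicit barriers absorb these terms and give the sup bound `exists_sup_bound`,
even for sources of size `N` at the two end points, and the lower bound `exists_lower_bound`.
Doubling the variables and comparing `y_i - y_j` with a concave function of `i - j` gives the
gradient bound `gradient_bound`. Together they form `exists_C1_bound`. Since `Ω λ` solves the same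
system as `λ`, the same bounds control the time derivative, hence the second differences.

*Comparison of `N` and `2N`.* The initial data `λ_0` need not satisfy the discrete boundary
conditions to second order. They are replaced on the fine grid by the grid values of
`exp (E ∫ ρ₀)` plus a cubic correction of size `1/N` (`exists_wellPrepared`), for which `Ω` of the
data is bounded and Lipschitz. The averages over pairs of neighbouring sites of the resulting
solution on `2N` cells satisfy the equation on `N` cells up to an error `O(1/N)` inside and `O(1)`
at the two ends. This is exactly what `exists_C1_bound` tolerates, so that the densities on the
two grids differ by `O(1/N)` (`exists_densityEstimates`).

*The limit.* Summed over `N, 2N, 4N, …` these differences form a geometric series, so the densities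
converge at rate `O(1/N)` to a continuous function (`exists_dyadic_limit`). Its integrals against a
test function are limits of the moments `-∑ ln λ_j (G_{j+1} - G_j) / (N ln (1 + E/N))`, whose time
derivative involves the current `Ω λ_j / λ_j = E N (q_{j+1} - q_j) - E² q_j (1 - q_j) + O(1/N)`.
Thus the limit satisfies the weak Burgers equation (`weak_equation_of_close`).

*Uniqueness.* The difference `u` of two weak solutions is tested with the second primitive of
itself: if `P` is the primitive of `u` of mean zero, `∫ P²` satisfies a Gronwall inequality
(`eq_zero_of_weak`). Hence the limit is the given weak solution.
-/


noncomputable section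

namespace BurgersProxy

open Set Filter Topology

/-! ### Maximum principle for finite systems -/

theorem hasDerivWithinAt_Ici_nonpos_of_min {f : ℝ → ℝ} {d t : ℝ} (ht : 0 < t)
    (hf : HasDerivWithinAt f d (Ici 0) t) (hmin : ∀ s ∈ Icc 0 t, f t ≤ f s) : d ≤ 0 := by
  have h := (hasDerivAt_iff_tendsto_slope_left_right.1 (hf.hasDerivAt (Ici_mem_nhds ht))).1
  refine le_of_tendsto h ?_
  have : Ioo 0 t ∈ 𝓝[<] t := Ioo_mem_nhdsLT ht
  filter_upwards [this] with s hs
  rw [slope_def_field]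
  exact div_nonpos_of_nonneg_of_nonpos (sub_nonneg.2 (hmin s ⟨hs.1.le, hs.2.le⟩))
    (sub_nonpos.2 hs.2.le)

/-- Minimum principle for a finite system of differentiable functions: only the derivative of a
component realising a negative minimum has to be bounded below. -/
theorem nonneg_of_min_principle {ι : Type*} (s : Finset ι) {y y' : ℝ → ι → ℝ} {T K : ℝ}
    (hd : ∀ t ∈ Icc 0 T, ∀ i ∈ s, HasDerivWithinAt (fun τ => y τ i) (y' t i) (Ici 0) t)
    (h0 : ∀ i ∈ s, 0 ≤ y 0 i)
    (hmin : ∀ t ∈ Icc 0 T, ∀ i ∈ s, y t i < 0 → (∀ k ∈ s, y t i ≤ y t k) →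
      K * y t i ≤ y' t i) :
    ∀ t ∈ Icc 0 T, ∀ i ∈ s, 0 ≤ y t i := by
  classical
  -- It suffices to show that `y + ε exp ((K + 1) t)` stays positive for every `ε > 0`.
  have key : ∀ ε > 0, ∀ t ∈ Icc 0 T, ∀ i ∈ s, 0 < y t i + ε * Real.exp ((K + 1) * t) := by
    intro ε hε
    by_contra hcon
    push Not at hcon
    obtain ⟨t₁, ht₁, i₁, hi₁, hneg₁⟩ := hcon
    have hcont : ∀ i ∈ s, ContinuousOn (fun t => y t i + ε * Real.exp ((K + 1) * t)) (Icc 0 T) := by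
      intro i hi
      refine ContinuousOn.add (fun t ht => ?_) (by fun_prop)
      exact ((hd t ht i hi).continuousWithinAt).mono Icc_subset_Ici_self
    let B : Set ℝ := ⋃ i ∈ s, {t ∈ Icc 0 T | y t i + ε * Real.exp ((K + 1) * t) ≤ 0}
    have hBc : IsClosed B := by
      refine isClosed_biUnion_finset fun i hi => ?_
      exact (hcont i hi).preimage_isClosed_of_isClosed isClosed_Icc isClosed_Iic
    have hBsub : B ⊆ Icc 0 T := iUnion₂_subset fun i _ t ht => ht.1
    have hBne : B.Nonempty := ⟨t₁, mem_iUnion₂.2 ⟨i₁, hi₁, ht₁, hneg₁⟩⟩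
    obtain ⟨t, htB, htl⟩ := (isCompact_Icc.of_isClosed_subset hBc hBsub).exists_isLeast hBne
    obtain ⟨i₀, hi₀, htI, hi₀neg⟩ := mem_iUnion₂.1 htB
    obtain ⟨i, hi, him⟩ := s.exists_min_image (fun i => y t i) ⟨i₀, hi₀⟩
    have hineg : y t i + ε * Real.exp ((K + 1) * t) ≤ 0 := by linarith [him i₀ hi₀]
    have htpos : 0 < t := by
      rcases htI.1.lt_or_eq with h | h
      · exact h
      · subst h
        have := h0 i hi
        simp at hineg
        linarith
    have hbefore : ∀ τ ∈ Ico 0 t, 0 < y τ i + ε * Real.exp ((K + 1) * τ) := by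
      intro τ hτ
      by_contra hle
      exact absurd (htl (mem_iUnion₂.2 ⟨i, hi, ⟨hτ.1, hτ.2.le.trans htI.2⟩, not_lt.1 hle⟩))
        (not_le.2 hτ.2)
    have hder : HasDerivWithinAt (fun τ => y τ i + ε * Real.exp ((K + 1) * τ))
        (y' t i + ε * (Real.exp ((K + 1) * t) * ((K + 1) * 1))) (Ici 0) t :=
      (hd t htI i hi).add
        ((((hasDerivAt_id t).const_mul (K + 1)).exp.const_mul ε).hasDerivWithinAt)
    have hzero : y t i + ε * Real.exp ((K + 1) * t) = 0 := by
      refine le_antisymm hineg ?_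
      have hcw : ContinuousWithinAt (fun τ => y τ i + ε * Real.exp ((K + 1) * τ)) (Iio t) t :=
        ((hder.hasDerivAt (Ici_mem_nhds htpos)).continuousAt).continuousWithinAt
      refine ge_of_tendsto hcw.tendsto ?_
      filter_upwards [Ico_mem_nhdsLT htpos] with τ hτ using (hbefore τ hτ).le
    have hnonpos := hasDerivWithinAt_Ici_nonpos_of_min htpos hder (fun τ hτ => by
      rcases hτ.2.lt_or_eq with h | h
      · exact hineg.trans (hbefore τ ⟨hτ.1, h⟩).le
      · rw [h])
    have hexp : 0 < ε * Real.exp ((K + 1) * t) := by positivity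
    have := hmin t htI i hi (by linarith) him
    have hyi : y t i = -(ε * Real.exp ((K + 1) * t)) := by linarith
    rw [hyi] at this
    nlinarith
  intro t ht i hi
  by_contra hneg
  push Not at hneg
  have hexp := Real.exp_pos ((K + 1) * t)
  have := key (-(y t i) / Real.exp ((K + 1) * t)) (div_pos (by linarith) hexp) t ht i hi
  rw [div_mul_cancel₀ _ hexp.ne'] at this
  linarith

/-! ### The operator `Ω` and its barriers -/

/-- The part of `Ω` that annihilates constants. The value at `0` involves `f (0 - 1) = f 0`
(truncated subtraction) and the value at `N - 1` has no right neighbour, so both ends carry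
reflecting conditions. -/
def neumannOp (E : ℝ) (N : ℕ) (f : ℕ → ℝ) (j : ℕ) : ℝ :=
  (N : ℝ) ^ 2 * (1 + E / N) * (f (j - 1) - f j) +
    if j + 1 < N then (N : ℝ) ^ 2 * (f (j + 1) - f j) else 0

theorem Omega_eq_neumannOp (E α β : ℝ) {N : ℕ} (hN : 2 ≤ N) (f : ℕ → ℝ) {j : ℕ} (hj : j < N) :
    Omega E α β N f j = neumannOp E N f j + ((if j = 0 then -α * E * N * f 0 else 0) +
      if j = N - 1 then β * E * N * f (N - 1) else 0) := by
  have hN0 : (N : ℝ) ≠ 0 := by positivity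
  unfold Omega neumannOp gradPlus gradMinus discreteLaplacian
  by_cases h0 : j = 0
  · subst h0
    have h1 : 0 + 1 < N := by omega
    have h2 : ¬ (0 = N - 1) := by omega
    simp only [if_true, if_pos h1, if_neg h2]
    simp
    ring
  by_cases h1 : j = N - 1
  · subst h1
    have h2 : ¬ (N - 1 + 1 < N) := by omega
    simp only [if_neg h0, if_neg h2, if_true]
    field_simp
    ring
  · have h2 : j + 1 < N := by omega
    simp only [if_neg h0, if_neg h1, if_pos h2]
    field_simp
    ring

theorem Omega_sub (E α β : ℝ) (N : ℕ) (f g : ℕ → ℝ) (j : ℕ) :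
    Omega E α β N (fun i => f i - g i) j = Omega E α β N f j - Omega E α β N g j := by
  unfold Omega gradPlus gradMinus discreteLaplacian
  split_ifs <;> ring

theorem Omega_add (E α β : ℝ) (N : ℕ) (f g : ℕ → ℝ) (j : ℕ) :
    Omega E α β N (fun i => f i + g i) j = Omega E α β N f j + Omega E α β N g j := by
  unfold Omega gradPlus gradMinus discreteLaplacian
  split_ifs <;> ring

theorem Omega_const_mul (E α β : ℝ) (N : ℕ) (a : ℝ) (f : ℕ → ℝ) (j : ℕ) :
    Omega E α β N (fun i => a * f i) j = a * Omega E α β N f j := by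
  unfold Omega gradPlus gradMinus discreteLaplacian
  split_ifs <;> ring

theorem Omega_congr (E α β : ℝ) {N : ℕ} {f g : ℕ → ℝ} (h : ∀ i < N, f i = g i)
    (hN : 2 ≤ N) {j : ℕ} (hj : j < N) : Omega E α β N f j = Omega E α β N g j := by
  have h0 := h 0 (by omega)
  have h1 := h (0 + 1) (by omega)
  have h2 := h (N - 1) (by omega)
  have h3 := h (N - 1 - 1) (by omega)
  have h4 := h j hj
  have h5 := h (j - 1) (by omega)
  unfold Omega gradPlus gradMinus discreteLaplacian
  split_ifs with a b
  · rw [h0, h1]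
  · rw [h2, h3]
  · rw [h4, h5, h (j + 1) (by omega)]

/-- Comparison principle: a supersolution of `y' = Ω y` that starts nonnegative stays so. -/
theorem nonneg_of_Omega_supersolution {E α β : ℝ} (hE : 0 < E) (hα : 0 ≤ α) (hβ : 0 ≤ β) {N : ℕ}
    (hN : 2 ≤ N) {T : ℝ} {y s : ℝ → ℕ → ℝ}
    (hd : ∀ t ∈ Icc 0 T, ∀ j < N, HasDerivWithinAt (fun τ => y τ j)
      (Omega E α β N (y t) j + s t j) (Ici 0) t)
    (hs : ∀ t ∈ Icc 0 T, ∀ j < N, 0 ≤ s t j) (h0 : ∀ j < N, 0 ≤ y 0 j) :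
    ∀ t ∈ Icc 0 T, ∀ j < N, 0 ≤ y t j := by
  have hNpos : (0 : ℝ) < N := by exact_mod_cast (by omega : 0 < N)
  have := nonneg_of_min_principle (Finset.range N) (y := y)
    (y' := fun t j => Omega E α β N (y t) j + s t j) (T := T) (K := β * E * N)
    (fun t ht j hj => hd t ht j (Finset.mem_range.1 hj))
    (fun j hj => h0 j (Finset.mem_range.1 hj)) ?_
  · exact fun t ht j hj => this t ht j (Finset.mem_range.2 hj)
  intro t ht j hj hneg hmin
  have hj := Finset.mem_range.1 hj
  have hmin' : ∀ k < N, 0 ≤ y t k - y t j := fun k hk =>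
    sub_nonneg.2 (hmin k (Finset.mem_range.2 hk))
  have hs' := hs t ht j hj
  rw [Omega_eq_neumannOp E α β hN _ hj]
  have hL : 0 ≤ neumannOp E N (y t) j := by
    unfold neumannOp
    have h1 : 0 ≤ (N : ℝ) ^ 2 * (1 + E / N) * (y t (j - 1) - y t j) :=
      mul_nonneg (by positivity) (hmin' _ (by omega))
    split_ifs with h
    · exact add_nonneg h1 (mul_nonneg (by positivity) (hmin' _ h))
    · simpa using h1
  have hA : 0 ≤ (if j = 0 then -α * E * N * y t 0 else 0) := by
    split_ifs with h
    · subst h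
      nlinarith [mul_nonneg (mul_nonneg hα hE.le) hNpos.le]
    · exact le_rfl
  have hb : 0 ≤ β * E * N := by positivity
  have hB : β * E * N * y t j ≤ (if j = N - 1 then β * E * N * y t (N - 1) else 0) := by
    split_ifs with h
    · subst h; exact le_rfl
    · nlinarith
  linarith

/-- A positive function with relative slope about `κ x` at `x = j / N`. -/
def ramp (κ : ℝ) (N j : ℕ) : ℝ := ∏ i ∈ Finset.range j, (1 + κ * ((i : ℝ) + 1) / (N : ℝ) ^ 2)

theorem ramp_succ (κ : ℝ) (N j : ℕ) :
    ramp κ N (j + 1) = ramp κ N j * (1 + κ * ((j : ℝ) + 1) / (N : ℝ) ^ 2) := by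
  simp [ramp, Finset.prod_range_succ]

theorem one_le_ramp {κ : ℝ} (hκ : 0 ≤ κ) (N j : ℕ) : 1 ≤ ramp κ N j := by
  induction j with
  | zero => simp [ramp]
  | succ j ih =>
    rw [ramp_succ]
    have : 0 ≤ κ * ((j : ℝ) + 1) / (N : ℝ) ^ 2 := by positivity
    nlinarith

theorem ramp_le_exp {κ : ℝ} (hκ : 0 ≤ κ) {N j : ℕ} (hj : j ≤ N) : ramp κ N j ≤ Real.exp κ := by
  rcases Nat.eq_zero_or_pos N with h | hN
  · obtain rfl : j = 0 := by omega
    simpa [ramp] using hκ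
  have hN' : (0 : ℝ) < N := by exact_mod_cast hN
  have key : ∀ i ≤ N, ramp κ N i ≤ Real.exp (κ / N * i) := by
    intro i
    induction i with
    | zero => intro _; simp [ramp]
    | succ i ih =>
      intro hi
      rw [ramp_succ]
      push_cast
      rw [show κ / N * ((i : ℝ) + 1) = κ / N * i + κ / N by ring, Real.exp_add]
      have hi' : (i : ℝ) + 1 ≤ N := by exact_mod_cast hi
      refine mul_le_mul (ih (by omega)) ?_ (by positivity) (Real.exp_pos _).le
      have h1 : κ * ((i : ℝ) + 1) / (N : ℝ) ^ 2 ≤ κ / N := by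
        rw [div_le_div_iff₀ (by positivity) hN']
        nlinarith [mul_le_mul_of_nonneg_left hi' (mul_nonneg hκ hN'.le)]
      linarith [Real.add_one_le_exp (κ / N)]
  refine (key j hj).trans (Real.exp_le_exp.2 ?_)
  have : (j : ℝ) ≤ N := by exact_mod_cast hj
  calc κ / N * j ≤ κ / N * N := by gcongr
    _ = κ := by field_simp

/-- The ramp is a strict supersolution for `Ω`, with room of order `N` at the two end points. -/
theorem Omega_ramp_le {E α β : ℝ} (hE : 0 < E) (hβ : β ≤ 1) {N : ℕ}
    (hN : 2 ≤ N) {κ : ℝ} (hκ : κ = 2 * (E + 1)) {j : ℕ} (hj : j < N) :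
    Omega E α β N (ramp κ N) j + (if j = 0 then α * E * N else if j = N - 1 then (N : ℝ) else 0)
      ≤ κ * (1 + κ) * ramp κ N j := by
  have hκ0 : 0 < κ := by rw [hκ]; positivity
  have hN2 : (2 : ℝ) ≤ N := by exact_mod_cast hN
  have hN0 : (0 : ℝ) < N := by linarith
  unfold Omega gradPlus gradMinus discreteLaplacian
  rcases j with _ | j
  · simp only [if_true, ramp_succ]
    have h0 : ramp κ N 0 = 1 := by simp [ramp]
    rw [h0]
    have : (-α * E * N * 1 + N * (N * (1 * (1 + κ * (((0 : ℕ) : ℝ) + 1) / (N : ℝ) ^ 2) - 1)) +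
      α * E * N) = κ := by
      field_simp
      push_cast
      ring
    rw [this]
    nlinarith
  simp only [Nat.succ_ne_zero, if_false, Nat.add_sub_cancel]
  have hS := one_le_ramp hκ0.le N j
  have hj1 : (j : ℝ) + 1 < N := by exact_mod_cast hj
  by_cases h1 : j + 1 = N - 1
  · have h2 : N - 1 - 1 = j := by omega
    have h3 : N - 1 = j + 1 := by omega
    have h4 : (N : ℝ) = j + 2 := by exact_mod_cast (by omega : N = j + 2)
    rw [if_pos h1, if_pos h1, h2, h3, ramp_succ]
    set S := ramp κ N j
    have e1 : β * E * N * (S * (1 + κ * ((j : ℝ) + 1) / (N : ℝ) ^ 2)) ≤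
        1 * E * N * (S * (1 + κ * ((j : ℝ) + 1) / (N : ℝ) ^ 2)) := by
      have : 0 ≤ E * N * (S * (1 + κ * ((j : ℝ) + 1) / (N : ℝ) ^ 2)) := by positivity
      nlinarith
    have e2 : 1 * E * N * (S * (1 + κ * ((j : ℝ) + 1) / (N : ℝ) ^ 2)) -
        N * (1 + E / N) * (-(N : ℝ) * (S - S * (1 + κ * ((j : ℝ) + 1) / (N : ℝ) ^ 2))) + N
        = S * (E * N - κ * (j + 1)) + N := by
      field_simp
      ring
    have e3 : 0 ≤ κ * (1 + κ) * (S * (1 + κ * ((j : ℝ) + 1) / (N : ℝ) ^ 2)) := by positivity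
    have e4 : E * N - κ * (j + 1) ≤ -N := by
      rw [hκ, h4]; nlinarith [(Nat.cast_nonneg j : (0:ℝ) ≤ j)]
    nlinarith
  · rw [if_neg h1, if_neg h1, ramp_succ κ N (j + 1), ramp_succ]
    set S := ramp κ N j
    push_cast
    set a := κ * ((j : ℝ) + 1) / (N : ℝ) ^ 2 with ha
    have ha0 : 0 ≤ a := by positivity
    have hNa : (N : ℝ) ^ 2 * a = κ * (j + 1) := by rw [ha]; field_simp
    have e1 : (N : ℝ) ^ 2 * (S * (1 + a) * (1 + κ * ((j : ℝ) + 1 + 1) / (N : ℝ) ^ 2) + S -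
        2 * (S * (1 + a))) = S * (1 + a) * κ * (j + 1 + 1) - S * (N ^ 2 * a) := by
      field_simp
      ring
    rw [e1, hNa]
    have e2 : 0 ≤ E * (-(N : ℝ) * (S - S * (1 + a))) := by
      have : -(N : ℝ) * (S - S * (1 + a)) = N * S * a := by ring
      rw [this]; positivity
    have e3 : a * (j + 1) ≤ κ := by
      rw [ha, div_mul_eq_mul_div, div_le_iff₀ (by positivity)]
      have : ((j : ℝ) + 1) * (j + 1) ≤ N * N := by nlinarith [(Nat.cast_nonneg j : (0:ℝ) ≤ j)]
      nlinarith
    have e4 : S * (1 + a) * κ * (j + 1 + 1) - S * (κ * (j + 1)) =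
        S * κ * (1 + a + a * (j + 1)) := by ring
    rw [e4]
    have e5 : S * κ * (1 + a + a * (j + 1)) ≤ S * κ * ((1 + a) * (1 + κ)) := by
      apply mul_le_mul_of_nonneg_left _ (by positivity)
      nlinarith
    nlinarith

/-- Sup-norm estimate for `y' = Ω y + s`: a source of size `N` is harmless at the end points. -/
theorem exists_sup_bound {E α β : ℝ} (hE : 0 < E) (hα : 0 < α) (hβ : β ∈ Ioo (0 : ℝ) 1)
    (T : ℝ) : ∃ C, 1 ≤ C ∧ ∀ N : ℕ, 2 ≤ N → ∀ (K : ℝ), 0 ≤ K → ∀ y s : ℝ → ℕ → ℝ,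
      (∀ t ∈ Icc 0 T, ∀ j < N, HasDerivWithinAt (fun τ => y τ j)
        (Omega E α β N (y t) j + s t j) (Ici 0) t) →
      (∀ t ∈ Icc 0 T, ∀ j < N, |s t j| ≤ N * K) →
      (∀ t ∈ Icc 0 T, ∀ j < N, 0 < j → j + 1 < N → |s t j| ≤ K) →
      (∀ j < N, |y 0 j| ≤ K) →
      ∀ t ∈ Icc 0 T, ∀ j < N, |y t j| ≤ C * K := by
  -- `A` makes the barrier absorb a source of size `N * K` at the left end, where the operator gains
  -- only the factor `α * E`; the extra `1` in `μ` absorbs the source in the interior.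
  set κ := 2 * (E + 1) with hκ
  set μ := κ * (1 + κ) + 1 with hμ
  set A := 1 + 1 / (α * E) with hA
  have hκ0 : 0 < κ := by positivity
  have hμ0 : 0 < μ := by positivity
  have hA1 : 1 ≤ A := by
    have : 0 ≤ 1 / (α * E) := by positivity
    linarith
  have hAα : 1 ≤ A * (α * E) := by
    have : 1 / (α * E) * (α * E) = 1 := by field_simp
    have : 0 < α * E := by positivity
    nlinarith
  refine ⟨A * Real.exp (μ * |T|) * Real.exp κ, ?_, ?_⟩
  · have h1 : 1 ≤ Real.exp (μ * |T|) := Real.one_le_exp (by positivity)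
    have h2 : 1 ≤ Real.exp κ := Real.one_le_exp hκ0.le
    exact one_le_mul_of_one_le_of_one_le (one_le_mul_of_one_le_of_one_le hA1 h1) h2
  intro N hN K hK y s hd hsN hsK hy0
  have hN2 : (2 : ℝ) ≤ N := by exact_mod_cast hN
  -- Compare `± y` with the barrier `A K exp (μ t) ramp`.
  have key : ∀ σ : ℝ, |σ| = 1 → ∀ t ∈ Icc 0 T, ∀ j < N,
      0 ≤ A * K * Real.exp (μ * t) * ramp κ N j - σ * y t j := by
    intro σ hσ
    refine nonneg_of_Omega_supersolution hE hα.le hβ.1.le hN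
      (y := fun t j => A * K * Real.exp (μ * t) * ramp κ N j - σ * y t j)
      (s := fun t j => A * K * Real.exp (μ * t) * (μ * ramp κ N j - Omega E α β N (ramp κ N) j)
        - σ * s t j) ?_ ?_ ?_
    · intro t ht j hj
      have h1 : HasDerivWithinAt (fun τ => A * K * Real.exp (μ * τ) * ramp κ N j)
          (A * K * (Real.exp (μ * t) * (μ * 1)) * ramp κ N j) (Ici 0) t :=
        (((((hasDerivAt_id t).const_mul μ).exp).const_mul (A * K)).mul_const
          (ramp κ N j)).hasDerivWithinAt
      refine (h1.sub ((hd t ht j hj).const_mul σ)).congr_deriv ?_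
      rw [Omega_sub, Omega_const_mul, Omega_const_mul]
      ring
    · intro t ht j hj
      have h1 := Omega_ramp_le (α := α) hE hβ.2.le hN hκ hj
      have h2 := one_le_ramp hκ0.le N j
      have hexp : 1 ≤ Real.exp (μ * t) := Real.one_le_exp (mul_nonneg hμ0.le ht.1)
      have hAK : K ≤ A * K * Real.exp (μ * t) := by
        have : 1 ≤ A * Real.exp (μ * t) := one_le_mul_of_one_le_of_one_le hA1 hexp
        nlinarith
      have hσs : σ * s t j ≤ |s t j| := by
        calc σ * s t j ≤ |σ * s t j| := le_abs_self _
          _ = |s t j| := by rw [abs_mul, hσ, one_mul]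
      have hAK0 : 0 ≤ A * K * Real.exp (μ * t) := by positivity
      by_cases hj0 : j = 0
      · rw [if_pos hj0] at h1
        have h3 := hsN t ht j hj
        have h4 : α * E * N ≤ μ * ramp κ N j - Omega E α β N (ramp κ N) j := by
          rw [hμ]; linarith
        have h5 := mul_le_mul_of_nonneg_left h4 hAK0
        have h6 : N * K ≤ A * K * Real.exp (μ * t) * (α * E * N) := by
          have e : A * K * Real.exp (μ * t) * (α * E * N) =
            (A * (α * E)) * Real.exp (μ * t) * (N * K) := by ring
          rw [e]
          have := one_le_mul_of_one_le_of_one_le hAα hexp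
          have hNK : 0 ≤ N * K := by positivity
          nlinarith
        linarith
      by_cases hj1 : j = N - 1
      · rw [if_neg hj0, if_pos hj1] at h1
        have h3 := hsN t ht j hj
        have h4 : (N : ℝ) ≤ μ * ramp κ N j - Omega E α β N (ramp κ N) j := by
          rw [hμ]; linarith
        have h5 := mul_le_mul_of_nonneg_left h4 hAK0
        have h6 : N * K ≤ A * K * Real.exp (μ * t) * N := by nlinarith
        linarith
      · rw [if_neg hj0, if_neg hj1] at h1
        have h3 := hsK t ht j hj (by omega) (by omega)
        have h4 : 1 ≤ μ * ramp κ N j - Omega E α β N (ramp κ N) j := by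
          rw [hμ]; linarith
        have h5 := mul_le_mul_of_nonneg_left h4 hAK0
        linarith
    · intro j hj
      have h2 := one_le_ramp hκ0.le N j
      have hσs : σ * y 0 j ≤ |y 0 j| := by
        calc σ * y 0 j ≤ |σ * y 0 j| := le_abs_self _
          _ = |y 0 j| := by rw [abs_mul, hσ, one_mul]
      have h3 := hy0 j hj
      have h4 : K ≤ A * K * ramp κ N j := by
        have := one_le_mul_of_one_le_of_one_le hA1 h2
        nlinarith
      simp only [mul_zero, Real.exp_zero, mul_one]
      linarith
  intro t ht j hj
  have h1 := key 1 (by simp) t ht j hj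
  have h2 := key (-1) (by simp) t ht j hj
  have h3 : A * K * Real.exp (μ * t) * ramp κ N j ≤
      A * Real.exp (μ * |T|) * Real.exp κ * K := by
    have e1 : Real.exp (μ * t) ≤ Real.exp (μ * |T|) :=
      Real.exp_le_exp.2 (mul_le_mul_of_nonneg_left (ht.2.trans (le_abs_self T)) hμ0.le)
    have e2 := ramp_le_exp hκ0.le hj.le
    have e3 := one_le_ramp hκ0.le N j
    calc A * K * Real.exp (μ * t) * ramp κ N j
        ≤ A * K * Real.exp (μ * |T|) * Real.exp κ := by gcongr
      _ = _ := by ring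
  rw [abs_le]
  constructor <;> linarith

/-- A positive function with relative slope about `E (1 - x)` at `x = j / N`. -/
def revRamp (E : ℝ) (N j : ℕ) : ℝ :=
  ∏ i ∈ Finset.range j, (1 + E * ((N : ℝ) - 2 - i) / (N : ℝ) ^ 2)

theorem revRamp_succ (E : ℝ) (N j : ℕ) :
    revRamp E N (j + 1) = revRamp E N j * (1 + E * ((N : ℝ) - 2 - j) / (N : ℝ) ^ 2) := by
  simp [revRamp, Finset.prod_range_succ]

theorem one_le_revRamp {E : ℝ} (hE : 0 ≤ E) {N j : ℕ} (hj : j < N) : 1 ≤ revRamp E N j := by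
  induction j with
  | zero => simp [revRamp]
  | succ j ih =>
    rw [revRamp_succ]
    have h := ih (by omega)
    have hj' : 0 ≤ (N : ℝ) - 2 - j := by
      have : (j : ℝ) + 2 ≤ N := by exact_mod_cast hj
      linarith
    have : 0 ≤ E * ((N : ℝ) - 2 - j) / (N : ℝ) ^ 2 := by positivity
    nlinarith

theorem revRamp_le_exp {E : ℝ} (hE : 0 ≤ E) {N j : ℕ} (hj : j < N) :
    revRamp E N j ≤ Real.exp E := by
  have hN' : (0 : ℝ) < N := by exact_mod_cast (by omega : 0 < N)
  have key : ∀ i < N, revRamp E N i ≤ Real.exp (E / N * i) := by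
    intro i
    induction i with
    | zero => intro _; simp [revRamp]
    | succ i ih =>
      intro hi
      rw [revRamp_succ]
      push_cast
      rw [show E / N * ((i : ℝ) + 1) = E / N * i + E / N by ring, Real.exp_add]
      have hi' : (i : ℝ) + 2 ≤ N := by exact_mod_cast hi
      have hpos : 0 ≤ E * ((N : ℝ) - 2 - i) / (N : ℝ) ^ 2 :=
        div_nonneg (mul_nonneg hE (by linarith)) (by positivity)
      refine mul_le_mul (ih (by omega)) ?_ (by linarith) (Real.exp_pos _).le
      have h1 : E * ((N : ℝ) - 2 - i) / (N : ℝ) ^ 2 ≤ E / N := by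
        rw [div_le_div_iff₀ (by positivity) hN']
        have : (N : ℝ) - 2 - i ≤ N := by linarith [(Nat.cast_nonneg i : (0 : ℝ) ≤ i)]
        nlinarith [mul_le_mul_of_nonneg_left this (mul_nonneg hE hN'.le)]
      linarith [Real.add_one_le_exp (E / N)]
  refine (key j hj).trans (Real.exp_le_exp.2 ?_)
  have : (j : ℝ) ≤ N := by exact_mod_cast hj.le
  calc E / N * j ≤ E / N * N := by gcongr
    _ = E := by field_simp

theorem neg_le_Omega_revRamp {E α β : ℝ} (hE : 0 < E) (hα : α ≤ 1) (hβ : 0 ≤ β) {N : ℕ}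
    (hN : 2 ≤ N) {j : ℕ} (hj : j < N) :
    -(2 * E + E * (1 + E)) * revRamp E N j ≤ Omega E α β N (revRamp E N) j := by
  have hN2 : (2 : ℝ) ≤ N := by exact_mod_cast hN
  have hN0 : (0 : ℝ) < N := by linarith
  unfold Omega gradPlus gradMinus discreteLaplacian
  rcases j with _ | j
  · simp only [if_true, revRamp_succ]
    have h0 : revRamp E N 0 = 1 := by simp [revRamp]
    rw [h0]
    have : (-α * E * N * 1 + N * (N * (1 * (1 + E * ((N : ℝ) - 2 - (0 : ℕ)) / (N : ℝ) ^ 2) - 1)))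
        = E * N * (1 - α) - 2 * E := by
      field_simp
      push_cast
      ring
    rw [this]
    have : 0 ≤ E * N * (1 - α) := mul_nonneg (by positivity) (by linarith)
    nlinarith
  simp only [Nat.succ_ne_zero, if_false, Nat.add_sub_cancel]
  have hS := one_le_revRamp hE.le (show j < N by omega)
  by_cases h1 : j + 1 = N - 1
  · have h2 : N - 1 - 1 = j := by omega
    have h3 : N - 1 = j + 1 := by omega
    have h4 : (N : ℝ) = j + 2 := by exact_mod_cast (by omega : N = j + 2)
    rw [if_pos h1, h2, h3, revRamp_succ]
    have h5 : (N : ℝ) - 2 - j = 0 := by rw [h4]; ring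
    rw [h5]
    set S := revRamp E N j
    have e1 : 0 ≤ β * E * N * S := by positivity
    have e2 : 0 ≤ (2 * E + E * (1 + E)) * S := by positivity
    have e3 : β * E * N * (S * (1 + E * 0 / (N : ℝ) ^ 2)) -
        N * (1 + E / N) * (-(N : ℝ) * (S - S * (1 + E * 0 / (N : ℝ) ^ 2))) = β * E * N * S := by
      ring
    rw [e3]
    have e4 : -(2 * E + E * (1 + E)) * (S * (1 + E * 0 / (N : ℝ) ^ 2)) =
      -((2 * E + E * (1 + E)) * S) := by ring
    rw [e4]
    linarith
  · have hj3 : (j : ℝ) + 3 ≤ N := by exact_mod_cast (by omega : j + 3 ≤ N)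
    rw [if_neg h1, revRamp_succ E N (j + 1), revRamp_succ]
    set S := revRamp E N j
    push_cast
    set a := E * ((N : ℝ) - 2 - j) / (N : ℝ) ^ 2 with ha
    have ha0 : 0 ≤ a := div_nonneg (mul_nonneg hE.le (by linarith)) (by positivity)
    have e1 : (N : ℝ) ^ 2 * (S * (1 + a) * (1 + E * ((N : ℝ) - 2 - (j + 1)) / (N : ℝ) ^ 2) + S -
        2 * (S * (1 + a))) - E * (-(N : ℝ) * (S - S * (1 + a))) =
        S * ((1 + a) * (E * ((N : ℝ) - 2 - (j + 1))) - N ^ 2 * a - E * (N * a)) := by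
      field_simp
      ring
    have hNa : (N : ℝ) ^ 2 * a = E * (N - 2 - j) := by rw [ha]; field_simp
    have hNa' : N * a ≤ E := by
      have : N * (N * a) ≤ N * E := by nlinarith [(Nat.cast_nonneg j : (0 : ℝ) ≤ j)]
      exact le_of_mul_le_mul_left this hN0
    rw [e1, hNa]
    have e2 : 0 ≤ a * (E * ((N : ℝ) - 2 - (j + 1))) :=
      mul_nonneg ha0 (mul_nonneg hE.le (by linarith))
    have e3 : -(E * (1 + E)) ≤ (1 + a) * (E * ((N : ℝ) - 2 - (j + 1))) - E * (N - 2 - j)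
        - E * (N * a) := by nlinarith
    have e4 := mul_le_mul_of_nonneg_left e3 (by linarith : 0 ≤ S)
    have e5 : 0 ≤ E * S := by positivity
    have e6 : 0 ≤ E * (1 + E) * (S * a) := by positivity
    have e7 : 0 ≤ E * (S * a) := by positivity
    nlinarith

/-- Solutions of `y' = Ω y` that start above `1` are bounded away from zero, uniformly in `N`. -/
theorem exists_lower_bound {E α β : ℝ} (hE : 0 < E) (hα : α ∈ Ioo (0 : ℝ) 1)
    (hβ : β ∈ Ioo (0 : ℝ) 1) (T : ℝ) : ∃ c, 0 < c ∧ ∀ N : ℕ, 2 ≤ N → ∀ y : ℝ → ℕ → ℝ,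
      (∀ t ∈ Icc 0 T, ∀ j < N, HasDerivWithinAt (fun τ => y τ j)
        (Omega E α β N (y t) j) (Ici 0) t) →
      (∀ j < N, 1 ≤ y 0 j) → ∀ t ∈ Icc 0 T, ∀ j < N, c ≤ y t j := by
  set μ := 2 * E + E * (1 + E) with hμ
  have hμ0 : 0 < μ := by positivity
  refine ⟨Real.exp (-E) * Real.exp (-μ * |T|), by positivity, ?_⟩
  intro N hN y hd hy0 t ht j hj
  have key := nonneg_of_Omega_supersolution hE hα.1.le hβ.1.le hN (T := T)
    (y := fun t j => y t j - Real.exp (-E) * Real.exp (-μ * t) * revRamp E N j)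
    (s := fun t j => Real.exp (-E) * Real.exp (-μ * t) *
      (Omega E α β N (revRamp E N) j - -μ * revRamp E N j)) ?_ ?_ ?_ t ht j hj
  · have h1 := one_le_revRamp hE.le hj
    have h2 : Real.exp (-μ * |T|) ≤ Real.exp (-μ * t) :=
      Real.exp_le_exp.2 (by nlinarith [ht.2.trans (le_abs_self T)])
    have h3 : Real.exp (-E) * Real.exp (-μ * |T|) ≤
        Real.exp (-E) * Real.exp (-μ * t) * revRamp E N j := by
      calc Real.exp (-E) * Real.exp (-μ * |T|) ≤ Real.exp (-E) * Real.exp (-μ * t) := by gcongr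
        _ ≤ _ := le_mul_of_one_le_right (by positivity) h1
    linarith
  · intro t ht j hj
    have h1 : HasDerivWithinAt (fun τ => Real.exp (-E) * Real.exp (-μ * τ) * revRamp E N j)
        (Real.exp (-E) * (Real.exp (-μ * t) * (-μ * 1)) * revRamp E N j) (Ici 0) t :=
      (((((hasDerivAt_id t).const_mul (-μ)).exp).const_mul (Real.exp (-E))).mul_const
        (revRamp E N j)).hasDerivWithinAt
    refine ((hd t ht j hj).sub h1).congr_deriv ?_
    rw [Omega_sub, Omega_const_mul]
    ring
  · intro t ht j hj
    have := neg_le_Omega_revRamp hE hα.2.le hβ.1.le hN hj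
    exact mul_nonneg (by positivity) (by linarith)
  · intro j hj
    have h1 := revRamp_le_exp hE.le hj
    have h2 : Real.exp (-E) * revRamp E N j ≤ 1 := by
      calc Real.exp (-E) * revRamp E N j ≤ Real.exp (-E) * Real.exp E := by gcongr
        _ = 1 := by rw [← Real.exp_add]; simp
    have h3 := hy0 j hj
    simp only [mul_zero, Real.exp_zero, mul_one]
    linarith

/-! ### Gradient estimate by doubling of variables -/

/-- Gradient estimate for the reflecting operator: `y i - y j` is compared, on the triangle
`j ≤ i`, with a concave increasing function of `(i - j) / N`. Sources of size `N` at the end points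
are absorbed by the slope of that function. -/
theorem gradient_bound {E : ℝ} (hE : 0 < E) {N : ℕ} (hN : 2 ≤ N) {T K : ℝ} (hK : 0 ≤ K)
    {y s : ℝ → ℕ → ℝ}
    (hd : ∀ t ∈ Icc 0 T, ∀ j < N, HasDerivWithinAt (fun τ => y τ j)
      (neumannOp E N (y t) j + s t j) (Ici 0) t)
    (hsN : ∀ t ∈ Icc 0 T, ∀ j < N, |s t j| ≤ N * K)
    (hsK : ∀ t ∈ Icc 0 T, ∀ j < N, 0 < j → j + 1 < N → |s t j| ≤ K)
    (hy0 : ∀ j, j + 1 < N → |y 0 (j + 1) - y 0 j| ≤ K / N) :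
    ∀ t ∈ Icc 0 T, ∀ j, j + 1 < N → |y t (j + 1) - y t j| ≤ 4 * K / N := by
  have hN2 : (2 : ℝ) ≤ N := by exact_mod_cast hN
  have hN0 : (0 : ℝ) < N := by linarith
  -- The slope of `ψ` is at least `2 * K`, and its second difference is `-2 * K / N ^ 2`.
  let ψ : ℕ → ℝ := fun k => 4 * K * (k / N) - K * (k / N) ^ 2
  have hψ2 : ∀ k, (N : ℝ) ^ 2 * (ψ (k + 2) - ψ (k + 1)) = N ^ 2 * (ψ (k + 1) - ψ k) - 2 * K := by
    intro k; simp only [ψ]; push_cast; field_simp; ring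
  have hψ1 : ∀ k, k < N → N * K * 2 ≤ (N : ℝ) ^ 2 * (ψ (k + 1) - ψ k) := by
    intro k hk
    have hk' : (k : ℝ) + 1 ≤ N := by exact_mod_cast hk
    have : (N : ℝ) ^ 2 * (ψ (k + 1) - ψ k) = K * (4 * N - (2 * k + 1)) := by
      simp only [ψ]; push_cast; field_simp; ring
    rw [this]
    nlinarith
  have hε : 0 < E / N := by positivity
  -- The estimate for increments over arbitrary distances, for `y` and for `-y`.
  have key : ∀ σ : ℝ, |σ| = 1 → ∀ t ∈ Icc 0 T,
      ∀ p ∈ (Finset.range N ×ˢ Finset.range N).filter (fun p => p.2 ≤ p.1),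
        0 ≤ ψ (p.1 - p.2) - σ * (y t p.1 - y t p.2) := by
    intro σ hσ
    refine nonneg_of_min_principle (K := 0) _
      (y := fun t (p : ℕ × ℕ) => ψ (p.1 - p.2) - σ * (y t p.1 - y t p.2))
      (y' := fun t p => -(σ * ((neumannOp E N (y t) p.1 + s t p.1) -
        (neumannOp E N (y t) p.2 + s t p.2)))) ?_ ?_ ?_
    · rintro t ht ⟨i, j⟩ hp
      simp only [Finset.mem_filter, Finset.mem_product, Finset.mem_range] at hp
      exact (((hd t ht i hp.1.1).sub (hd t ht j hp.1.2)).const_mul σ).const_sub _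
    · rintro ⟨i, j⟩ hp
      simp only [Finset.mem_filter, Finset.mem_product, Finset.mem_range] at hp
      obtain ⟨⟨hi, hj⟩, hji⟩ := hp
      obtain ⟨k, rfl⟩ := Nat.exists_eq_add_of_le hji
      have hkN : j + k < N := hi
      have h1 : ∀ m, j + m < N → |y 0 (j + m) - y 0 j| ≤ m * (K / N) := by
        intro m
        induction m with
        | zero => intro _; simp
        | succ m ih =>
          intro hm
          have e1 := ih (by omega)
          have e2 := hy0 (j + m) (by omega)
          have e3 : y 0 (j + (m + 1)) - y 0 j = (y 0 (j + m + 1) - y 0 (j + m)) +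
            (y 0 (j + m) - y 0 j) := by rw [← add_assoc]; ring
          rw [e3]
          push_cast
          linarith [abs_add_le (y 0 (j + m + 1) - y 0 (j + m)) (y 0 (j + m) - y 0 j)]
      have h2 := h1 k hkN
      have h3 : σ * (y 0 (j + k) - y 0 j) ≤ |y 0 (j + k) - y 0 j| := by
        calc _ ≤ |σ * (y 0 (j + k) - y 0 j)| := le_abs_self _
          _ = _ := by rw [abs_mul, hσ, one_mul]
      have h4 : k * (K / N) ≤ ψ k := by
        have hx : (k : ℝ) / N ≤ 1 := by
          rw [div_le_one hN0]; exact_mod_cast (by omega : k ≤ N)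
        have hx0 : 0 ≤ (k : ℝ) / N := by positivity
        have e : k * (K / N) = K * (k / N) := by ring
        rw [e]
        simp only [ψ]
        nlinarith [mul_nonneg hK hx0]
      simp only [Nat.add_sub_cancel_left]
      linarith
    · rintro t ht ⟨i, j⟩ hp hneg hmin
      simp only [Finset.mem_filter, Finset.mem_product, Finset.mem_range] at hp
      obtain ⟨⟨hi, hj⟩, hji⟩ := hp
      have hmin' : ∀ i' j', i' < N → j' < N → j' ≤ i' →
          ψ (i - j) - σ * (y t i - y t j) ≤ ψ (i' - j') - σ * (y t i' - y t j') := by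
        intro i' j' h1 h2 h3
        exact hmin (i', j') (by
          simp only [Finset.mem_filter, Finset.mem_product, Finset.mem_range]
          exact ⟨⟨h1, h2⟩, h3⟩)
      rcases hji.lt_or_eq with hlt | heq
      swap
      · subst heq
        simp [ψ] at hneg
      obtain ⟨k, rfl⟩ := Nat.exists_eq_add_of_lt hlt
      have ek : j + k + 1 - j = k + 1 := by omega
      have hkN : k < N := by omega
      rw [ek] at hmin'
      have hslope := hψ1 k hkN
      have hslope' := hψ2 k
      set D := (N : ℝ) ^ 2 * (ψ (k + 1) - ψ k) with hD
      have hNK : 0 ≤ N * K := by positivity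
      have hKN : K ≤ N * K := le_mul_of_one_le_left hK (by linarith)
      -- Upper bound for the operator at the larger index.
      have hσi : σ * s t (j + k + 1) ≤ |s t (j + k + 1)| := by
        calc _ ≤ |σ * s t (j + k + 1)| := le_abs_self _
          _ = _ := by rw [abs_mul, hσ, one_mul]
      have hσj : -(σ * s t j) ≤ |s t j| := by
        calc _ ≤ |σ * s t j| := neg_le_abs _
          _ = _ := by rw [abs_mul, hσ, one_mul]
      have hup : σ * (neumannOp E N (y t) (j + k + 1) + s t (j + k + 1)) ≤ -(E / N) * D - K := by
        have a1 := hmin' (j + k) j (by omega) hj (by omega)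
        rw [show j + k - j = k by omega] at a1
        have a2 : σ * (y t (j + k) - y t (j + k + 1)) ≤ -(ψ (k + 1) - ψ k) := by linarith
        have a3 := mul_le_mul_of_nonneg_left a2
          (show (0 : ℝ) ≤ (N : ℝ) ^ 2 * (1 + E / N) by positivity)
        unfold neumannOp
        rw [show j + k + 1 - 1 = j + k by omega]
        have a4 : (N : ℝ) ^ 2 * (1 + E / N) * -(ψ (k + 1) - ψ k) = -(1 + E / N) * D := by
          rw [hD]; ring
        rw [a4] at a3
        by_cases hb : j + k + 1 + 1 < N
        · rw [if_pos hb]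
          have b1 := hmin' (j + k + 1 + 1) j hb hj (by omega)
          rw [show j + k + 1 + 1 - j = k + 2 by omega] at b1
          have b2 : σ * (y t (j + k + 1 + 1) - y t (j + k + 1)) ≤ ψ (k + 2) - ψ (k + 1) := by
            linarith
          have b3 := mul_le_mul_of_nonneg_left b2 (show (0 : ℝ) ≤ (N : ℝ) ^ 2 by positivity)
          have b4 := hsK t ht _ hi (by omega) hb
          rw [hslope'] at b3
          have b6 : σ * ((N : ℝ) ^ 2 * (1 + E / N) * (y t (j + k) - y t (j + k + 1)) +
              (N : ℝ) ^ 2 * (y t (j + k + 1 + 1) - y t (j + k + 1)) + s t (j + k + 1)) =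
              (N : ℝ) ^ 2 * (1 + E / N) * (σ * (y t (j + k) - y t (j + k + 1))) +
              (N : ℝ) ^ 2 * (σ * (y t (j + k + 1 + 1) - y t (j + k + 1))) +
              σ * s t (j + k + 1) := by ring
          rw [b6]
          linarith
        · rw [if_neg hb]
          have b4 := hsN t ht _ hi
          have b6 : σ * ((N : ℝ) ^ 2 * (1 + E / N) * (y t (j + k) - y t (j + k + 1)) + 0 +
              s t (j + k + 1)) =
              (N : ℝ) ^ 2 * (1 + E / N) * (σ * (y t (j + k) - y t (j + k + 1))) +
              σ * s t (j + k + 1) := by ring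
          rw [b6]
          linarith
      -- Lower bound for the operator at the smaller index.
      have hlow : -(E / N) * D - K ≤ σ * (neumannOp E N (y t) j + s t j) := by
        have a1 := hmin' (j + k + 1) (j + 1) hi (by omega) (by omega)
        rw [show j + k + 1 - (j + 1) = k by omega] at a1
        have a2 : ψ (k + 1) - ψ k ≤ σ * (y t (j + 1) - y t j) := by linarith
        have a3 := mul_le_mul_of_nonneg_left a2 (show (0 : ℝ) ≤ (N : ℝ) ^ 2 by positivity)
        rw [← hD] at a3
        unfold neumannOp
        rw [if_pos (show j + 1 < N by omega)]
        have b6 : σ * ((N : ℝ) ^ 2 * (1 + E / N) * (y t (j - 1) - y t j) +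
            (N : ℝ) ^ 2 * (y t (j + 1) - y t j) + s t j) =
            (N : ℝ) ^ 2 * (1 + E / N) * (σ * (y t (j - 1) - y t j)) +
            (N : ℝ) ^ 2 * (σ * (y t (j + 1) - y t j)) + σ * s t j := by ring
        rw [b6]
        rcases Nat.eq_zero_or_pos j with hb | hb
        · have b4 := hsN t ht j hj
          have b7 : y t (j - 1) - y t j = 0 := by subst hb; simp
          rw [b7]
          have b8 : 0 ≤ E / N * D := mul_nonneg hε.le (by linarith)
          linarith
        · have b1 := hmin' (j + k + 1) (j - 1) hi (by omega) (by omega)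
          rw [show j + k + 1 - (j - 1) = k + 2 by omega] at b1
          have b2 : -(ψ (k + 2) - ψ (k + 1)) ≤
              σ * (y t (j - 1) - y t j) := by linarith
          have b3 := mul_le_mul_of_nonneg_left b2
            (show (0 : ℝ) ≤ (N : ℝ) ^ 2 * (1 + E / N) by positivity)
          have b4 := hsK t ht _ hj hb (by omega)
          have b5 : (N : ℝ) ^ 2 * (1 + E / N) *
              (-(ψ (k + 2) - ψ (k + 1))) =
              -(1 + E / N) * (D - 2 * K) := by
            rw [← hslope']; ring
          have b8 : 0 ≤ E / N * K := by positivity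
          linarith
      simp only [zero_mul, mul_sub]
      linarith
  intro t ht j hj
  have hmem : (j + 1, j) ∈ (Finset.range N ×ˢ Finset.range N).filter (fun p => p.2 ≤ p.1) := by
    simp only [Finset.mem_filter, Finset.mem_product, Finset.mem_range]
    omega
  have h1 := key 1 (by simp) t ht _ hmem
  have h2 := key (-1) (by simp) t ht _ hmem
  have h3 : ψ (j + 1 - j) ≤ 4 * K / N := by
    rw [show j + 1 - j = 1 by omega]
    simp only [ψ]
    have : 0 ≤ K * (((1 : ℕ) : ℝ) / N) ^ 2 := by positivity
    have e : 4 * K * (((1 : ℕ) : ℝ) / N) = 4 * K / N := by push_cast; ring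
    linarith
  rw [abs_le]
  simp only at h1 h2
  constructor <;> linarith

/-! ### The semidiscrete evolution -/

/-- If every component below `N` is differentiable in time, then so is `Ω` applied to it. -/
theorem hasDerivWithinAt_Omega {E α β : ℝ} {N : ℕ} (hN : 2 ≤ N) {y : ℝ → ℕ → ℝ} {y' : ℕ → ℝ}
    {S : Set ℝ} {t : ℝ} (h : ∀ j < N, HasDerivWithinAt (fun τ => y τ j) (y' j) S t) {j : ℕ}
    (hj : j < N) :
    HasDerivWithinAt (fun τ => Omega E α β N (y τ) j) (Omega E α β N y' j) S t := by
  unfold Omega gradPlus gradMinus discreteLaplacian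
  have h0 := h 0 (by omega)
  have h1 := h (0 + 1) (by omega)
  have h2 := h (N - 1) (by omega)
  have h3 := h (N - 1 - 1) (by omega)
  have h4 := h j hj
  have h5 := h (j - 1) (by omega)
  split_ifs with a b
  · exact (h0.const_mul _).add (((h1.sub h0).const_mul _).const_mul _)
  · exact (h2.const_mul _).sub (((h3.sub h2).const_mul _).const_mul _)
  · have h6 := h (j + 1) (by omega)
    exact (((h6.add h5).sub (h4.const_mul _)).const_mul _).sub
      (((h5.sub h4).const_mul _).const_mul _)

/-- Existence for the linear system `y' = Ω y`, by the exponential of the operator. -/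
theorem exists_Omega_solution (E α β : ℝ) (N : ℕ) (v : ℕ → ℝ) :
    ∃ y : ℝ → ℕ → ℝ, (∀ j < N, y 0 j = v j) ∧
      ∀ t, ∀ j < N, HasDerivAt (fun τ => y τ j) (Omega E α β N (y t) j) t := by
  -- `Ω` as an endomorphism of the finite-dimensional space of functions on `{0, …, N - 1}`.
  let ext : (Fin N → ℝ) → ℕ → ℝ := fun f j => if h : j < N then f ⟨j, h⟩ else 0
  have ext_add : ∀ f g, ext (f + g) = fun i => ext f i + ext g i := by
    intro f g; funext i; simp only [ext]; split_ifs <;> simp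
  have ext_smul : ∀ (a : ℝ) f, ext (a • f) = fun i => a * ext f i := by
    intro a f; funext i; simp only [ext]; split_ifs <;> simp
  let A : (Fin N → ℝ) →ₗ[ℝ] (Fin N → ℝ) :=
    { toFun := fun f i => Omega E α β N (ext f) i
      map_add' := fun f g => by funext i; simp only [ext_add, Omega_add, Pi.add_apply]
      map_smul' := fun a f => by
        funext i
        simp only [ext_smul, Omega_const_mul, Pi.smul_apply, smul_eq_mul, RingHom.id_apply] }
  let B : (Fin N → ℝ) →L[ℝ] (Fin N → ℝ) := LinearMap.toContinuousLinearMap A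
  let z : ℝ → Fin N → ℝ := fun t => NormedSpace.exp (t • B) (fun i => v i)
  have hz : ∀ t, HasDerivAt z (B (z t)) t := by
    intro t
    have h1 := hasDerivAt_exp_smul_const' B t
    have h2 := (ContinuousLinearMap.apply ℝ (Fin N → ℝ) (fun i : Fin N => v i)).hasFDerivAt
      (x := NormedSpace.exp (t • B))
    exact h2.comp_hasDerivAt t h1
  refine ⟨fun t => ext (z t), ?_, ?_⟩
  · intro j hj
    simp [ext, z, hj]
  · intro t j hj
    have h := (hasDerivAt_pi.1 (hz t)) ⟨j, hj⟩
    have e : (fun τ => ext (z τ) j) = fun τ => z τ ⟨j, hj⟩ := by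
      funext τ; simp [ext, hj]
    rw [e]
    exact h

/-! ### The Hopf–Cole transform of the initial datum -/

theorem log_one_add_ge {x : ℝ} (hx : 0 ≤ x) : x - x ^ 2 ≤ Real.log (1 + x) := by
  have h := Real.one_sub_inv_le_log_of_pos (show 0 < 1 + x by linarith)
  have : x - x ^ 2 ≤ 1 - (1 + x)⁻¹ := by
    have h1 : 1 - (1 + x)⁻¹ = x / (1 + x) := by field_simp; ring
    rw [h1, le_div_iff₀ (by linarith)]
    nlinarith [pow_nonneg hx 3]
  linarith

theorem log_one_add_le {x : ℝ} (hx : 0 ≤ x) : Real.log (1 + x) ≤ x := by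
  have := Real.log_le_sub_one_of_pos (show 0 < 1 + x by linarith)
  linarith

theorem abs_exp_sub_exp_le {M x y : ℝ} (hx : x ≤ M) (hy : y ≤ M) :
    |Real.exp x - Real.exp y| ≤ Real.exp M * |x - y| := by
  have key : ∀ a b : ℝ, a ≤ b → b ≤ M → Real.exp b - Real.exp a ≤ Real.exp M * (b - a) := by
    intro a b hab hb
    have h1 : Real.exp a = Real.exp b * Real.exp (a - b) := by rw [← Real.exp_add]; ring_nf
    have h2 := Real.add_one_le_exp (a - b)
    have h3 := Real.exp_le_exp.2 hb
    have h4 := Real.exp_pos b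
    have h5 : Real.exp b * (b - a) ≤ Real.exp M * (b - a) :=
      mul_le_mul_of_nonneg_right h3 (by linarith)
    rw [h1]
    nlinarith
  rcases le_total x y with h | h
  · rw [abs_sub_comm, abs_sub_comm x y, abs_of_nonneg (sub_nonneg.2 (Real.exp_le_exp.2 h)),
      abs_of_nonneg (sub_nonneg.2 h)]
    exact key x y h hy
  · rw [abs_of_nonneg (sub_nonneg.2 (Real.exp_le_exp.2 h)), abs_of_nonneg (sub_nonneg.2 h)]
    exact key y x h hx

/-- The initial value of `λ^N`. -/
def initialLam (E : ℝ) (ρ₀ : ℝ → ℝ) (N j : ℕ) : ℝ :=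
  Real.exp (-(gam E N / N) * ∑ k ∈ Finset.Icc 1 j, ρ₀ ((k : ℝ) / N))

/-- `F`, with derivatives `F₁` and `F₂`, is a profile on `[0,1]` that satisfies the Robin conditions
`F' = α E F` at `0` and `F' = β E F` at `1` and has a Lipschitz second derivative. -/
structure IsRobinProfile (E α β K : ℝ) (F F₁ F₂ : ℝ → ℝ) : Prop where
  deriv₁ : ∀ x ∈ Icc (0 : ℝ) 1, HasDerivWithinAt F (F₁ x) (Icc 0 1) x
  deriv₂ : ∀ x ∈ Icc (0 : ℝ) 1, HasDerivWithinAt F₁ (F₂ x) (Icc 0 1) x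
  bound : ∀ x ∈ Icc (0 : ℝ) 1, |F x| ≤ K
  bound₁ : ∀ x ∈ Icc (0 : ℝ) 1, |F₁ x| ≤ K
  bound₂ : ∀ x ∈ Icc (0 : ℝ) 1, |F₂ x| ≤ K
  lipschitz : ∀ x ∈ Icc (0 : ℝ) 1, ∀ y ∈ Icc (0 : ℝ) 1, |F₂ y - F₂ x| ≤ K * |y - x|
  left : F₁ 0 = α * E * F 0
  right : F₁ 1 = β * E * F 1

/-- The discrete initial datum is, together with its difference quotients, `O(1/N)`-close to the
profile `exp (E ∫ ρ₀)`: the exponents are Riemann sums of each other. -/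
theorem initialLam_close {E L : ℝ} (hE : 0 < E) (hL : 0 ≤ L) {ρ₀ I : ℝ → ℝ}
    (hrange : ∀ x ∈ Icc (0 : ℝ) 1, ρ₀ x ∈ Icc (0 : ℝ) 1)
    (hlip : ∀ x ∈ Icc (0 : ℝ) 1, ∀ y ∈ Icc (0 : ℝ) 1, |ρ₀ y - ρ₀ x| ≤ L * |y - x|)
    (hI0 : I 0 = 0) (hI : ∀ x ∈ Icc (0 : ℝ) 1, HasDerivWithinAt I (ρ₀ x) (Icc 0 1) x) :
    ∃ K, 0 ≤ K ∧ ∀ N : ℕ, 1 ≤ N →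
      (∀ j ≤ N, |initialLam E ρ₀ N j - Real.exp (E * I ((j : ℝ) / N))| ≤ K / N) ∧
      (∀ j < N, |(initialLam E ρ₀ N (j + 1) - Real.exp (E * I (((j : ℝ) + 1) / N))) -
        (initialLam E ρ₀ N j - Real.exp (E * I ((j : ℝ) / N)))| ≤ K / (N : ℝ) ^ 2) := by
  set D := E ^ 2 + E * L with hD
  have hD0 : 0 ≤ D := by positivity
  set K := Real.exp E * D + (Real.exp E * D * (Real.exp E * E) + Real.exp E * (Real.exp E * D))
    with hK
  refine ⟨K, by positivity, ?_⟩
  intro N hN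
  have hN0 : (0 : ℝ) < N := by exact_mod_cast hN
  have hN1 : (1 : ℝ) ≤ N := by exact_mod_cast hN
  have hmem : ∀ j : ℕ, j ≤ N → (j : ℝ) / N ∈ Icc (0 : ℝ) 1 := fun j hj =>
    ⟨by positivity, by rw [div_le_one hN0]; exact_mod_cast hj⟩
  have hmem' : ∀ j : ℕ, j < N → ((j : ℝ) + 1) / N ∈ Icc (0 : ℝ) 1 := fun j hj => by
    have := hmem (j + 1) hj
    push_cast at this
    exact this
  set a := Real.log (1 + E / N) with ha
  have hε : 0 ≤ E / N := by positivity
  have ha1 : E / N - (E / N) ^ 2 ≤ a := log_one_add_ge hε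
  have ha2 : a ≤ E / N := log_one_add_le hε
  have ha0 : 0 ≤ a := Real.log_nonneg (by linarith)
  let A : ℕ → ℝ := fun j => a * ∑ k ∈ Finset.Icc 1 j, ρ₀ ((k : ℝ) / N)
  have hA0 : A 0 = 0 := by simp [A]
  have hAs : ∀ j, A (j + 1) = A j + a * ρ₀ (((j : ℝ) + 1) / N) := by
    intro j
    simp only [A]
    rw [Finset.sum_Icc_succ_top (by omega)]
    push_cast
    ring
  have hlam : ∀ j, initialLam E ρ₀ N j = Real.exp (A j) := by
    intro j
    simp only [initialLam, A, gam, ha]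
    congr 2
    field_simp
  let B : ℕ → ℝ := fun j => E * I ((j : ℝ) / N)
  have hIinc : ∀ j < N, |I (((j : ℝ) + 1) / N) - I ((j : ℝ) / N) - ρ₀ (((j : ℝ) + 1) / N) / N| ≤
      L / N ^ 2 := by
    intro j hj
    have hs : Icc ((j : ℝ) / N) (((j : ℝ) + 1) / N) ⊆ Icc 0 1 :=
      Icc_subset_Icc (hmem j hj.le).1 (hmem' j hj).2
    have hle : (j : ℝ) / N ≤ ((j : ℝ) + 1) / N := by gcongr; linarith
    have hconv : Convex ℝ (Icc ((j : ℝ) / N) (((j : ℝ) + 1) / N)) := convex_Icc _ _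
    have h := hconv.norm_image_sub_le_of_norm_hasDerivWithin_le
      (f := fun x => I x - ρ₀ (((j : ℝ) + 1) / N) * x)
      (f' := fun x => ρ₀ x - ρ₀ (((j : ℝ) + 1) / N) * 1) (C := L / N)
      (fun x hx => (((hI x (hs hx)).mono hs).sub ((hasDerivWithinAt_id _ _).const_mul _))) ?_
      (left_mem_Icc.2 hle) (right_mem_Icc.2 hle)
    · rw [Real.norm_eq_abs, Real.norm_eq_abs] at h
      have e1 : ((j : ℝ) + 1) / N - j / N = 1 / N := by ring
      rw [e1, abs_of_nonneg (by positivity : (0 : ℝ) ≤ 1 / N)] at h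
      calc _ = |I (((j : ℝ) + 1) / N) - ρ₀ (((j : ℝ) + 1) / N) * (((j : ℝ) + 1) / N) -
            (I ((j : ℝ) / N) - ρ₀ (((j : ℝ) + 1) / N) * ((j : ℝ) / N))| := by
              congr 1; ring
        _ ≤ _ := h
        _ = L / N ^ 2 := by field_simp
    · intro x hx
      rw [Real.norm_eq_abs, mul_one]
      refine (hlip _ (hmem' j hj) _ (hs hx)).trans ?_
      have : |x - ((j : ℝ) + 1) / N| ≤ 1 / N := by
        rw [abs_le]
        have e1 : ((j : ℝ) + 1) / N = j / N + 1 / N := by ring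
        constructor
        · linarith [hx.1]
        · have : 0 ≤ 1 / (N : ℝ) := by positivity
          linarith [hx.2]
      calc L * |x - ((j : ℝ) + 1) / N| ≤ L * (1 / N) := by gcongr
        _ = L / N := by ring
  -- One-step increments of the two exponents.
  have hinc : ∀ j < N, |(A (j + 1) - A j) - (B (j + 1) - B j)| ≤ D / N ^ 2 := by
    intro j hj
    have hr := hrange _ (hmem' j hj)
    have h1 := hIinc j hj
    have e : (A (j + 1) - A j) - (B (j + 1) - B j) =
        (a - E / N) * ρ₀ (((j : ℝ) + 1) / N) -
        E * (I (((j : ℝ) + 1) / N) - I ((j : ℝ) / N) - ρ₀ (((j : ℝ) + 1) / N) / N) := by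
      rw [hAs]
      simp only [B]
      push_cast
      ring
    rw [e]
    refine (abs_sub _ _).trans ?_
    rw [abs_mul, abs_mul, abs_of_pos hE, abs_of_nonneg hr.1]
    have h2 : |a - E / N| ≤ (E / N) ^ 2 := by
      rw [abs_le]; constructor <;> nlinarith
    have h3 : |a - E / N| * ρ₀ (((j : ℝ) + 1) / N) ≤ (E / N) ^ 2 * 1 :=
      mul_le_mul h2 hr.2 hr.1 (by positivity)
    have h4 := mul_le_mul_of_nonneg_left h1 hE.le
    have h5 : D / N ^ 2 = (E / N) ^ 2 * 1 + E * (L / N ^ 2) := by rw [hD]; ring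
    rw [h5]
    linarith
  have hAB : ∀ j ≤ N, |A j - B j| ≤ j * (D / N ^ 2) := by
    intro j
    induction j with
    | zero => intro _; simp [B, hA0, hI0]
    | succ j ih =>
      intro hj
      have h1 := ih (by omega)
      have h2 := hinc j hj
      have e : A (j + 1) - B (j + 1) = ((A (j + 1) - A j) - (B (j + 1) - B j)) + (A j - B j) := by
        ring
      rw [e]
      push_cast
      linarith [abs_add_le ((A (j + 1) - A j) - (B (j + 1) - B j)) (A j - B j)]
  have hAB' : ∀ j ≤ N, |A j - B j| ≤ D / N := by
    intro j hj
    refine (hAB j hj).trans ?_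
    have : (j : ℝ) ≤ N := by exact_mod_cast hj
    calc (j : ℝ) * (D / N ^ 2) ≤ N * (D / N ^ 2) := by gcongr
      _ = D / N := by field_simp
  have hainc : ∀ j < N, 0 ≤ A (j + 1) - A j ∧ A (j + 1) - A j ≤ E / N := by
    intro j hj
    have hr := hrange _ (hmem' j hj)
    have : A (j + 1) - A j = a * ρ₀ (((j : ℝ) + 1) / N) := by rw [hAs]; ring
    rw [this]
    exact ⟨mul_nonneg ha0 hr.1, (mul_le_of_le_one_right ha0 hr.2).trans ha2⟩
  have hAE : ∀ j ≤ N, A j ≤ j * (E / N) := by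
    intro j
    induction j with
    | zero => intro _; simp [hA0]
    | succ j ih =>
      intro hj
      have h1 := ih (by omega)
      have h2 := (hainc j hj).2
      push_cast
      linarith
  have hAE' : ∀ j ≤ N, A j ≤ E := by
    intro j hj
    refine (hAE j hj).trans ?_
    have : (j : ℝ) ≤ N := by exact_mod_cast hj
    calc (j : ℝ) * (E / N) ≤ N * (E / N) := by gcongr
      _ = E := by field_simp
  have hIE : ∀ x ∈ Icc (0 : ℝ) 1, ∀ y ∈ Icc (0 : ℝ) 1, |I y - I x| ≤ |y - x| := by
    intro x hx y hy
    have := (convex_Icc (0 : ℝ) 1).norm_image_sub_le_of_norm_hasDerivWithin_le (C := 1) hI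
      (fun x hx => by
        rw [Real.norm_eq_abs, abs_of_nonneg (hrange x hx).1]; exact (hrange x hx).2) hx hy
    simpa using this
  have hBE : ∀ j ≤ N, B j ≤ E := by
    intro j hj
    have h := hIE 0 (by simp) _ (hmem j hj)
    rw [hI0, sub_zero, sub_zero, abs_of_nonneg (hmem j hj).1] at h
    have : I ((j : ℝ) / N) ≤ 1 := (le_abs_self _).trans (h.trans (hmem j hj).2)
    simp only [B]
    nlinarith
  have hbinc : ∀ j < N, |B (j + 1) - B j| ≤ E := by
    intro j hj
    have h := hIE _ (hmem j hj.le) _ (hmem' j hj)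
    have e1 : ((j : ℝ) + 1) / N - j / N = 1 / N := by ring
    rw [e1, abs_of_nonneg (by positivity : (0 : ℝ) ≤ 1 / N)] at h
    have : B (j + 1) - B j = E * (I (((j : ℝ) + 1) / N) - I ((j : ℝ) / N)) := by
      simp only [B]; push_cast; ring
    rw [this, abs_mul, abs_of_pos hE]
    have : 1 / (N : ℝ) ≤ 1 := by rw [div_le_one hN0]; exact hN1
    nlinarith
  have h1K : Real.exp E * D ≤ K := by
    have : 0 ≤ (Real.exp E * D * (Real.exp E * E) + Real.exp E * (Real.exp E * D)) := by positivity
    linarith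
  have h2K : (Real.exp E * D * (Real.exp E * E) + Real.exp E * (Real.exp E * D)) ≤ K := by
    have : 0 ≤ Real.exp E * D := by positivity
    linarith
  have hval : ∀ j ≤ N, |Real.exp (A j) - Real.exp (B j)| ≤ Real.exp E * D / N := by
    intro j hj
    calc _ ≤ Real.exp E * |A j - B j| := abs_exp_sub_exp_le (hAE' j hj) (hBE j hj)
      _ ≤ Real.exp E * (D / N) := by gcongr; exact hAB' j hj
      _ = _ := by ring
  refine ⟨fun j hj => ?_, fun j hj => ?_⟩
  · rw [hlam]
    exact (hval j hj).trans (by gcongr)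
  · rw [hlam, hlam]
    have eB : Real.exp (E * I (((j : ℝ) + 1) / N)) = Real.exp (B (j + 1)) := by
      simp only [B]; push_cast; rfl
    rw [eB]
    set p := A (j + 1) - A j
    set q := B (j + 1) - B j
    have e : Real.exp (A (j + 1)) - Real.exp (B (j + 1)) - (Real.exp (A j) - Real.exp (B j)) =
        (Real.exp (A j) - Real.exp (B j)) * (Real.exp p - Real.exp 0) +
        Real.exp (B j) * (Real.exp p - Real.exp q) := by
      have h1 : Real.exp (A (j + 1)) = Real.exp (A j) * Real.exp p := by
        rw [← Real.exp_add]; simp [p]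
      have h2 : Real.exp (B (j + 1)) = Real.exp (B j) * Real.exp q := by
        rw [← Real.exp_add]; simp [q]
      rw [h1, h2, Real.exp_zero]
      ring
    have hp := hainc j hj
    have hpE : p ≤ E := hp.2.trans (div_le_self hE.le hN1)
    have hqE : q ≤ E := (le_abs_self _).trans (hbinc j hj)
    have h3 : |Real.exp p - Real.exp 0| ≤ Real.exp E * (E / N) := by
      refine (abs_exp_sub_exp_le hpE hE.le).trans ?_
      rw [sub_zero, abs_of_nonneg hp.1]
      gcongr
      exact hp.2
    have h4 : |Real.exp p - Real.exp q| ≤ Real.exp E * (D / N ^ 2) :=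
      (abs_exp_sub_exp_le hpE hqE).trans (by gcongr; exact hinc j hj)
    have h5 := hval j hj.le
    have h6 : Real.exp (B j) ≤ Real.exp E := Real.exp_le_exp.2 (hBE j hj.le)
    rw [e]
    refine (abs_add_le _ _).trans ?_
    rw [abs_mul, abs_mul, abs_of_pos (Real.exp_pos (B j))]
    calc _ ≤ Real.exp E * D / N * (Real.exp E * (E / N)) +
          Real.exp E * (Real.exp E * (D / N ^ 2)) := by
            gcongr
      _ = (Real.exp E * D * (Real.exp E * E) + Real.exp E * (Real.exp E * D)) / N ^ 2 := by
          field_simp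
      _ ≤ K / N ^ 2 := by gcongr

theorem exists_robinProfile {E α β : ℝ} (hE : 0 < E) {ρ₀ : ℝ → ℝ}
    (hρ₀ : ContDiffOn ℝ 4 ρ₀ (Icc 0 1)) (hrange : ∀ x ∈ Icc (0 : ℝ) 1, ρ₀ x ∈ Icc (0 : ℝ) 1)
    (hleft : ρ₀ 0 = α) (hright : ρ₀ 1 = β) :
    ∃ (K : ℝ) (F F₁ F₂ : ℝ → ℝ), 0 ≤ K ∧ IsRobinProfile E α β K F F₁ F₂ ∧
      ∀ N : ℕ, 1 ≤ N → (∀ j ≤ N, |initialLam E ρ₀ N j - F ((j : ℝ) / N)| ≤ K / N) ∧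
        (∀ j < N, |(initialLam E ρ₀ N (j + 1) - F (((j : ℝ) + 1) / N)) -
          (initialLam E ρ₀ N j - F ((j : ℝ) / N))| ≤ K / (N : ℝ) ^ 2) := by
  have hcvx : Convex ℝ (Icc (0 : ℝ) 1) := convex_Icc 0 1
  have hcpt : IsCompact (Icc (0 : ℝ) 1) := isCompact_Icc
  have hud : UniqueDiffOn ℝ (Icc (0 : ℝ) 1) := uniqueDiffOn_Icc zero_lt_one
  let R : ℝ → ℝ := fun x => ρ₀ (projIcc (0 : ℝ) 1 zero_le_one x)
  have hRc : Continuous R :=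
    hρ₀.continuousOn.comp_continuous (by fun_prop) (fun x => Subtype.coe_prop _)
  have hReq : ∀ x ∈ Icc (0 : ℝ) 1, R x = ρ₀ x := by
    intro x hx; simp only [R]; rw [projIcc_of_mem zero_le_one hx]
  let I : ℝ → ℝ := fun x => ∫ y in (0 : ℝ)..x, R y
  have hIR : ∀ x, HasDerivAt I (R x) x := fun x => (hRc.integral_hasStrictDerivAt 0 x).hasDerivAt
  have hI : ∀ x ∈ Icc (0 : ℝ) 1, HasDerivWithinAt I (ρ₀ x) (Icc 0 1) x := fun x hx =>
    hReq x hx ▸ (hIR x).hasDerivWithinAt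
  have hI1 : ContDiff ℝ 1 I := by
    rw [contDiff_one_iff_deriv]
    refine ⟨fun x => (hIR x).differentiableAt, ?_⟩
    have : deriv I = R := funext fun x => (hIR x).deriv
    rw [this]; exact hRc
  let ρ' : ℝ → ℝ := derivWithin ρ₀ (Icc 0 1)
  have hρ'1 : ContDiffOn ℝ 1 ρ' (Icc 0 1) := hρ₀.derivWithin hud (by norm_num)
  have hρ'd : ∀ x ∈ Icc (0 : ℝ) 1, HasDerivWithinAt ρ₀ (ρ' x) (Icc 0 1) x := fun x hx =>
    ((hρ₀.differentiableOn (by norm_num)) x hx).hasDerivWithinAt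
  let F : ℝ → ℝ := fun x => Real.exp (E * I x)
  let F₁ : ℝ → ℝ := fun x => E * (ρ₀ x * F x)
  let F₂ : ℝ → ℝ := fun x => E * (ρ' x * F x + ρ₀ x * F₁ x)
  have hF1 : ∀ x ∈ Icc (0 : ℝ) 1, HasDerivWithinAt F (F₁ x) (Icc 0 1) x := fun x hx =>
    (((hI x hx).const_mul E).exp).congr_deriv (by simp only [F₁, F]; ring)
  have hF2 : ∀ x ∈ Icc (0 : ℝ) 1, HasDerivWithinAt F₁ (F₂ x) (Icc 0 1) x := fun x hx =>
    ((hρ'd x hx).mul (hF1 x hx)).const_mul E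
  have hρ1 : ContDiffOn ℝ 1 ρ₀ (Icc 0 1) := hρ₀.of_le (by norm_num)
  have hFc : ContDiffOn ℝ 1 F (Icc 0 1) := ((contDiff_const.mul hI1).exp).contDiffOn
  have hF1c : ContDiffOn ℝ 1 F₁ (Icc 0 1) := contDiffOn_const.mul (hρ1.mul hFc)
  have hF2c : ContDiffOn ℝ 1 F₂ (Icc 0 1) :=
    contDiffOn_const.mul ((hρ'1.mul hFc).add (hρ1.mul hF1c))
  obtain ⟨L, hL⟩ := hρ1.exists_lipschitzOnWith one_ne_zero hcvx hcpt
  obtain ⟨L₂, hL₂⟩ := hF2c.exists_lipschitzOnWith one_ne_zero hcvx hcpt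
  have hlip : ∀ x ∈ Icc (0 : ℝ) 1, ∀ y ∈ Icc (0 : ℝ) 1, |ρ₀ y - ρ₀ x| ≤ L * |y - x| := by
    intro x hx y hy
    simpa [Real.dist_eq] using hL.dist_le_mul y hy x hx
  have hlip₂ : ∀ x ∈ Icc (0 : ℝ) 1, ∀ y ∈ Icc (0 : ℝ) 1, |F₂ y - F₂ x| ≤ L₂ * |y - x| := by
    intro x hx y hy
    simpa [Real.dist_eq] using hL₂.dist_le_mul y hy x hx
  obtain ⟨b0, hb0⟩ := hcpt.exists_bound_of_continuousOn hFc.continuousOn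
  obtain ⟨b1, hb1⟩ := hcpt.exists_bound_of_continuousOn hF1c.continuousOn
  obtain ⟨b2, hb2⟩ := hcpt.exists_bound_of_continuousOn hF2c.continuousOn
  obtain ⟨K₀, hK₀, hclose⟩ := initialLam_close hE L.2 hrange hlip (by simp [I]) hI
  set K := K₀ + |b0| + |b1| + |b2| + L₂ with hK
  have p0 := abs_nonneg b0
  have p1 := abs_nonneg b1
  have p2 := abs_nonneg b2
  have p3 : (0 : ℝ) ≤ L₂ := L₂.2
  refine ⟨K, F, F₁, F₂, by positivity, ⟨hF1, hF2, ?_, ?_, ?_, ?_, ?_, ?_⟩, ?_⟩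
  · intro x hx
    have := hb0 x hx
    rw [Real.norm_eq_abs] at this
    linarith [le_abs_self b0]
  · intro x hx
    have := hb1 x hx
    rw [Real.norm_eq_abs] at this
    linarith [le_abs_self b1]
  · intro x hx
    have := hb2 x hx
    rw [Real.norm_eq_abs] at this
    linarith [le_abs_self b2]
  · intro x hx y hy
    refine (hlip₂ x hx y hy).trans ?_
    gcongr
    linarith
  · simp only [F₁, hleft]; ring
  · simp only [F₁, hright]; ring
  · intro N hN
    have hN0 : (0 : ℝ) < N := by exact_mod_cast hN
    have hKK : K₀ ≤ K := by linarith
    refine ⟨fun j hj => ((hclose N hN).1 j hj).trans (by gcongr),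
      fun j hj => ((hclose N hN).2 j hj).trans (by gcongr)⟩

/-! ### Well-prepared initial data -/

theorem taylor_two {f f₁ f₂ : ℝ → ℝ} {K : ℝ}
    (h₁ : ∀ x ∈ Icc (0 : ℝ) 1, HasDerivWithinAt f (f₁ x) (Icc 0 1) x)
    (h₂ : ∀ x ∈ Icc (0 : ℝ) 1, HasDerivWithinAt f₁ (f₂ x) (Icc 0 1) x)
    (hL : ∀ x ∈ Icc (0 : ℝ) 1, ∀ y ∈ Icc (0 : ℝ) 1, |f₂ y - f₂ x| ≤ K * |y - x|) (hK : 0 ≤ K)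
    {x y : ℝ} (hx : x ∈ Icc (0 : ℝ) 1) (hy : y ∈ Icc (0 : ℝ) 1) :
    |f y - f x - (y - x) * f₁ x - (y - x) ^ 2 / 2 * f₂ x| ≤ K * |y - x| ^ 3 := by
  have first : ∀ z ∈ Icc (0 : ℝ) 1, |f₁ z - f₁ x - (z - x) * f₂ x| ≤ K * |z - x| ^ 2 := by
    intro z hz
    have hsub : uIcc x z ⊆ Icc 0 1 := uIcc_subset_Icc hx hz
    have h := (convex_uIcc x z).norm_image_sub_le_of_norm_hasDerivWithin_le
      (f := fun w => f₁ w - f₂ x * w) (f' := fun w => f₂ w - f₂ x * 1) (C := K * |z - x|)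
      (fun w hw => ((h₂ w (hsub hw)).mono hsub).sub ((hasDerivWithinAt_id _ _).const_mul _)) ?_
      left_mem_uIcc right_mem_uIcc
    · rw [Real.norm_eq_abs, Real.norm_eq_abs] at h
      calc _ = |f₁ z - f₂ x * z - (f₁ x - f₂ x * x)| := by congr 1; ring
        _ ≤ _ := h
        _ = _ := by ring
    · intro w hw
      rw [Real.norm_eq_abs, mul_one]
      refine (hL x hx w (hsub hw)).trans ?_
      exact mul_le_mul_of_nonneg_left (abs_sub_left_of_mem_uIcc hw) hK
  have hsub : uIcc x y ⊆ Icc 0 1 := uIcc_subset_Icc hx hy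
  have h := (convex_uIcc x y).norm_image_sub_le_of_norm_hasDerivWithin_le
    (f := fun w => f w - f₁ x * w - (w - x) ^ 2 / 2 * f₂ x)
    (f' := fun w => f₁ w - f₁ x * 1 - (2 * (w - x) ^ 1 * 1) / 2 * f₂ x) (C := K * |y - x| ^ 2)
    (fun w hw => (((h₁ w (hsub hw)).mono hsub).sub ((hasDerivWithinAt_id _ _).const_mul _)).sub
      (((((hasDerivWithinAt_id w _).sub_const x).pow 2).div_const 2).mul_const _)) ?_
    left_mem_uIcc right_mem_uIcc
  · rw [Real.norm_eq_abs, Real.norm_eq_abs] at h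
    calc _ = |f y - f₁ x * y - (y - x) ^ 2 / 2 * f₂ x -
          (f x - f₁ x * x - (x - x) ^ 2 / 2 * f₂ x)| := by congr 1; ring
      _ ≤ _ := h
      _ = _ := by ring
  · intro w hw
    rw [Real.norm_eq_abs]
    have e : f₁ w - f₁ x * 1 - (2 * (w - x) ^ 1 * 1) / 2 * f₂ x = f₁ w - f₁ x - (w - x) * f₂ x := by
      ring
    rw [e]
    refine (first w (hsub hw)).trans ?_
    have := abs_sub_left_of_mem_uIcc hw
    gcongr

theorem lipschitz_of_bound {f f₁ : ℝ → ℝ} {K : ℝ}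
    (h₁ : ∀ x ∈ Icc (0 : ℝ) 1, HasDerivWithinAt f (f₁ x) (Icc 0 1) x)
    (hK : ∀ x ∈ Icc (0 : ℝ) 1, |f₁ x| ≤ K) {x y : ℝ} (hx : x ∈ Icc (0 : ℝ) 1)
    (hy : y ∈ Icc (0 : ℝ) 1) : |f y - f x| ≤ K * |y - x| := by
  simpa using (convex_Icc (0 : ℝ) 1).norm_image_sub_le_of_norm_hasDerivWithin_le h₁
    (fun x hx => by rw [Real.norm_eq_abs]; exact hK x hx) hx hy

/-- Consistency of `Ω`, the end points included, on a smooth function that satisfies the Robin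
conditions with the first-order correction dictated by the position of the first and of the last
grid point. -/
theorem Omega_consistency {E α β : ℝ} (hE : 0 < E) (hβ : β ∈ Ioo (0 : ℝ) 1) {K : ℝ} (hK : 0 ≤ K)
    {f f₁ f₂ : ℝ → ℝ} {M : ℕ} (hM : 2 ≤ M)
    (h₁ : ∀ x ∈ Icc (0 : ℝ) 1, HasDerivWithinAt f (f₁ x) (Icc 0 1) x)
    (h₂ : ∀ x ∈ Icc (0 : ℝ) 1, HasDerivWithinAt f₁ (f₂ x) (Icc 0 1) x)
    (hf₂ : ∀ x ∈ Icc (0 : ℝ) 1, |f₂ x| ≤ K)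
    (hL : ∀ x ∈ Icc (0 : ℝ) 1, ∀ y ∈ Icc (0 : ℝ) 1, |f₂ y - f₂ x| ≤ K * |y - x|)
    (hleft : |M * (f₁ 0 - α * E * f 0) - (f₂ 0 / 2 - E * f₁ 0)| ≤ K / M)
    (hright : |M * (f₁ 1 - β * E * f 1) - (f₂ 1 / 2 - β * E * f₁ 1)| ≤ K / M)
    {j : ℕ} (hj : j < M) :
    |Omega E α β M (fun i => f ((i : ℝ) / M)) j - (f₂ ((j : ℝ) / M) - E * f₁ ((j : ℝ) / M))| ≤
      20 * (1 + E) * K / M := by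
  have hM2 : (2 : ℝ) ≤ M := by exact_mod_cast hM
  have hM0 : (0 : ℝ) < M := by linarith
  have hM0' : (M : ℝ) ≠ 0 := hM0.ne'
  have hd : 0 ≤ K / M := by positivity
  have hEd : 0 ≤ E * (K / M) := by positivity
  have hgoal : 20 * (1 + E) * K / M = 20 * (K / M) + 20 * (E * (K / M)) := by ring
  rw [hgoal]
  have hmem : ∀ i : ℕ, i ≤ M → (i : ℝ) / M ∈ Icc (0 : ℝ) 1 := fun i hi =>
    ⟨by positivity, by rw [div_le_one hM0]; exact_mod_cast hi⟩
  -- Taylor expansion with remainders of size `K / M ^ 3`.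
  have htay : ∀ x ∈ Icc (0 : ℝ) 1, ∀ y ∈ Icc (0 : ℝ) 1, ∀ k : ℝ, y - x = k / M →
      |(M : ℝ) ^ 2 * (f y - f x - k / M * f₁ x - (k / M) ^ 2 / 2 * f₂ x)| ≤ |k| ^ 3 * (K / M) := by
    intro x hx y hy k hk
    have h := taylor_two h₁ h₂ hL hK hx hy
    rw [hk, abs_div, abs_of_pos hM0] at h
    rw [abs_mul, abs_of_pos (by positivity : (0 : ℝ) < (M : ℝ) ^ 2)]
    calc _ ≤ (M : ℝ) ^ 2 * (K * (|k| / M) ^ 3) := by gcongr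
      _ = _ := by field_simp
  have hdrop : ∀ r : ℝ, ∀ B : ℝ, |(M : ℝ) ^ 2 * r| ≤ B → |(M : ℝ) * r| ≤ B := by
    intro r B h
    refine le_trans ?_ h
    rw [abs_mul, abs_mul, abs_of_pos hM0, abs_of_pos (by positivity : (0 : ℝ) < (M : ℝ) ^ 2)]
    have := abs_nonneg r
    gcongr
    nlinarith
  unfold Omega gradPlus gradMinus discreteLaplacian
  rcases Nat.eq_zero_or_pos j with rfl | hj0
  · simp only [if_true]
    simp only [Nat.cast_zero, zero_add, Nat.cast_one]
    have t := htay 0 (by simp) _ (hmem 1 (by omega)) 1 (by push_cast; ring)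
    set r := f (((1 : ℕ) : ℝ) / M) - f 0 - 1 / M * f₁ 0 - (1 / M) ^ 2 / 2 * f₂ 0 with hr
    have e : -α * E * M * f (0 / M) + M * (M * (f (1 / M) - f (0 / M))) -
        (f₂ (0 / M) - E * f₁ (0 / M)) =
        (M : ℝ) ^ 2 * r + (M * (f₁ 0 - α * E * f 0) - (f₂ 0 / 2 - E * f₁ 0)) := by
      rw [hr]
      simp only [zero_div, Nat.cast_one]
      field_simp
      ring
    rw [e]
    refine (abs_add_le _ _).trans ?_
    simp only [abs_one, one_pow, one_mul] at t
    linarith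
  rw [if_neg (by omega)]
  by_cases h1 : j = M - 1
  · rw [if_pos h1]
    obtain ⟨m, rfl⟩ : ∃ m, M = m + 2 := ⟨M - 2, by omega⟩
    have hj1 : j = m + 1 := by omega
    subst hj1
    have e1 : m + 2 - 1 = m + 1 := rfl
    have e2 : m + 2 - 1 - 1 = m := rfl
    rw [e1, Nat.add_sub_cancel]
    set x₁ : ℝ := ((m + 1 : ℕ) : ℝ) / ((m + 2 : ℕ) : ℝ) with hx₁
    set x₂ : ℝ := ((m : ℕ) : ℝ) / ((m + 2 : ℕ) : ℝ) with hx₂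
    set M' : ℝ := ((m + 2 : ℕ) : ℝ) with hM'
    have hmM : (m : ℝ) = M' - 2 := by rw [hM']; push_cast; ring
    have hm1 : x₁ ∈ Icc (0 : ℝ) 1 := hmem (m + 1) (by omega)
    have hm2 : x₂ ∈ Icc (0 : ℝ) 1 := hmem m (by omega)
    have hd1 : x₁ - 1 = -1 / M' := by rw [hx₁]; push_cast; rw [hmM]; field_simp; ring
    have hd2 : x₂ - 1 = -2 / M' := by rw [hx₂, hmM]; field_simp; ring
    have t1 := htay 1 (by simp) x₁ hm1 (-1) hd1
    have t2 := htay 1 (by simp) x₂ hm2 (-2) hd2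
    set r₁ := f x₁ - f 1 - -1 / M' * f₁ 1 - (-1 / M') ^ 2 / 2 * f₂ 1 with hr₁
    set r₂ := f x₂ - f 1 - -2 / M' * f₁ 1 - (-2 / M') ^ 2 / 2 * f₂ 1 with hr₂
    rw [show |(-1 : ℝ)| ^ 3 = 1 by norm_num, one_mul] at t1
    rw [show |(-2 : ℝ)| ^ 3 = 8 by norm_num] at t2
    have u1 := hdrop r₁ _ t1
    have u2 := hdrop r₂ _ t2
    have hfx1 : f x₁ = r₁ + f 1 + -1 / M' * f₁ 1 + (-1 / M') ^ 2 / 2 * f₂ 1 := by rw [hr₁]; ring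
    have hfx2 : f x₂ = r₂ + f 1 + -2 / M' * f₁ 1 + (-2 / M') ^ 2 / 2 * f₂ 1 := by rw [hr₂]; ring
    have e : β * E * M' * f x₁ - M' * (1 + E / M') * (-M' * (f x₂ - f x₁)) -
        (f₂ x₁ - E * f₁ x₁) =
        -(M' * (f₁ 1 - β * E * f 1) - (f₂ 1 / 2 - β * E * f₁ 1)) - (M' ^ 2 * r₁ - M' ^ 2 * r₂) -
        (E * (M' * r₁) - E * (M' * r₂)) + β * E * (M' * r₁) +
        (β * E * (f₂ 1 / M') / 2 + 3 / 2 * (E * (f₂ 1 / M')) +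
          ((f₂ 1 - f₂ x₁) - E * (f₁ 1 - f₁ x₁))) := by
      rw [hfx1, hfx2]
      field_simp
      ring
    have v1 : |f₂ 1 - f₂ x₁| ≤ K / M' := by
      have := hL 1 (by simp) x₁ hm1
      rw [abs_sub_comm, hd1] at this
      rw [abs_div, abs_neg, abs_one, abs_of_pos hM0] at this
      linarith [this, show K * (1 / M') = K / M' by ring]
    have v2 : |f₁ 1 - f₁ x₁| ≤ K / M' := by
      have := lipschitz_of_bound h₂ hf₂ (x := 1) (by simp) hm1
      rw [abs_sub_comm, hd1] at this
      rw [abs_div, abs_neg, abs_one, abs_of_pos hM0] at this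
      linarith [this, show K * (1 / M') = K / M' by ring]
    have v3 : |f₂ 1 / M'| ≤ K / M' := by
      rw [abs_div, abs_of_pos hM0]
      gcongr
      exact hf₂ 1 (by simp)
    have hE1 : ∀ z B : ℝ, |z| ≤ B → |E * z| ≤ E * B := fun z B h => by
      rw [abs_mul, abs_of_pos hE]; gcongr
    have hβ1 : ∀ z B : ℝ, |z| ≤ B → |β * z| ≤ B := fun z B h => by
      rw [abs_mul, abs_of_pos hβ.1]
      calc β * |z| ≤ 1 * |z| := by gcongr; exact hβ.2.le
        _ ≤ B := by linarith
    have w1 := hE1 _ _ u1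
    have w2 := hE1 _ _ u2
    have w3 := hβ1 _ _ w1
    have w4 := hE1 _ _ v3
    have w5 := hβ1 _ _ w4
    have w6 := hE1 _ _ v2
    rw [e]
    rw [← mul_assoc] at w3 w5
    rw [abs_le] at *
    constructor <;> linarith [hright.1, hright.2, t1.1, t1.2, t2.1, t2.2, w1.1, w1.2, w2.1, w2.2,
      w3.1, w3.2, w4.1, w4.2, w5.1, w5.2, w6.1, w6.2, v1.1, v1.2]
  · rw [if_neg h1]
    have hx := hmem j hj.le
    have hp := hmem (j + 1) hj
    have hm := hmem (j - 1) (by omega)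
    have c1 : ((j - 1 : ℕ) : ℝ) = j - 1 := by
      rw [Nat.cast_sub (by omega)]; simp
    set x : ℝ := (j : ℝ) / M with hxd
    set xp : ℝ := ((j + 1 : ℕ) : ℝ) / M with hxp
    set xm : ℝ := ((j - 1 : ℕ) : ℝ) / M with hxm
    have hd1 : xp - x = 1 / M := by rw [hxp, hxd]; push_cast; ring
    have hd2 : xm - x = -1 / M := by rw [hxm, hxd, c1]; ring
    have t1 := htay x hx xp hp 1 hd1
    have t2 := htay x hx xm hm (-1) hd2
    set r₁ := f xp - f x - 1 / M * f₁ x - (1 / M) ^ 2 / 2 * f₂ x with hr₁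
    set r₂ := f xm - f x - -1 / M * f₁ x - (-1 / M) ^ 2 / 2 * f₂ x with hr₂
    rw [show |(1 : ℝ)| ^ 3 = 1 by norm_num, one_mul] at t1
    rw [show |(-1 : ℝ)| ^ 3 = 1 by norm_num, one_mul] at t2
    have u2 := hdrop r₂ _ t2
    have e : (M : ℝ) ^ 2 * (f xp + f xm - 2 * f x) - E * (-(M : ℝ) * (f xm - f x)) -
        (f₂ x - E * f₁ x) = M ^ 2 * r₁ + M ^ 2 * r₂ + E * (M * r₂) + E * (f₂ x / M) / 2 := by
      rw [hr₁, hr₂]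
      field_simp
      ring
    have v3 : |f₂ x / M| ≤ K / M := by
      rw [abs_div, abs_of_pos hM0]
      gcongr
      exact hf₂ x hx
    have hE1 : ∀ z B : ℝ, |z| ≤ B → |E * z| ≤ E * B := fun z B h => by
      rw [abs_mul, abs_of_pos hE]; gcongr
    have w2 := hE1 _ _ u2
    have w4 := hE1 _ _ v3
    rw [e]
    rw [abs_le] at *
    constructor <;> linarith [t1.1, t1.2, t2.1, t2.2, w2.1, w2.2, w4.1, w4.2]

theorem exists_cubic_correction (a b : ℝ) : ∃ (B : ℝ) (η η₁ η₂ : ℝ → ℝ), 0 ≤ B ∧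
    (∀ x, HasDerivAt η (η₁ x) x) ∧ (∀ x, HasDerivAt η₁ (η₂ x) x) ∧
    (∀ x ∈ Icc (0 : ℝ) 1, |η x| ≤ B ∧ |η₁ x| ≤ B ∧ |η₂ x| ≤ B) ∧
    (∀ x y : ℝ, |η₂ y - η₂ x| ≤ B * |y - x|) ∧ η 0 = 0 ∧ η 1 = 0 ∧ η₁ 0 = a ∧ η₁ 1 = b := by
  set c := a + b with hc
  let η : ℝ → ℝ := fun x => a * x - (a + c) * x ^ 2 + c * x ^ 3
  let η₁ : ℝ → ℝ := fun x => a - 2 * (a + c) * x + 3 * c * x ^ 2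
  let η₂ : ℝ → ℝ := fun x => -2 * (a + c) + 6 * c * x
  have hη₁ : ∀ x, HasDerivAt η (η₁ x) x := by
    intro x
    have := (((hasDerivAt_id x).const_mul a).sub (((hasDerivAt_id x).pow 2).const_mul (a + c))).add
      (((hasDerivAt_id x).pow 3).const_mul c)
    refine this.congr_deriv ?_
    simp [η₁]; ring
  have hη₂ : ∀ x, HasDerivAt η₁ (η₂ x) x := by
    intro x
    have := ((((hasDerivAt_id x).const_mul (2 * (a + c))).const_sub a)).add
      (((hasDerivAt_id x).pow 2).const_mul (3 * c))
    refine this.congr_deriv ?_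
    simp [η₂]; ring
  set B := 10 * (|a| + |c|) with hB
  have hηb : ∀ x ∈ Icc (0 : ℝ) 1, |η x| ≤ B ∧ |η₁ x| ≤ B ∧ |η₂ x| ≤ B := by
    intro x hx
    have hx0 : 0 ≤ x := hx.1
    have hx1 : x ≤ 1 := hx.2
    have hx2 : x ^ 2 ≤ 1 := pow_le_one₀ hx0 hx1
    have hx3 : x ^ 3 ≤ 1 := pow_le_one₀ hx0 hx1
    have k : ∀ z y : ℝ, 0 ≤ y → y ≤ 1 → |z * y| ≤ |z| := fun z y h0 h1 => by
      rw [abs_mul, abs_of_nonneg h0]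
      exact mul_le_of_le_one_right (abs_nonneg z) h1
    have a1 := k a x hx0 hx1
    have a2 := k a (x ^ 2) (by positivity) hx2
    have c1 := k c x hx0 hx1
    have c2 := k c (x ^ 2) (by positivity) hx2
    have c3 := k c (x ^ 3) (by positivity) hx3
    have a0 := abs_le.1 (le_refl |a|)
    have c0 := abs_le.1 (le_refl |c|)
    rw [abs_le] at a1 a2 c1 c2 c3
    refine ⟨?_, ?_, ?_⟩ <;> simp only [η, η₁, η₂, abs_le, hB] <;> constructor <;>
      linarith [a1.1, a1.2, a2.1, a2.2, c1.1, c1.2, c2.1, c2.2, c3.1, c3.2, a0.1, a0.2, c0.1, c0.2]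
  have hηL : ∀ x y : ℝ, |η₂ y - η₂ x| ≤ B * |y - x| := by
    intro x y
    have : η₂ y - η₂ x = 6 * c * (y - x) := by simp only [η₂]; ring
    rw [this, abs_mul]
    gcongr
    rw [abs_mul, hB]
    norm_num
    linarith [abs_nonneg a, abs_nonneg c]
  refine ⟨B, η, η₁, η₂, by positivity, hη₁, hη₂, hηb, hηL, ?_, ?_, ?_, ?_⟩ <;>
    simp only [η, η₁, hc] <;> ring

/-- An `O(1/M)` modification of a Robin profile, by a cubic polynomial vanishing at both ends, that
satisfies the corrected end point conditions of `Omega_consistency`. -/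
theorem exists_corrected_profile {E α β K : ℝ} (hE : 0 < E) (hβ : β ∈ Ioo (0 : ℝ) 1) (hK : 0 ≤ K)
    {F F₁ F₂ : ℝ → ℝ} (hF : IsRobinProfile E α β K F F₁ F₂) :
    ∃ K', 0 ≤ K' ∧ ∀ M : ℕ, 2 ≤ M → ∃ f f₁ f₂ : ℝ → ℝ,
      (∀ x ∈ Icc (0 : ℝ) 1, HasDerivWithinAt f (f₁ x) (Icc 0 1) x) ∧
      (∀ x ∈ Icc (0 : ℝ) 1, HasDerivWithinAt f₁ (f₂ x) (Icc 0 1) x) ∧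
      (∀ x ∈ Icc (0 : ℝ) 1, |f x| ≤ K') ∧ (∀ x ∈ Icc (0 : ℝ) 1, |f₁ x| ≤ K') ∧
      (∀ x ∈ Icc (0 : ℝ) 1, |f₂ x| ≤ K') ∧
      (∀ x ∈ Icc (0 : ℝ) 1, ∀ y ∈ Icc (0 : ℝ) 1, |f₂ y - f₂ x| ≤ K' * |y - x|) ∧
      |M * (f₁ 0 - α * E * f 0) - (f₂ 0 / 2 - E * f₁ 0)| ≤ K' / M ∧
      |M * (f₁ 1 - β * E * f 1) - (f₂ 1 / 2 - β * E * f₁ 1)| ≤ K' / M ∧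
      (∀ x ∈ Icc (0 : ℝ) 1, |f x - F x| ≤ K' / M) ∧
      (∀ x ∈ Icc (0 : ℝ) 1, ∀ y ∈ Icc (0 : ℝ) 1,
        |(f y - F y) - (f x - F x)| ≤ K' / M * |y - x|) := by
  set a := F₂ 0 / 2 - E * F₁ 0 with ha
  set b := F₂ 1 / 2 - β * E * F₁ 1 with hb
  obtain ⟨B, η, η₁, η₂, hB0, hη₁, hη₂, hηb, hηL, hη0, hη1, hηa, hηb'⟩ := exists_cubic_correction a b
  set K' := 2 * (K + B) * (1 + E) with hK'
  have hKB : 0 ≤ K + B := by linarith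
  have hKK' : K + B ≤ K' := by rw [hK']; nlinarith
  have hK'0 : 0 ≤ K' := hKB.trans hKK'
  have hBE : B * (1 + E) ≤ K' := by rw [hK']; nlinarith
  refine ⟨K', hK'0, ?_⟩
  intro M hM
  have hM2 : (2 : ℝ) ≤ M := by exact_mod_cast hM
  have hM0 : (0 : ℝ) < M := by linarith
  have hMi : 1 / (M : ℝ) ≤ 1 := by rw [div_le_one hM0]; linarith
  have hMi0 : 0 ≤ 1 / (M : ℝ) := by positivity
  -- The slopes `a` and `b` of `η` at the ends supply the terms of order one in the corrected
  -- conditions.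
  let f : ℝ → ℝ := fun x => F x + 1 / M * η x
  let f₁ : ℝ → ℝ := fun x => F₁ x + 1 / M * η₁ x
  let f₂ : ℝ → ℝ := fun x => F₂ x + 1 / M * η₂ x
  have hf₁ : ∀ x ∈ Icc (0 : ℝ) 1, HasDerivWithinAt f (f₁ x) (Icc 0 1) x := fun x hx =>
    (hF.deriv₁ x hx).add ((hη₁ x).hasDerivWithinAt.const_mul _)
  have hf₂ : ∀ x ∈ Icc (0 : ℝ) 1, HasDerivWithinAt f₁ (f₂ x) (Icc 0 1) x := fun x hx =>
    (hF.deriv₂ x hx).add ((hη₂ x).hasDerivWithinAt.const_mul _)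
  have hmix : ∀ p q P Q : ℝ, |p| ≤ P → |q| ≤ Q → |p + 1 / M * q| ≤ P + Q := by
    intro p q P Q hp hq
    refine (abs_add_le _ _).trans (add_le_add hp ?_)
    rw [abs_mul, abs_of_nonneg hMi0]
    exact (mul_le_of_le_one_left (abs_nonneg q) hMi).trans hq
  have b0 : ∀ x ∈ Icc (0 : ℝ) 1, |f x| ≤ K' := fun x hx =>
    (hmix _ _ _ _ (hF.bound x hx) (hηb x hx).1).trans hKK'
  have b1 : ∀ x ∈ Icc (0 : ℝ) 1, |f₁ x| ≤ K' := fun x hx =>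
    (hmix _ _ _ _ (hF.bound₁ x hx) (hηb x hx).2.1).trans hKK'
  have b2 : ∀ x ∈ Icc (0 : ℝ) 1, |f₂ x| ≤ K' := fun x hx =>
    (hmix _ _ _ _ (hF.bound₂ x hx) (hηb x hx).2.2).trans hKK'
  have bL : ∀ x ∈ Icc (0 : ℝ) 1, ∀ y ∈ Icc (0 : ℝ) 1, |f₂ y - f₂ x| ≤ K' * |y - x| := by
    intro x hx y hy
    have e : f₂ y - f₂ x = (F₂ y - F₂ x) + 1 / M * (η₂ y - η₂ x) := by simp only [f₂]; ring
    rw [e]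
    refine (hmix _ _ _ _ (hF.lipschitz x hx y hy) (hηL x y)).trans ?_
    rw [← add_mul]
    gcongr
  refine ⟨f, f₁, f₂, hf₁, hf₂, b0, b1, b2, bL, ?_, ?_, ?_, ?_⟩
  · have e : M * (f₁ 0 - α * E * f 0) - (f₂ 0 / 2 - E * f₁ 0) =
        -(1 / M * η₂ 0) / 2 + E * (1 / M * η₁ 0) + M * (F₁ 0 - α * E * F 0) +
        ((a - (F₂ 0 / 2 - E * F₁ 0))) := by
      simp only [f, f₁, f₂, hη0, hηa]
      field_simp
      ring
    rw [e, show a - (F₂ 0 / 2 - E * F₁ 0) = 0 from sub_self a, hF.left, sub_self, mul_zero,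
      add_zero,
      add_zero]
    have u1 : |1 / M * η₂ 0| ≤ B / M := by
      rw [abs_mul, abs_of_nonneg hMi0, div_mul_eq_mul_div, one_mul]
      gcongr; exact (hηb 0 (by simp)).2.2
    have u2 : |E * (1 / M * η₁ 0)| ≤ E * (B / M) := by
      rw [abs_mul, abs_of_pos hE, abs_mul, abs_of_nonneg hMi0, div_mul_eq_mul_div, one_mul]
      gcongr; exact (hηb 0 (by simp)).2.1
    have u3 : B / M + E * (B / M) ≤ K' / M := by
      have : B / M + E * (B / M) = (B * (1 + E)) / M := by ring
      rw [this]; gcongr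
    have u4 : 0 ≤ B / M := by positivity
    rw [abs_le] at *
    constructor <;> linarith [u1.1, u1.2, u2.1, u2.2]
  · have e : M * (f₁ 1 - β * E * f 1) - (f₂ 1 / 2 - β * E * f₁ 1) =
        -(1 / M * η₂ 1) / 2 + β * (E * (1 / M * η₁ 1)) + M * (F₁ 1 - β * E * F 1) +
        ((b - (F₂ 1 / 2 - β * E * F₁ 1))) := by
      simp only [f, f₁, f₂, hη1, hηb']
      field_simp
      ring
    rw [e, show b - (F₂ 1 / 2 - β * E * F₁ 1) = 0 from sub_self b, hF.right, sub_self, mul_zero,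
      add_zero, add_zero]
    have u1 : |1 / M * η₂ 1| ≤ B / M := by
      rw [abs_mul, abs_of_nonneg hMi0, div_mul_eq_mul_div, one_mul]
      gcongr; exact (hηb 1 (by simp)).2.2
    have u2 : |E * (1 / M * η₁ 1)| ≤ E * (B / M) := by
      rw [abs_mul, abs_of_pos hE, abs_mul, abs_of_nonneg hMi0, div_mul_eq_mul_div, one_mul]
      gcongr; exact (hηb 1 (by simp)).2.1
    have u2' : |β * (E * (1 / M * η₁ 1))| ≤ E * (B / M) := by
      rw [abs_mul, abs_of_pos hβ.1]
      exact (mul_le_of_le_one_left (abs_nonneg _) hβ.2.le).trans u2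
    have u3 : B / M + E * (B / M) ≤ K' / M := by
      have : B / M + E * (B / M) = (B * (1 + E)) / M := by ring
      rw [this]; gcongr
    have u4 : 0 ≤ B / M := by positivity
    rw [abs_le] at *
    constructor <;> linarith [u1.1, u1.2, u2'.1, u2'.2]
  · intro x hx
    have e : f x - F x = 1 / M * η x := by simp only [f]; ring
    rw [e, abs_mul, abs_of_nonneg hMi0, div_mul_eq_mul_div, one_mul]
    gcongr
    exact (hηb x hx).1.trans (by linarith)
  · intro x hx y hy
    have e : (f y - F y) - (f x - F x) = 1 / M * (η y - η x) := by simp only [f]; ring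
    have h1 := lipschitz_of_bound (fun x _ => (hη₁ x).hasDerivWithinAt) (fun x hx => (hηb x hx).2.1)
      hx hy
    rw [e, abs_mul, abs_of_nonneg hMi0]
    calc 1 / (M : ℝ) * |η y - η x| ≤ 1 / M * (B * |y - x|) := by gcongr
      _ = B / M * |y - x| := by ring
      _ ≤ K' / M * |y - x| := by gcongr; linarith

/-- Well-prepared data: an `O(1/M)` modification of the profile on which `Ω` is bounded and has
bounded difference quotients up to the end points. -/
theorem exists_wellPrepared {E α β K : ℝ} (hE : 0 < E) (hβ : β ∈ Ioo (0 : ℝ) 1) (hK : 0 ≤ K)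
    {F F₁ F₂ : ℝ → ℝ} (hF : IsRobinProfile E α β K F F₁ F₂) :
    ∃ C, 0 ≤ C ∧ ∀ M : ℕ, 2 ≤ M → ∃ v : ℕ → ℝ,
      (∀ j < M, |v j| ≤ C) ∧ (∀ j, j + 1 < M → |v (j + 1) - v j| ≤ C / M) ∧
      (∀ j < M, |Omega E α β M v j| ≤ C) ∧
      (∀ j, j + 1 < M → |Omega E α β M v (j + 1) - Omega E α β M v j| ≤ C / M) ∧
      (∀ j < M, |v j - F ((j : ℝ) / M)| ≤ C / M) ∧
      (∀ j, j + 1 < M → |(v (j + 1) - F (((j : ℝ) + 1) / M)) - (v j - F ((j : ℝ) / M))| ≤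
        C / (M : ℝ) ^ 2) := by
  obtain ⟨K', hK'0, hcorr⟩ := exists_corrected_profile hE hβ hK hF
  set C := (1 + E) * K' + (20 * (1 + E) * K' + 20 * (1 + E) * K' + (1 + E) * K') with hC
  have hEK : 0 ≤ (1 + E) * K' := by positivity
  have hKC : K' ≤ C := by rw [hC]; nlinarith
  have hEKC : (1 + E) * K' + 20 * (1 + E) * K' ≤ C := by rw [hC]; nlinarith
  refine ⟨C, by linarith, ?_⟩
  intro M hM
  obtain ⟨f, f₁, f₂, hf₁, hf₂, b0, b1, b2, bL, hleft, hright, hfF, hfF'⟩ := hcorr M hM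
  have hM2 : (2 : ℝ) ≤ M := by exact_mod_cast hM
  have hM0 : (0 : ℝ) < M := by linarith
  have hMi0 : 0 ≤ 1 / (M : ℝ) := by positivity
  have hmem : ∀ i : ℕ, i ≤ M → (i : ℝ) / M ∈ Icc (0 : ℝ) 1 := fun i hi =>
    ⟨by positivity, by rw [div_le_one hM0]; exact_mod_cast hi⟩
  have hmem' : ∀ i : ℕ, i < M → ((i : ℝ) + 1) / M ∈ Icc (0 : ℝ) 1 := fun i hi => by
    have := hmem (i + 1) hi
    push_cast at this
    exact this
  have hstep : ∀ i : ℕ, ((i : ℝ) + 1) / M - i / M = 1 / M := fun i => by ring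
  have hcons : ∀ j < M, |Omega E α β M (fun i => f ((i : ℝ) / M)) j -
      (f₂ ((j : ℝ) / M) - E * f₁ ((j : ℝ) / M))| ≤ 20 * (1 + E) * K' / M := fun j hj =>
    Omega_consistency hE hβ hK'0 hM hf₁ hf₂ b2 bL hleft hright hj
  have hW : ∀ x ∈ Icc (0 : ℝ) 1, |f₂ x - E * f₁ x| ≤ (1 + E) * K' := by
    intro x hx
    refine (abs_sub _ _).trans ?_
    rw [abs_mul, abs_of_pos hE]
    nlinarith [b1 x hx, b2 x hx]
  refine ⟨fun i => f ((i : ℝ) / M), ?_, ?_, ?_, ?_, ?_, ?_⟩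
  · exact fun j hj => (b0 _ (hmem j hj.le)).trans hKC
  · intro j hj
    push_cast
    have := lipschitz_of_bound hf₁ b1 (hmem j (by omega)) (hmem' j (by omega))
    rw [hstep, abs_of_nonneg hMi0] at this
    refine this.trans ?_
    rw [mul_one_div]
    gcongr
  · intro j hj
    have h1 := hcons j hj
    have h2 := hW _ (hmem j hj.le)
    have h3 : 20 * (1 + E) * K' / M ≤ 20 * (1 + E) * K' := div_le_self (by positivity) (by linarith)
    rw [abs_le] at *
    constructor <;> linarith [h1.1, h1.2, h2.1, h2.2]
  · intro j hj
    have h1 := hcons j (by omega)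
    have h2 := hcons (j + 1) hj
    push_cast at h2
    have h3 := bL _ (hmem j (by omega)) _ (hmem' j (by omega))
    have h4 := lipschitz_of_bound hf₂ b2 (hmem j (by omega)) (hmem' j (by omega))
    rw [hstep, abs_of_nonneg hMi0, mul_one_div] at h3 h4
    have h5 : |E * (f₁ (((j : ℝ) + 1) / M) - f₁ (j / M))| ≤ E * (K' / M) := by
      rw [abs_mul, abs_of_pos hE]; gcongr
    have h6 : 20 * (1 + E) * K' / M + 20 * (1 + E) * K' / M + (K' / M + E * (K' / M)) ≤ C / M := by
      have : 20 * (1 + E) * K' / M + 20 * (1 + E) * K' / M + (K' / M + E * (K' / M)) =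
        (20 * (1 + E) * K' + 20 * (1 + E) * K' + (1 + E) * K') / M := by ring
      rw [this]; gcongr; rw [hC]; linarith
    rw [abs_le] at *
    constructor <;> linarith [h1.1, h1.2, h2.1, h2.2, h3.1, h3.2, h5.1, h5.2]
  · intro j hj
    refine (hfF _ (hmem j hj.le)).trans (by gcongr)
  · intro j hj
    push_cast
    refine (hfF' _ (hmem j (by omega)) _ (hmem' j (by omega))).trans ?_
    rw [hstep, abs_of_nonneg hMi0]
    calc K' / M * (1 / M) = K' / (M : ℝ) ^ 2 := by field_simp
      _ ≤ C / (M : ℝ) ^ 2 := by gcongr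

/-! ### Regularity of the semidiscrete solutions -/

/-- Sup-norm and gradient estimate combined: the Robin terms are treated as end point sources in
the gradient estimate. -/
theorem exists_C1_bound {E α β : ℝ} (hE : 0 < E) (hα : α ∈ Ioo (0 : ℝ) 1)
    (hβ : β ∈ Ioo (0 : ℝ) 1) (T : ℝ) : ∃ C, 1 ≤ C ∧ ∀ N : ℕ, 2 ≤ N → ∀ (K : ℝ), 0 ≤ K →
      ∀ y s : ℝ → ℕ → ℝ,
      (∀ t ∈ Icc 0 T, ∀ j < N, HasDerivWithinAt (fun τ => y τ j)
        (Omega E α β N (y t) j + s t j) (Ici 0) t) →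
      (∀ t ∈ Icc 0 T, ∀ j < N, |s t j| ≤ N * K) →
      (∀ t ∈ Icc 0 T, ∀ j < N, 0 < j → j + 1 < N → |s t j| ≤ K) →
      (∀ j < N, |y 0 j| ≤ K) → (∀ j, j + 1 < N → |y 0 (j + 1) - y 0 j| ≤ K / N) →
      ∀ t ∈ Icc 0 T, (∀ j < N, |y t j| ≤ C * K) ∧
        ∀ j, j + 1 < N → |y t (j + 1) - y t j| ≤ C * K / N := by
  obtain ⟨C, hC, hsup⟩ := exists_sup_bound hE hα.1 hβ T
  refine ⟨4 * (1 + 2 * E) * C, by nlinarith, ?_⟩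
  intro N hN K hK y s hd hsN hsK h0 h0' t ht
  have hN2 : (2 : ℝ) ≤ N := by exact_mod_cast hN
  have hs := hsup N hN K hK y s hd hsN hsK h0
  have hCK : K ≤ C * K := le_mul_of_one_le_left hK hC
  have hEC : 0 ≤ E * (C * K) := by positivity
  set K' := K + 2 * (E * (C * K)) with hK'
  have hK'0 : 0 ≤ K' := by positivity
  have hKK' : K ≤ K' := by linarith
  let bd : ℝ → ℕ → ℝ := fun t j => (if j = 0 then -α * E * N * y t 0 else 0) +
    if j = N - 1 then β * E * N * y t (N - 1) else 0
  have hbd : ∀ t ∈ Icc 0 T, ∀ j, |bd t j| ≤ N * (2 * (E * (C * K))) := by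
    intro t ht j
    have hNE : 0 ≤ N * (E * (C * K)) := by positivity
    have h1 : |(if j = 0 then -α * E * N * y t 0 else 0)| ≤ N * (E * (C * K)) := by
      split_ifs
      · rw [show -α * E * N * y t 0 = -(α * (N * (E * y t 0))) by ring, abs_neg, abs_mul,
          abs_of_pos hα.1, abs_mul, abs_of_nonneg (by positivity : (0 : ℝ) ≤ N), abs_mul,
          abs_of_pos hE]
        refine (mul_le_of_le_one_left (by positivity) hα.2.le).trans ?_
        gcongr
        exact hs t ht 0 (by omega)
      · simpa using hNE
    have h2 : |(if j = N - 1 then β * E * N * y t (N - 1) else 0)| ≤ N * (E * (C * K)) := by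
      split_ifs
      · rw [show β * E * N * y t (N - 1) = β * (N * (E * y t (N - 1))) by ring, abs_mul,
          abs_of_pos hβ.1, abs_mul, abs_of_nonneg (by positivity : (0 : ℝ) ≤ N), abs_mul,
          abs_of_pos hE]
        refine (mul_le_of_le_one_left (by positivity) hβ.2.le).trans ?_
        gcongr
        exact hs t ht (N - 1) (by omega)
      · simpa using hNE
    have := abs_add_le (if j = 0 then -α * E * N * y t 0 else 0)
      (if j = N - 1 then β * E * N * y t (N - 1) else 0)
    simp only [bd]
    linarith
  have hgrad := gradient_bound hE hN (T := T) hK'0 (y := y) (s := fun t j => s t j + bd t j)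
    ?_ ?_ ?_ ?_ t ht
  · refine ⟨fun j hj => (hs t ht j hj).trans ?_, fun j hj => (hgrad j hj).trans ?_⟩
    · have : 0 ≤ C * K := by positivity
      nlinarith
    · have : 4 * K' ≤ 4 * (1 + 2 * E) * C * K := by rw [hK']; nlinarith
      gcongr
  · intro t ht j hj
    refine (hd t ht j hj).congr_deriv ?_
    rw [Omega_eq_neumannOp E α β hN _ hj]
    simp only [bd]
    ring
  · intro t ht j hj
    have h1 := hsN t ht j hj
    have h2 := hbd t ht j
    have := abs_add_le (s t j) (bd t j)
    rw [hK', mul_add]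
    linarith
  · intro t ht j hj hj0 hj1
    have : bd t j = 0 := by
      simp only [bd]
      rw [if_neg (by omega), if_neg (by omega), add_zero]
    rw [this, add_zero]
    exact (hsK t ht j hj hj0 hj1).trans hKK'
  · exact fun j hj => (h0' j hj).trans (by gcongr)

/-- Bounds, uniform in `N`, on a grid function `a` and on `Ω a`, together with their difference
quotients. -/
structure IsRegular (E α β : ℝ) (N : ℕ) (C : ℝ) (a : ℕ → ℝ) : Prop where
  bound : ∀ j < N, |a j| ≤ C
  grad : ∀ j, j + 1 < N → |a (j + 1) - a j| ≤ C / N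
  bound_Omega : ∀ j < N, |Omega E α β N a j| ≤ C
  grad_Omega : ∀ j, j + 1 < N → |Omega E α β N a (j + 1) - Omega E α β N a j| ≤ C / N

theorem Omega_interior (E α β : ℝ) (N : ℕ) (f : ℕ → ℝ) {j : ℕ} (hj : j + 2 < N) :
    Omega E α β N f (j + 1) = (N : ℝ) ^ 2 * (f (j + 2) + f j - 2 * f (j + 1)) -
      E * (N * (f (j + 1) - f j)) := by
  unfold Omega gradPlus gradMinus discreteLaplacian
  rw [if_neg (by omega), if_neg (by omega), Nat.add_sub_cancel]
  ring

theorem Omega_zero (E α β : ℝ) (N : ℕ) (f : ℕ → ℝ) :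
    Omega E α β N f 0 = N * (N * (f 1 - f 0) - α * E * f 0) := by
  unfold Omega gradPlus
  rw [if_pos rfl]
  ring

theorem Omega_last (E α β : ℝ) (n : ℕ) (f : ℕ → ℝ) :
    Omega E α β (n + 2) f (n + 1) = ((n + 2 : ℕ) : ℝ) * (β * E * f (n + 1) -
      (1 + E / ((n + 2 : ℕ) : ℝ)) * (((n + 2 : ℕ) : ℝ) * (f (n + 1) - f n))) := by
  unfold Omega gradMinus
  rw [if_neg (by omega), if_pos (by omega), show n + 2 - 1 = n + 1 from rfl, Nat.add_sub_cancel]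
  ring

/-- Passing to the double grid: averaging a regular fine grid function over pairs of neighbours
commutes with `Ω` up to `O(1/N)`, and up to `O(1)` at the end points. -/
theorem Omega_average {E α β : ℝ} (hE : 0 < E) (hα : α ∈ Ioo (0 : ℝ) 1) (hβ : β ∈ Ioo (0 : ℝ) 1)
    {N : ℕ} (hN : 2 ≤ N) {C : ℝ} (hC : 0 ≤ C) {a : ℕ → ℝ} (ha : IsRegular E α β (2 * N) C a) :
    (∀ j < N, |(Omega E α β (2 * N) a (2 * j) + Omega E α β (2 * N) a (2 * j + 1)) / 2 -
        Omega E α β N (fun i => (a (2 * i) + a (2 * i + 1)) / 2) j| ≤ 10 * (1 + E) ^ 3 * C) ∧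
    (∀ j < N, 0 < j → j + 1 < N →
      |(Omega E α β (2 * N) a (2 * j) + Omega E α β (2 * N) a (2 * j + 1)) / 2 -
        Omega E α β N (fun i => (a (2 * i) + a (2 * i + 1)) / 2) j| ≤
        10 * (1 + E) ^ 3 * C / N) := by
  have hN2 : (2 : ℝ) ≤ N := by exact_mod_cast hN
  have hN0 : (0 : ℝ) < N := by linarith
  set M := 2 * N with hM
  have hMN : (M : ℝ) = 2 * N := by rw [hM]; push_cast; ring
  have hNM : (N : ℝ) = M / 2 := by rw [hMN]; ring
  have hM0 : (0 : ℝ) < M := by rw [hMN]; linarith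
  have hM1 : (1 : ℝ) ≤ M := by rw [hMN]; linarith
  have hM0' : (M : ℝ) ≠ 0 := hM0.ne'
  -- `G j` is the difference quotient between `j` and `j + 1`.
  let G : ℕ → ℝ := fun i => M * (a (i + 1) - a i)
  have hG : ∀ i, i + 1 < M → |G i| ≤ C := by
    intro i hi
    simp only [G]
    rw [abs_mul, abs_of_pos hM0]
    calc (M : ℝ) * |a (i + 1) - a i| ≤ M * (C / M) := by gcongr; exact ha.grad i hi
      _ = C := by field_simp
  have hEm : ∀ z B : ℝ, |z| ≤ B → |E * z| ≤ E * B := fun z B h => by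
    rw [abs_mul, abs_of_pos hE]; gcongr
  have hMd : ∀ z B : ℝ, |z| ≤ B → |z / M| ≤ B / M := fun z B h => by
    rw [abs_div, abs_of_pos hM0]; gcongr
  have hMd1 : ∀ z B : ℝ, |z| ≤ B → |z / M| ≤ B := fun z B h => by
    refine (hMd z B h).trans (div_le_self ((abs_nonneg z).trans h) hM1)
  have interior : ∀ j < N, 0 < j → j + 1 < N →
      |(Omega E α β M a (2 * j) + Omega E α β M a (2 * j + 1)) / 2 -
        Omega E α β N (fun i => (a (2 * i) + a (2 * i + 1)) / 2) j| ≤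
        10 * (1 + E) ^ 3 * C / M := by
    intro j hj hj0 hj1
    obtain ⟨k, rfl⟩ : ∃ k, j = k + 1 := ⟨j - 1, by omega⟩
    have e2 : 2 * (k + 1) = 2 * k + 2 := by ring
    have e3 : 2 * (k + 2) = 2 * k + 4 := by ring
    rw [Omega_interior E α β N _ hj1]
    simp only [e2, e3]
    have w1 := Omega_interior E α β M a (j := 2 * k) (by omega)
    have w2 := Omega_interior E α β M a (j := 2 * k + 1) (by omega)
    have w3 := Omega_interior E α β M a (j := 2 * k + 2) (by omega)
    have w4 := Omega_interior E α β M a (j := 2 * k + 3) (by omega)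
    have d1 := ha.grad_Omega (2 * k + 1) (by omega)
    have d3 := ha.grad_Omega (2 * k + 3) (by omega)
    have b1 := ha.bound_Omega (2 * k + 1) (by omega)
    have b2 := ha.bound_Omega (2 * k + 2) (by omega)
    have b3 := ha.bound_Omega (2 * k + 3) (by omega)
    have g0 := hG (2 * k) (by omega)
    have g1 := hG (2 * k + 1) (by omega)
    have g2 := hG (2 * k + 2) (by omega)
    simp only [G] at g0 g1 g2
    simp only [add_assoc, Nat.reduceAdd] at *
    set W1 := Omega E α β M a (2 * k + 1)
    set W2 := Omega E α β M a (2 * k + 2)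
    set W3 := Omega E α β M a (2 * k + 3)
    set W4 := Omega E α β M a (2 * k + 4)
    set G0 := (M : ℝ) * (a (2 * k + 1) - a (2 * k))
    set G1 := (M : ℝ) * (a (2 * k + 2) - a (2 * k + 1))
    set G2 := (M : ℝ) * (a (2 * k + 3) - a (2 * k + 2))
    have e : (W2 + W3) / 2 - ((N : ℝ) ^ 2 * ((a (2 * k + 4) + a (2 * k + 5)) / 2 +
        (a (2 * k) + a (2 * k + 1)) / 2 - 2 * ((a (2 * k + 2) + a (2 * k + 3)) / 2)) -
        E * (N * ((a (2 * k + 2) + a (2 * k + 3)) / 2 - (a (2 * k) + a (2 * k + 1)) / 2))) =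
        -((W4 - W3) + E * ((W3 + E * G2) / M) - (W2 - W1) - E * ((W1 + E * G0) / M)) / 8
        - E * ((W2 + E * G1) / M) / 2
        + E * (((W2 - W1) + E * ((W1 + E * G0) / M)) / M) / 4 := by
      rw [hNM, w1, w2, w3, w4]
      simp only [G0, G1, G2]
      field_simp
      ring
    rw [e]
    have hs : ∀ w g : ℝ, |w| ≤ C → |g| ≤ C → |E * ((w + E * g) / M)| ≤ E * ((C + E * C) / M) := by
      intro w g hw hg
      exact hEm _ _ (hMd _ _ ((abs_add_le _ _).trans (add_le_add hw (hEm _ _ hg))))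
    have s1 := hs _ _ b3 g2
    have s2 := hs _ _ b1 g0
    have s3 := hs _ _ b2 g1
    have s4 := hEm _ _ (hMd1 _ _ ((abs_add_le (W2 - W1) (E * ((W1 + E * G0) / M))).trans
      (add_le_add d1 s2)))
    have hfin : 10 * (1 + E) ^ 3 * C / M = 10 * (C / M) + 30 * (E * (C / M)) +
        30 * (E * (E * (C / M))) + 10 * (E * (E * (E * (C / M)))) := by ring
    have h0 : 0 ≤ C / M := by positivity
    have h1 : 0 ≤ E * (C / M) := by positivity
    have h2 : 0 ≤ E * (E * (C / M)) := by positivity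
    have h3 : 0 ≤ E * (E * (E * (C / M))) := by positivity
    have q1 : E * ((C + E * C) / M) = E * (C / M) + E * (E * (C / M)) := by ring
    have q2 : E * (C / M + (E * (C / M) + E * (E * (C / M)))) =
      E * (C / M) + E * (E * (C / M)) + E * (E * (E * (C / M))) := by ring
    rw [hfin]
    rw [q1] at s1 s2 s3 s4
    rw [q2] at s4
    rw [abs_le] at *
    constructor <;> linarith [d1.1, d1.2, d3.1, d3.2, s1.1, s1.2, s2.1, s2.2, s3.1, s3.2,
      s4.1, s4.2]
  have hMNle : 10 * (1 + E) ^ 3 * C / M ≤ 10 * (1 + E) ^ 3 * C / N := by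
    gcongr
    linarith
  have hfin : 10 * (1 + E) ^ 3 * C = 10 * C + 30 * (E * C) +
      30 * (E * (E * C)) + 10 * (E * (E * (E * C))) := by ring
  have h1 : 0 ≤ E * C := by positivity
  have h2 : 0 ≤ E * (E * C) := by positivity
  have h3 : 0 ≤ E * (E * (E * C)) := by positivity
  refine ⟨fun j hj => ?_, fun j hj hj0 hj1 => (interior j hj hj0 hj1).trans hMNle⟩
  rcases Nat.eq_zero_or_pos j with rfl | hj0
  · have w0 := Omega_zero E α β M a
    have w1 := Omega_interior E α β M a (j := 0) (by omega)
    have w2 := Omega_interior E α β M a (j := 1) (by omega)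
    have b0 := ha.bound_Omega 0 (by omega)
    have b1 := ha.bound_Omega 1 (by omega)
    have b2 := ha.bound_Omega 2 (by omega)
    have g0 := hG 0 (by omega)
    have g1 := hG 1 (by omega)
    simp only [G] at g0 g1
    rw [Omega_zero E α β N]
    simp only [mul_zero, mul_one, zero_add, Nat.reduceAdd] at *
    set W0 := Omega E α β M a 0
    set W1 := Omega E α β M a 1
    set W2 := Omega E α β M a 2
    set G0 := (M : ℝ) * (a 1 - a 0)
    set G1 := (M : ℝ) * (a 2 - a 1)
    have e : (W0 + W1) / 2 - (N : ℝ) * (N * ((a 2 + a 3) / 2 - (a 0 + a 1) / 2) -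
        α * E * ((a 0 + a 1) / 2)) =
        W1 / 2 - (3 * (W1 + E * G0) + (W2 + E * G1)) / 8 + α * (E * G0) / 4 := by
      rw [hNM, w0, w1, w2]
      simp only [G0, G1]
      field_simp
      ring
    rw [e]
    have s0 := hEm _ _ g0
    have s1 := hEm _ _ g1
    have s2 : |α * (E * G0)| ≤ E * C := by
      rw [abs_mul, abs_of_pos hα.1]
      exact (mul_le_of_le_one_left (abs_nonneg _) hα.2.le).trans s0
    rw [hfin]
    rw [abs_le] at *
    constructor <;> linarith [b0.1, b0.2, b1.1, b1.2, b2.1, b2.2, s0.1, s0.2, s1.1, s1.2, s2.1,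
      s2.2]
  by_cases hjl : j + 1 < N
  · refine (interior j hj hj0 hjl).trans (div_le_self (by positivity) hM1)
  · obtain ⟨k, rfl⟩ : ∃ k, N = k + 2 := ⟨N - 2, by omega⟩
    obtain rfl : j = k + 1 := by omega
    have eM : M = 2 * k + 2 + 2 := by rw [hM]; ring
    have w3 := Omega_last E α β (2 * k + 2) a
    rw [← eM] at w3
    have w1 := Omega_interior E α β M a (j := 2 * k) (by omega)
    have w2 := Omega_interior E α β M a (j := 2 * k + 1) (by omega)
    have b1 := ha.bound_Omega (2 * k + 1) (by omega)
    have b2 := ha.bound_Omega (2 * k + 2) (by omega)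
    have g0 := hG (2 * k) (by omega)
    have g1 := hG (2 * k + 1) (by omega)
    have g2 := hG (2 * k + 2) (by omega)
    simp only [G] at g0 g1 g2
    rw [Omega_last E α β k]
    have e2 : 2 * (k + 1) = 2 * k + 2 := by ring
    simp only [e2]
    simp only [add_assoc, Nat.reduceAdd] at *
    set W1 := Omega E α β M a (2 * k + 1)
    set W2 := Omega E α β M a (2 * k + 2)
    set W3 := Omega E α β M a (2 * k + 3)
    set G0 := (M : ℝ) * (a (2 * k + 1) - a (2 * k))
    set G1 := (M : ℝ) * (a (2 * k + 2) - a (2 * k + 1))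
    set G2 := (M : ℝ) * (a (2 * k + 3) - a (2 * k + 2))
    rw [hNM]
    have e : (W2 + W3) / 2 - (M : ℝ) / 2 * (β * E * ((a (2 * k + 2) + a (2 * k + 3)) / 2) -
        (1 + E / ((M : ℝ) / 2)) * ((M : ℝ) / 2 * ((a (2 * k + 2) + a (2 * k + 3)) / 2 -
          (a (2 * k) + a (2 * k + 1)) / 2))) =
        W2 / 2 + E * G2 / 2 + β * (E * G2) / 4 - (3 * (W2 + E * G1) + (W1 + E * G0)) / 8 -
          E * ((3 * (W2 + E * G1) + (W1 + E * G0)) / M) / 4 := by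
      rw [w1, w2, w3]
      simp only [G0, G1, G2]
      field_simp
      ring
    rw [e]
    have s0 := hEm _ _ g0
    have s1 := hEm _ _ g1
    have s2 := hEm _ _ g2
    have s3 : |β * (E * G2)| ≤ E * C := by
      rw [abs_mul, abs_of_pos hβ.1]
      exact (mul_le_of_le_one_left (abs_nonneg _) hβ.2.le).trans s2
    have s4 : |3 * (W2 + E * G1) + (W1 + E * G0)| ≤ 4 * (C + E * C) := by
      rw [abs_le] at *
      constructor <;> linarith [b1.1, b1.2, b2.1, b2.2, s0.1, s0.2, s1.1, s1.2]
    have s5 := hEm _ _ (hMd1 _ _ s4)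
    rw [hfin]
    have q : E * (4 * (C + E * C)) = 4 * (E * C) + 4 * (E * (E * C)) := by ring
    rw [q] at s5
    rw [abs_le] at *
    constructor <;> linarith [b1.1, b1.2, b2.1, b2.2, s0.1, s0.2, s1.1, s1.2, s2.1, s2.2, s3.1,
      s3.2, s4.1, s4.2, s5.1, s5.2]

theorem IsRegular.mono {E α β : ℝ} {N : ℕ} {C C' : ℝ} {a : ℕ → ℝ} (h : IsRegular E α β N C a)
    (hC : C ≤ C') : IsRegular E α β N C' a where
  bound j hj := (h.bound j hj).trans hC
  grad j hj := (h.grad j hj).trans (by gcongr)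
  bound_Omega j hj := (h.bound_Omega j hj).trans hC
  grad_Omega j hj := (h.grad_Omega j hj).trans (by gcongr)

/-- `IsDataClose N K F v`: the grid function `v` and its increments agree with those of the samples
of `F` up to `K / N` and `K / N ^ 2`. -/
structure IsDataClose (N : ℕ) (K : ℝ) (F : ℝ → ℝ) (v : ℕ → ℝ) : Prop where
  close : ∀ j < N, |v j - F ((j : ℝ) / N)| ≤ K / N
  grad : ∀ j, j + 1 < N → |(v (j + 1) - F (((j : ℝ) + 1) / N)) - (v j - F ((j : ℝ) / N))| ≤
    K / (N : ℝ) ^ 2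

/-- Solutions from well-prepared data stay regular, since `Ω a` solves the same linear system. -/
theorem exists_regular_solution {E α β K : ℝ} (hE : 0 < E) (hα : α ∈ Ioo (0 : ℝ) 1)
    (hβ : β ∈ Ioo (0 : ℝ) 1) (T : ℝ) (hK : 0 ≤ K) {F F₁ F₂ : ℝ → ℝ}
    (hF : IsRobinProfile E α β K F F₁ F₂) :
    ∃ C, 0 ≤ C ∧ ∀ M : ℕ, 2 ≤ M → ∃ a : ℝ → ℕ → ℝ,
      (∀ t ∈ Icc 0 T, ∀ j < M, HasDerivWithinAt (fun τ => a τ j) (Omega E α β M (a t) j)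
        (Ici 0) t) ∧
      (∀ t ∈ Icc 0 T, IsRegular E α β M C (a t)) ∧ IsDataClose M C F (a 0) := by
  obtain ⟨C₀, hC₀, hwp⟩ := exists_wellPrepared hE hβ hK hF
  obtain ⟨C₁, hC₁, hC1⟩ := exists_C1_bound hE hα hβ T
  refine ⟨C₁ * C₀, by positivity, ?_⟩
  intro M hM
  obtain ⟨v, hv1, hv2, hv3, hv4, hv5, hv6⟩ := hwp M hM
  obtain ⟨a, ha0, had⟩ := exists_Omega_solution E α β M v
  have hO : ∀ j < M, Omega E α β M (a 0) j = Omega E α β M v j := fun j hj =>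
    Omega_congr E α β ha0 hM hj
  have hle : C₀ ≤ C₁ * C₀ := le_mul_of_one_le_left hC₀ hC₁
  have hd : ∀ t ∈ Icc 0 T, ∀ j < M, HasDerivWithinAt (fun τ => a τ j) (Omega E α β M (a t) j)
      (Ici 0) t := fun t _ j hj => (had t j hj).hasDerivWithinAt
  have hMC : 0 ≤ (M : ℝ) * C₀ := by positivity
  have h1 := hC1 M hM C₀ hC₀ a (fun _ _ => 0)
    (fun t ht j hj => (hd t ht j hj).congr_deriv (by ring)) (fun _ _ _ _ => by simpa using hMC)
    (fun _ _ _ _ _ _ => by simpa using hC₀) (fun j hj => by rw [ha0 j hj]; exact hv1 j hj)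
    (fun j hj => by rw [ha0 j (by omega), ha0 (j + 1) hj]; exact hv2 j hj)
  have h2 := hC1 M hM C₀ hC₀ (fun t => Omega E α β M (a t)) (fun _ _ => 0)
    (fun t ht j hj => (hasDerivWithinAt_Omega hM (hd t ht) hj).congr_deriv (by ring))
    (fun _ _ _ _ => by simpa using hMC)
    (fun _ _ _ _ _ _ => by simpa using hC₀) (fun j hj => by rw [hO j hj]; exact hv3 j hj)
    (fun j hj => by rw [hO j (by omega), hO (j + 1) hj]; exact hv4 j hj)
  refine ⟨a, hd, fun t ht => ⟨(h1 t ht).1, (h1 t ht).2, (h2 t ht).1, (h2 t ht).2⟩, ?_, ?_⟩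
  · intro j hj
    rw [ha0 j hj]
    exact (hv5 j hj).trans (by gcongr)
  · intro j hj
    rw [ha0 j (by omega), ha0 (j + 1) hj]
    exact (hv6 j hj).trans (by gcongr)

/-- `IsC1Close N C f g`: `f` and `g` differ by at most `C / N`, and their increments by at most
`C / N ^ 2`. -/
structure IsC1Close (N : ℕ) (C : ℝ) (f g : ℕ → ℝ) : Prop where
  close : ∀ j < N, |f j - g j| ≤ C / N
  grad : ∀ j, j + 1 < N → |(f (j + 1) - g (j + 1)) - (f j - g j)| ≤ C / (N : ℝ) ^ 2

/-- Two approximate solutions with close data stay close. -/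
theorem exists_stability {E α β : ℝ} (hE : 0 < E) (hα : α ∈ Ioo (0 : ℝ) 1)
    (hβ : β ∈ Ioo (0 : ℝ) 1) (T : ℝ) {K : ℝ} (hK : 0 ≤ K) : ∃ C, 0 ≤ C ∧ ∀ N : ℕ, 2 ≤ N →
      ∀ y z s : ℝ → ℕ → ℝ,
      (∀ t ∈ Icc 0 T, ∀ j < N, HasDerivWithinAt (fun τ => y τ j)
        (Omega E α β N (y t) j + s t j) (Ici 0) t) →
      (∀ t ∈ Icc 0 T, ∀ j < N, HasDerivWithinAt (fun τ => z τ j)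
        (Omega E α β N (z t) j) (Ici 0) t) →
      (∀ t ∈ Icc 0 T, ∀ j < N, |s t j| ≤ K) →
      (∀ t ∈ Icc 0 T, ∀ j < N, 0 < j → j + 1 < N → |s t j| ≤ K / N) →
      IsC1Close N K (y 0) (z 0) → ∀ t ∈ Icc 0 T, IsC1Close N C (y t) (z t) := by
  obtain ⟨C₁, hC₁, hC1⟩ := exists_C1_bound hE hα hβ T
  refine ⟨C₁ * K, by positivity, ?_⟩
  intro N hN y z s hy hz hs hs' h0 t ht
  have hN0 : (0 : ℝ) < N := by exact_mod_cast (by omega : 0 < N)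
  have h := hC1 N hN (K / N) (by positivity) (fun t j => y t j - z t j) s ?_ ?_ hs' h0.close ?_ t ht
  · refine ⟨fun j hj => (h.1 j hj).trans (by rw [mul_div_assoc]), fun j hj => (h.2 j hj).trans ?_⟩
    apply le_of_eq; field_simp
  · intro t ht j hj
    refine ((hy t ht j hj).sub (hz t ht j hj)).congr_deriv ?_
    rw [Omega_sub]; ring
  · intro t ht j hj
    refine (hs t ht j hj).trans (le_of_eq ?_)
    field_simp
  · intro j hj
    refine (h0.grad j hj).trans (le_of_eq ?_)
    field_simp

theorem IsSemidiscreteSolution.hasDerivWithinAt {E α β : ℝ} {ρ₀ : ℝ → ℝ} {N : ℕ}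
    {lam : ℝ → ℕ → ℝ} (h : IsSemidiscreteSolution E α β ρ₀ N lam) (T : ℝ) :
    ∀ t ∈ Icc 0 T, ∀ j < N, HasDerivWithinAt (fun τ => lam τ j) (Omega E α β N (lam t) j)
      (Ici 0) t := fun t ht j hj => h.evolution t ht.1 j hj

theorem exists_semidiscreteSolution (E α β : ℝ) (ρ₀ : ℝ → ℝ) (N : ℕ) :
    ∃ lam, IsSemidiscreteSolution E α β ρ₀ N lam := by
  obtain ⟨a, ha0, had⟩ := exists_Omega_solution E α β N (initialLam E ρ₀ N)
  exact ⟨a, ha0, fun t _ j hj => (had t j hj).hasDerivWithinAt⟩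

/-- The averages over pairs of neighbours of well-prepared data on the double grid are close to the
data on the original grid. -/
theorem average_data_close {E α β K : ℝ} (hK : 0 ≤ K) {F F₁ F₂ : ℝ → ℝ}
    (hF : IsRobinProfile E α β K F F₁ F₂) {N : ℕ} (hN : 2 ≤ N) {C : ℝ} (hC : 0 ≤ C)
    {v a : ℕ → ℝ} (hv : IsDataClose N C F v) (ha : IsDataClose (2 * N) C F a) :
    IsC1Close N (20 * (K + C)) (fun j => (a (2 * j) + a (2 * j + 1)) / 2) v := by
  have hN2 : (2 : ℝ) ≤ N := by exact_mod_cast hN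
  have hN0 : (0 : ℝ) < N := by linarith
  have hM : ((2 * N : ℕ) : ℝ) = 2 * N := by push_cast; ring
  have hmem : ∀ i : ℕ, i ≤ 2 * N → (i : ℝ) / (2 * N) ∈ Icc (0 : ℝ) 1 := fun i hi =>
    ⟨by positivity, by rw [div_le_one (by positivity)]; exact_mod_cast hi⟩
  have hx : ∀ j : ℕ, (((2 * j : ℕ) : ℝ)) / (2 * N) = j / N := fun j => by
    push_cast; field_simp
  have hx1 : ∀ j : ℕ, (((2 * j : ℕ) : ℝ) + 1) / (2 * N) = ((2 * j + 1 : ℕ) : ℝ) / (2 * N) :=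
    fun j => by push_cast; ring
  have ha1 := ha.close
  have ha2 := ha.grad
  rw [hM] at ha1 ha2
  have hCN : C / (2 * (N : ℝ)) ≤ C / N := by gcongr; linarith
  have hCN2 : C / (2 * (N : ℝ)) ^ 2 ≤ C / (N : ℝ) ^ 2 := by gcongr; linarith
  have hpK : 0 ≤ K / (N : ℝ) := by positivity
  have hpC : 0 ≤ C / (N : ℝ) := by positivity
  have hpK2 : 0 ≤ K / (N : ℝ) ^ 2 := by positivity
  have hpC2 : 0 ≤ C / (N : ℝ) ^ 2 := by positivity
  refine ⟨fun j hj => ?_, fun j hj => ?_⟩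
  · have h1 := ha1 (2 * j) (by omega)
    have h2 := ha1 (2 * j + 1) (by omega)
    have h3 := hv.close j hj
    have h4 := lipschitz_of_bound hF.deriv₁ hF.bound₁ (hmem (2 * j) (by omega))
      (hmem (2 * j + 1) (by omega))
    rw [hx] at h1 h4
    have e : ((2 * j + 1 : ℕ) : ℝ) / (2 * N) - j / N = 1 / (2 * N) := by
      push_cast; field_simp; ring
    rw [e, abs_of_nonneg (by positivity : (0 : ℝ) ≤ 1 / (2 * N))] at h4
    have h5 : K * (1 / (2 * N)) = K / N / 2 := by field_simp
    rw [h5] at h4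
    have h6 : 20 * (K + C) / N = 20 * (K / N) + 20 * (C / N) := by ring
    rw [h6]
    rw [abs_le] at *
    constructor <;> linarith [h1.1, h1.2, h2.1, h2.2, h3.1, h3.2, h4.1, h4.2]
  · have d1 := ha2 (2 * j) (by omega)
    have d2 := ha2 (2 * j + 1) (by omega)
    have d3 := ha2 (2 * j + 2) (by omega)
    have d0 := hv.grad j hj
    have m0 := hmem (2 * j) (by omega)
    have m1 := hmem (2 * j + 1) (by omega)
    have m2 := hmem (2 * j + 2) (by omega)
    have m3 := hmem (2 * j + 3) (by omega)
    have tay : ∀ k : ℕ, 2 * j + k ≤ 2 * N → k ≤ 3 →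
        |F (((2 * j + k : ℕ) : ℝ) / (2 * N)) - F ((j : ℝ) / N) -
          (k : ℝ) / (2 * N) * F₁ ((j : ℝ) / N) -
          ((k : ℝ) / (2 * N)) ^ 2 / 2 * F₂ ((j : ℝ) / N)| ≤ 4 * (K / N ^ 2) := by
      intro k hk hk3
      have h := taylor_two hF.deriv₁ hF.deriv₂ hF.lipschitz hK m0 (hmem (2 * j + k) hk)
      have e : ((2 * j + k : ℕ) : ℝ) / (2 * N) - ((2 * j : ℕ) : ℝ) / (2 * N) = k / (2 * N) := by
        push_cast; ring
      rw [e, hx, abs_of_nonneg (by positivity : (0 : ℝ) ≤ (k : ℝ) / (2 * N))] at h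
      refine h.trans ?_
      have hk' : (k : ℝ) ≤ 3 := by exact_mod_cast hk3
      calc K * ((k : ℝ) / (2 * N)) ^ 3 ≤ K * (3 / (2 * N)) ^ 3 := by gcongr
        _ = K / N ^ 2 * (27 / 8 / N) := by field_simp; ring
        _ ≤ K / N ^ 2 * 4 := by
          gcongr
          rw [div_le_iff₀ hN0]; linarith
        _ = _ := by ring
    have t1 := tay 1 (by omega) (by omega)
    have t2 := tay 2 (by omega) (by omega)
    have t3 := tay 3 (by omega) (by omega)
    have hb := hF.bound₂ _ m0
    rw [hx] at hb
    have hb2 : |F₂ ((j : ℝ) / N) / N ^ 2| ≤ K / N ^ 2 := by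
      rw [abs_div, abs_of_pos (by positivity : (0 : ℝ) < (N : ℝ) ^ 2)]
      gcongr
    have e4 : 2 * (j + 1) = 2 * j + 2 := by ring
    have c1 : (((2 * j : ℕ) : ℝ) + 1) / (2 * N) = ((2 * j + 1 : ℕ) : ℝ) / (2 * N) := by
      push_cast; ring
    have c2 : (((2 * j + 1 : ℕ) : ℝ) + 1) / (2 * N) = ((2 * j + 2 : ℕ) : ℝ) / (2 * N) := by
      push_cast; ring
    have c3 : (((2 * j + 2 : ℕ) : ℝ) + 1) / (2 * N) = ((2 * j + 3 : ℕ) : ℝ) / (2 * N) := by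
      push_cast; ring
    have c4 : ((j : ℝ) + 1) / N = ((2 * j + 2 : ℕ) : ℝ) / (2 * N) := by
      push_cast; field_simp
    rw [c1, hx] at d1
    rw [c2] at d2
    rw [c3] at d3
    rw [c4] at d0
    simp only [e4]
    simp only [add_assoc, Nat.reduceAdd] at *
    set f0 := F ((j : ℝ) / N)
    set f1 := F (((2 * j + 1 : ℕ) : ℝ) / (2 * N))
    set f2 := F (((2 * j + 2 : ℕ) : ℝ) / (2 * N))
    set f3 := F (((2 * j + 3 : ℕ) : ℝ) / (2 * N))
    -- The second difference of the profile that the averages introduce.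
    have hsec : |(f3 - f2) - (f1 - f0)| ≤ 13 * (K / N ^ 2) := by
      have e : (f3 - f2) - (f1 - f0) =
          (f3 - f0 - ((3 : ℕ) : ℝ) / (2 * N) * F₁ ((j : ℝ) / N) -
            (((3 : ℕ) : ℝ) / (2 * N)) ^ 2 / 2 * F₂ ((j : ℝ) / N)) -
          (f2 - f0 - ((2 : ℕ) : ℝ) / (2 * N) * F₁ ((j : ℝ) / N) -
            (((2 : ℕ) : ℝ) / (2 * N)) ^ 2 / 2 * F₂ ((j : ℝ) / N)) -
          (f1 - f0 - ((1 : ℕ) : ℝ) / (2 * N) * F₁ ((j : ℝ) / N) -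
            (((1 : ℕ) : ℝ) / (2 * N)) ^ 2 / 2 * F₂ ((j : ℝ) / N)) +
          F₂ ((j : ℝ) / N) / N ^ 2 / 2 := by
        push_cast
        field_simp
        ring
      rw [e]
      rw [abs_le] at t1 t2 t3 hb2 ⊢
      constructor <;> linarith [t1.1, t1.2, t2.1, t2.2, t3.1, t3.2, hb2.1, hb2.2]
    have h6 : 20 * (K + C) / (N : ℝ) ^ 2 = 20 * (K / N ^ 2) + 20 * (C / N ^ 2) := by ring
    rw [h6]
    rw [abs_le] at d0 d1 d2 d3 hsec ⊢
    constructor <;> linarith [d0.1, d0.2, d1.1, d1.2, d2.1, d2.2, d3.1, d3.2, hsec.1, hsec.2]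

/-- A semidiscrete solution is bounded away from zero and close to a regular grid function. The
solution on the double grid is close to a regular function `a` as well, whose averages over pairs of
neighbours are close to the original solution. Closeness includes the difference quotients. -/
theorem exists_semidiscrete_estimates {E α β : ℝ} (hE : 0 < E) (hα : α ∈ Ioo (0 : ℝ) 1)
    (hβ : β ∈ Ioo (0 : ℝ) 1) {ρ₀ : ℝ → ℝ} (hρ₀ : ContDiffOn ℝ 4 ρ₀ (Icc 0 1))
    (hrange : ∀ x ∈ Icc (0 : ℝ) 1, ρ₀ x ∈ Icc (0 : ℝ) 1)
    (hleft : ρ₀ 0 = α) (hright : ρ₀ 1 = β) (T : ℝ) :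
    ∃ c C, 0 < c ∧ 0 ≤ C ∧ ∀ N : ℕ, 2 ≤ N → ∀ lam, IsSemidiscreteSolution E α β ρ₀ N lam →
      ∀ t ∈ Icc 0 T, (∀ j < N, c ≤ lam t j) ∧
        (∃ a, IsRegular E α β N C a ∧ IsC1Close N C (lam t) a) ∧
        ∀ lam', IsSemidiscreteSolution E α β ρ₀ (2 * N) lam' →
          ∃ a, IsRegular E α β (2 * N) C a ∧ IsC1Close (2 * N) C (lam' t) a ∧
            IsC1Close N C (fun j => (a (2 * j) + a (2 * j + 1)) / 2) (lam t) := by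
  obtain ⟨K, F, F₁, F₂, hK, hF, hclose⟩ := exists_robinProfile hE hρ₀ hrange hleft hright
  obtain ⟨c, hc, hlow⟩ := exists_lower_bound hE hα hβ T
  obtain ⟨C₀, hC₀, hreg⟩ := exists_regular_solution hE hα hβ T hK hF
  set C₁ := C₀ + K with hC₁
  have hC₁0 : 0 ≤ C₁ := by positivity
  obtain ⟨C₂, hC₂, hstab⟩ := exists_stability hE hα hβ T hC₁0
  set K₃ := 20 * (K + C₁) + 10 * (1 + E) ^ 3 * C₀ with hK₃
  have hK₃0 : 0 ≤ K₃ := by positivity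
  obtain ⟨C₃, hC₃, hstab'⟩ := exists_stability hE hα hβ T hK₃0
  have hdata : ∀ N : ℕ, 2 ≤ N → ∀ lam, IsSemidiscreteSolution E α β ρ₀ N lam →
      IsDataClose N K F (lam 0) := by
    intro N hN lam hlam
    have h := hclose N (by omega)
    refine ⟨fun j hj => ?_, fun j hj => ?_⟩
    · rw [hlam.initial j hj]; exact h.1 j hj.le
    · rw [hlam.initial j (by omega), hlam.initial (j + 1) hj]; exact h.2 j (by omega)
  -- Closeness to the solution from well-prepared data on the same grid.
  have hsame : ∀ N : ℕ, 2 ≤ N → ∀ lam a : ℝ → ℕ → ℝ, IsSemidiscreteSolution E α β ρ₀ N lam →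
      (∀ t ∈ Icc 0 T, ∀ j < N, HasDerivWithinAt (fun τ => a τ j) (Omega E α β N (a t) j)
        (Ici 0) t) → IsDataClose N C₀ F (a 0) → ∀ t ∈ Icc 0 T, IsC1Close N C₂ (lam t) (a t) := by
    intro N hN lam a hlam had ha0
    have hl := hdata N hN lam hlam
    refine hstab N hN lam a (fun _ _ => 0)
      (fun t ht j hj => (hlam.hasDerivWithinAt T t ht j hj).congr_deriv (by ring)) had
      (fun _ _ _ _ => by simpa using hC₁0)
      (fun _ _ _ _ _ _ => by rw [abs_zero]; positivity) ⟨fun j hj => ?_, fun j hj => ?_⟩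
    · have h1 := hl.close j hj
      have h2 := ha0.close j hj
      rw [hC₁, add_div]
      rw [abs_le] at *
      constructor <;> linarith [h1.1, h1.2, h2.1, h2.2]
    · have h1 := hl.grad j hj
      have h2 := ha0.grad j hj
      rw [hC₁, add_div]
      rw [abs_le] at *
      constructor <;> linarith [h1.1, h1.2, h2.1, h2.2]
  set C := C₀ + C₂ + C₃ with hC
  have hle0 : C₀ ≤ C := by linarith
  have hle2 : C₂ ≤ C := by linarith
  have hle3 : C₃ ≤ C := by linarith
  have hmono : ∀ {N : ℕ} {A : ℝ} {f g : ℕ → ℝ}, A ≤ C → IsC1Close N A f g → IsC1Close N C f g :=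
    fun hA h => ⟨fun j hj => (h.close j hj).trans (by gcongr),
      fun j hj => (h.grad j hj).trans (by gcongr)⟩
  refine ⟨c, C, hc, by positivity, ?_⟩
  intro N hN lam hlam t ht
  refine ⟨?_, ?_, ?_⟩
  · refine hlow N hN lam (hlam.hasDerivWithinAt T) (fun j hj => ?_) t ht
    rw [hlam.initial j hj]
    refine Real.one_le_exp (mul_nonneg ?_ (Finset.sum_nonneg fun k hk => ?_))
    · have : 0 ≤ Real.log (1 + E / N) := Real.log_nonneg (by
        have : 0 ≤ E / N := by positivity
        linarith)
      have hN0 : (0 : ℝ) < N := by exact_mod_cast (by omega : 0 < N)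
      have e : -(gam E N / N) = Real.log (1 + E / N) := by unfold gam; field_simp
      rw [e]; exact this
    · have hk := Finset.mem_Icc.1 hk
      have hN0 : (0 : ℝ) < N := by exact_mod_cast (by omega : 0 < N)
      refine (hrange _ ⟨by positivity, ?_⟩).1
      rw [div_le_one hN0]
      exact_mod_cast (by omega : k ≤ N)
  · obtain ⟨a, had, har, ha0⟩ := hreg N hN
    exact ⟨a t, (har t ht).mono hle0, hmono hle2 (hsame N hN lam a hlam had ha0 t ht)⟩
  · intro lam' hlam'
    obtain ⟨a, had, har, ha0⟩ := hreg (2 * N) (by omega)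
    refine ⟨a t, (har t ht).mono hle0,
      hmono hle2 (hsame _ (by omega) lam' a hlam' had ha0 t ht), ?_⟩
    have hN0 : (0 : ℝ) < N := by exact_mod_cast (by omega : 0 < N)
    have hτ := fun t ht => Omega_average hE hα hβ hN hC₀ (har t ht)
    have hKK : 10 * (1 + E) ^ 3 * C₀ ≤ K₃ := by
      have : 0 ≤ 20 * (K + C₁) := by positivity
      linarith
    have hdc : IsC1Close N K₃ (fun j => (a 0 (2 * j) + a 0 (2 * j + 1)) / 2) (lam 0) := by
      have h1 := hdata N hN lam hlam
      have hKC : K ≤ C₁ := by linarith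
      have hCC : C₀ ≤ C₁ := by linarith
      have h := average_data_close hK hF hN hC₁0 (v := lam 0) (a := a 0)
        ⟨fun j hj => (h1.close j hj).trans (by gcongr),
          fun j hj => (h1.grad j hj).trans (by gcongr)⟩
        ⟨fun j hj => (ha0.close j hj).trans (by gcongr),
          fun j hj => (ha0.grad j hj).trans (by gcongr)⟩
      have hKK' : 20 * (K + C₁) ≤ K₃ := by
        have : 0 ≤ 10 * (1 + E) ^ 3 * C₀ := by positivity
        linarith
      exact ⟨fun j hj => (h.close j hj).trans (by gcongr),
        fun j hj => (h.grad j hj).trans (by gcongr)⟩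
    refine hmono hle3 (hstab' N hN (fun t j => (a t (2 * j) + a t (2 * j + 1)) / 2) lam
      (fun t j => (Omega E α β (2 * N) (a t) (2 * j) + Omega E α β (2 * N) (a t) (2 * j + 1)) / 2 -
        Omega E α β N (fun i => (a t (2 * i) + a t (2 * i + 1)) / 2) j)
      (fun t ht j hj => ?_) (hlam.hasDerivWithinAt T)
      (fun t ht j hj => ((hτ t ht).1 j hj).trans hKK)
      (fun t ht j hj h0 h1 => ((hτ t ht).2 j hj h0 h1).trans (by gcongr)) hdc t ht)
    refine (((had t ht (2 * j) (by omega)).add (had t ht (2 * j + 1) (by omega))).div_const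
      2).congr_deriv ?_
    ring

/-! ### Discrete densities -/

/-- Bounds for a semidiscrete solution `x = λ_t` at a fixed time: `x` lies in `[c, D]`, its
difference quotients are bounded, vary by `O(1/N)` from site to site, and match the Robin
conditions up to `O(1/N)`. -/
structure IsHopfColeGrid (E α β : ℝ) (N : ℕ) (c D : ℝ) (x : ℕ → ℝ) : Prop where
  lower : ∀ j < N, c ≤ x j
  upper : ∀ j < N, x j ≤ D
  grad : ∀ j, j + 1 < N → |N * (x (j + 1) - x j)| ≤ D
  second : ∀ j, j + 2 < N → |N * (x (j + 2) - x (j + 1)) - N * (x (j + 1) - x j)| ≤ D / N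
  left : |N * (x 1 - x 0) - α * E * x 0| ≤ D / N
  right : |N * (x (N - 1) - x (N - 2)) - β * E * x (N - 1)| ≤ D / N

theorem IsRegular.grad_mul {E α β : ℝ} {N : ℕ} (hN : 2 ≤ N) {C : ℝ} {a : ℕ → ℝ}
    (ha : IsRegular E α β N C a) {j : ℕ} (hj : j + 1 < N) : |N * (a (j + 1) - a j)| ≤ C := by
  have hN0 : (0 : ℝ) < N := by exact_mod_cast (by omega : 0 < N)
  rw [abs_mul, abs_of_pos hN0]
  calc (N : ℝ) * |a (j + 1) - a j| ≤ N * (C / N) := by gcongr; exact ha.grad j hj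
    _ = C := by field_simp

theorem IsRegular.second {E α β : ℝ} (hE : 0 < E) {N : ℕ} (hN : 2 ≤ N) {C : ℝ} {a : ℕ → ℝ}
    (ha : IsRegular E α β N C a) {j : ℕ} (hj : j + 2 < N) :
    |N * (a (j + 2) - a (j + 1)) - N * (a (j + 1) - a j)| ≤ (1 + E) * C / N := by
  have hN0 : (0 : ℝ) < N := by exact_mod_cast (by omega : 0 < N)
  have hw := ha.bound_Omega (j + 1) (by omega)
  have hg := ha.grad_mul hN (show j + 1 < N by omega)
  have e : N * (a (j + 2) - a (j + 1)) - N * (a (j + 1) - a j) =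
      (Omega E α β N a (j + 1) + E * (N * (a (j + 1) - a j))) / N := by
    rw [Omega_interior E α β N a hj]
    field_simp
    ring
  rw [e, abs_div, abs_of_pos hN0]
  gcongr
  refine (abs_add_le _ _).trans ?_
  rw [abs_mul E, abs_of_pos hE]
  nlinarith

theorem IsC1Close.grad_mul {N : ℕ} (hN : 2 ≤ N) {C : ℝ} {f g : ℕ → ℝ} (h : IsC1Close N C f g)
    {j : ℕ} (hj : j + 1 < N) : |N * (f (j + 1) - f j) - N * (g (j + 1) - g j)| ≤ C / N := by
  have hN0 : (0 : ℝ) < N := by exact_mod_cast (by omega : 0 < N)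
  rw [show N * (f (j + 1) - f j) - N * (g (j + 1) - g j) =
    N * ((f (j + 1) - g (j + 1)) - (f j - g j)) by ring, abs_mul, abs_of_pos hN0]
  calc (N : ℝ) * |f (j + 1) - g (j + 1) - (f j - g j)| ≤ N * (C / (N : ℝ) ^ 2) := by
        gcongr; exact h.grad j hj
    _ = C / N := by field_simp

theorem isHopfColeGrid_of_close {E α β : ℝ} (hE : 0 < E) (hα : α ∈ Ioo (0 : ℝ) 1)
    (hβ : β ∈ Ioo (0 : ℝ) 1) {N : ℕ} (hN : 2 ≤ N) {c C : ℝ} (hC : 0 ≤ C) {x a : ℕ → ℝ}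
    (hx : ∀ j < N, c ≤ x j) (ha : IsRegular E α β N C a) (hxa : IsC1Close N C x a) :
    IsHopfColeGrid E α β N c (10 * (1 + E) * C) x := by
  have hN2 : (2 : ℝ) ≤ N := by exact_mod_cast hN
  have hN0 : (0 : ℝ) < N := by linarith
  have hCN : C / N ≤ C := div_le_self hC (by linarith)
  have hCN0 : 0 ≤ C / N := by positivity
  have hEC : 0 ≤ E * C := by positivity
  have hEN : 0 ≤ E * (C / N) := by positivity
  have hD : 10 * (1 + E) * C = 10 * C + 10 * (E * C) := by ring
  have hDN : 10 * (1 + E) * C / N = 10 * (C / N) + 10 * (E * (C / N)) := by ring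
  refine ⟨hx, fun j hj => ?_, fun j hj => ?_, fun j hj => ?_, ?_, ?_⟩
  · have h1 := (abs_le.1 (ha.bound j hj)).2
    have h2 := (abs_le.1 (hxa.close j hj)).2
    rw [hD]
    linarith
  · have h1 := ha.grad_mul hN hj
    have h2 := hxa.grad_mul hN hj
    rw [hD]
    rw [abs_le] at *
    constructor <;> linarith [h1.1, h1.2, h2.1, h2.2]
  · have h1 := ha.second hE hN hj
    have h2 := hxa.grad_mul hN (show j + 1 < N by omega)
    have h3 := hxa.grad_mul hN (show j + 1 + 1 < N by omega)
    have e : (1 + E) * C / N = C / N + E * (C / N) := by ring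
    rw [e] at h1
    rw [hDN]
    rw [add_assoc, show 1 + 1 = 2 from rfl] at h3
    rw [abs_le] at *
    constructor <;> linarith [h1.1, h1.2, h2.1, h2.2, h3.1, h3.2]
  · have h1 := ha.bound_Omega 0 (by omega)
    rw [Omega_zero, abs_mul, abs_of_pos hN0] at h1
    have h1' : |N * (a 1 - a 0) - α * E * a 0| ≤ C / N := by rw [le_div_iff₀ hN0]; linarith
    have h2 := hxa.grad_mul hN (show 0 + 1 < N by omega)
    have h3 : |α * (E * (x 0 - a 0))| ≤ E * (C / N) := by
      rw [abs_mul, abs_of_pos hα.1, abs_mul, abs_of_pos hE]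
      refine (mul_le_of_le_one_left (by positivity) hα.2.le).trans ?_
      gcongr
      exact hxa.close 0 (by omega)
    rw [hDN]
    rw [zero_add] at h2
    rw [abs_le] at *
    constructor <;> linarith [h1'.1, h1'.2, h2.1, h2.2, h3.1, h3.2]
  · obtain ⟨n, rfl⟩ : ∃ n, N = n + 2 := ⟨N - 2, by omega⟩
    rw [show n + 2 - 1 = n + 1 from rfl, Nat.add_sub_cancel]
    have h1 := ha.bound_Omega (n + 1) (by omega)
    rw [Omega_last, abs_mul, abs_of_pos hN0] at h1
    set N' : ℝ := ((n + 2 : ℕ) : ℝ) with hN'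
    have h1' : |β * E * a (n + 1) - (1 + E / N') * (N' * (a (n + 1) - a n))| ≤ C / N' := by
      rw [le_div_iff₀ hN0]; linarith
    have h4 : |E / N' * (N' * (a (n + 1) - a n))| ≤ E * (C / N') := by
      rw [abs_mul, abs_of_pos (by positivity : 0 < E / N')]
      calc E / N' * |N' * (a (n + 1) - a n)| ≤ E / N' * C := by
            gcongr; exact ha.grad_mul hN (by omega)
        _ = _ := by ring
    have h2 := hxa.grad_mul hN (show n + 1 < n + 2 by omega)
    have h3 : |β * (E * (x (n + 1) - a (n + 1)))| ≤ E * (C / N') := by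
      rw [abs_mul, abs_of_pos hβ.1, abs_mul, abs_of_pos hE]
      refine (mul_le_of_le_one_left (by positivity) hβ.2.le).trans ?_
      gcongr
      exact hxa.close (n + 1) (by omega)
    rw [hDN]
    rw [abs_le] at *
    constructor <;> linarith [h1'.1, h1'.2, h2.1, h2.2, h3.1, h3.2, h4.1, h4.2]

/-- The discrete density `∇⁻ x / (E x)`, extended to the end points `0` and `N` by the boundary
values `α` and `β`. -/
def density (E α β : ℝ) (N : ℕ) (x : ℕ → ℝ) (j : ℕ) : ℝ :=
  if j = 0 then α else if N ≤ j then β else N * (x j - x (j - 1)) / (E * x (j - 1))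

theorem density_succ {E α β : ℝ} {N : ℕ} {x : ℕ → ℝ} {j : ℕ} (hj : j + 1 < N) :
    density E α β N x (j + 1) = N * (x (j + 1) - x j) / (E * x j) := by
  unfold density
  rw [if_neg (by omega), if_neg (by omega), Nat.add_sub_cancel]

theorem density_zero {E α β : ℝ} {N : ℕ} {x : ℕ → ℝ} : density E α β N x 0 = α := if_pos rfl

theorem density_last {E α β : ℝ} {N : ℕ} (hN : 0 < N) {x : ℕ → ℝ} :
    density E α β N x N = β := by
  unfold density
  rw [if_neg (by omega), if_pos le_rfl]

theorem abs_div_sub_div_le {m p q a b : ℝ} (hm : 0 < m) (ha : m ≤ a) (hb : m ≤ b) :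
    |p / a - q / b| ≤ |p - q| / m + |q| * |a - b| / m ^ 2 := by
  have ha0 : 0 < a := by linarith
  have hb0 : 0 < b := by linarith
  have e : p / a - q / b = (p - q) / a + -(q * (a - b) / (a * b)) := by field_simp; ring
  rw [e]
  refine (abs_add_le _ _).trans ?_
  rw [abs_neg, abs_div, abs_div, abs_mul, abs_of_pos ha0, abs_of_pos (mul_pos ha0 hb0)]
  have h : m ^ 2 ≤ a * b := by nlinarith
  gcongr

section

variable {E α β c D : ℝ} {N : ℕ} {x : ℕ → ℝ}

theorem density_abs_le (hE : 0 < E) (hα : α ∈ Ioo (0 : ℝ) 1) (hβ : β ∈ Ioo (0 : ℝ) 1) (hc : 0 < c)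
    (hx : IsHopfColeGrid E α β N c D x) (hD : 0 ≤ D) (j : ℕ) :
    |density E α β N x j| ≤ 1 + D / (E * c) := by
  have h0 : 0 ≤ D / (E * c) := by positivity
  rcases Nat.eq_zero_or_pos j with rfl | hj0
  · rw [density_zero, abs_of_pos hα.1]; linarith [hα.2]
  by_cases hj : j < N
  · obtain ⟨i, rfl⟩ : ∃ i, j = i + 1 := ⟨j - 1, by omega⟩
    have hl := hx.lower i (by omega)
    have hxi : 0 < x i := by linarith
    rw [density_succ hj, abs_div, abs_of_pos (mul_pos hE hxi)]
    have : |N * (x (i + 1) - x i)| / (E * x i) ≤ D / (E * c) := by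
      gcongr
      exact hx.grad i hj
    linarith
  · unfold density
    rw [if_neg (by omega), if_pos (by omega), abs_of_pos hβ.1]
    linarith [hβ.2]

theorem density_succ_sub_le (hE : 0 < E) (hβ : β ∈ Ioo (0 : ℝ) 1) (hc : 0 < c) (hN : 2 ≤ N)
    (hx : IsHopfColeGrid E α β N c D x) (hD : 0 ≤ D) {j : ℕ} (hj : j < N) :
    |density E α β N x (j + 1) - density E α β N x j| ≤
      (D / (E * c) + D * D * E / (E * c) ^ 2 + D / c) / N := by
  have hN0 : (0 : ℝ) < N := by exact_mod_cast (by omega : 0 < N)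
  have hEc : 0 < E * c := by positivity
  have hgoal : (D / (E * c) + D * D * E / (E * c) ^ 2 + D / c) / N =
    D / N / (E * c) + D * D * E / (E * c) ^ 2 / N + D / c / N := by ring
  have p1 : 0 ≤ D / N / (E * c) := by positivity
  have p2 : 0 ≤ D * D * E / (E * c) ^ 2 / N := by positivity
  have p3 : 0 ≤ D / c / N := by positivity
  rw [hgoal]
  have hlow : ∀ i < N, E * c ≤ E * x i := fun i hi =>
    mul_le_mul_of_nonneg_left (hx.lower i hi) hE.le
  have hinc : ∀ i, i + 1 < N → |x (i + 1) - x i| ≤ D / N := by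
    intro i hi
    have := hx.grad i hi
    rw [abs_mul, abs_of_pos hN0] at this
    rw [le_div_iff₀ hN0]
    linarith
  rcases Nat.eq_zero_or_pos j with rfl | hj0
  · have hl := hlow 0 (by omega)
    have hx0 : 0 < E * x 0 := by linarith
    rw [density_zero, density_succ (by omega)]
    have e : N * (x (0 + 1) - x 0) / (E * x 0) - α =
        (N * (x 1 - x 0) - α * E * x 0) / (E * x 0) := by
      have : x 0 ≠ 0 := fun h => by rw [h] at hx0; simp at hx0
      field_simp
    rw [e, abs_div, abs_of_pos hx0]
    have : |N * (x 1 - x 0) - α * E * x 0| / (E * x 0) ≤ D / N / (E * c) := by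
      gcongr
      exact hx.left
    linarith
  obtain ⟨i, rfl⟩ : ∃ i, j = i + 1 := ⟨j - 1, by omega⟩
  by_cases hj1 : i + 2 < N
  · rw [density_succ hj, density_succ (show i + 1 + 1 < N from hj1)]
    refine (abs_div_sub_div_le hEc (hlow (i + 1) hj) (hlow i (by omega))).trans ?_
    have h1 : |N * (x (i + 1 + 1) - x (i + 1)) - N * (x (i + 1) - x i)| / (E * c) ≤
        D / N / (E * c) := by
      gcongr
      exact hx.second i hj1
    have h2 : |N * (x (i + 1) - x i)| * |E * x (i + 1) - E * x i| / (E * c) ^ 2 ≤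
        D * D * E / (E * c) ^ 2 / N := by
      rw [← mul_sub, abs_mul E, abs_of_pos hE]
      calc _ ≤ D * (E * (D / N)) / (E * c) ^ 2 := by
            gcongr
            · exact hx.grad i hj
            · exact hinc i hj
        _ = _ := by ring
    linarith
  · obtain rfl : N = i + 2 := by omega
    rw [density_last (by omega), density_succ hj]
    have hr := hx.right
    rw [show i + 2 - 1 = i + 1 from rfl, Nat.add_sub_cancel] at hr
    have hl := hlow i (by omega)
    have hx0 : 0 < E * x i := by linarith
    have hxi : x i ≠ 0 := fun h => by rw [h] at hx0; simp at hx0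
    set N' : ℝ := ((i + 2 : ℕ) : ℝ)
    have e : β - N' * (x (i + 1) - x i) / (E * x i) =
        -((N' * (x (i + 1) - x i) - β * E * x (i + 1)) / (E * x i)) +
          -(β * ((x (i + 1) - x i) / x i)) := by
      field_simp
      ring
    rw [e]
    refine (abs_add_le _ _).trans ?_
    rw [abs_neg, abs_neg, abs_div, abs_of_pos hx0, abs_mul, abs_of_pos hβ.1, abs_div]
    have hxp : 0 < x i := by linarith [hx.lower i (by omega)]
    rw [abs_of_pos hxp]
    have h1 : |N' * (x (i + 1) - x i) - β * E * x (i + 1)| / (E * x i) ≤ D / N' / (E * c) := by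
      gcongr
    have h2 : β * (|x (i + 1) - x i| / x i) ≤ D / c / N' := by
      refine (mul_le_of_le_one_left (by positivity) hβ.2.le).trans ?_
      calc |x (i + 1) - x i| / x i ≤ D / N' / c := by
            gcongr
            · exact hinc i hj
            · exact hx.lower i (by omega)
        _ = _ := by ring
    linarith

theorem abs_log_sub_log_sub_le {m a b : ℝ} (hm : 0 < m) (ha : m ≤ a) (hb : m ≤ b) :
    |Real.log b - Real.log a - (b - a) / a| ≤ (b - a) ^ 2 / m ^ 2 := by
  have ha0 : 0 < a := by linarith
  have hb0 : 0 < b := by linarith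
  have h1 := Real.log_le_sub_one_of_pos (div_pos hb0 ha0)
  have h2 := Real.one_sub_inv_le_log_of_pos (div_pos hb0 ha0)
  rw [Real.log_div hb0.ne' ha0.ne'] at h1 h2
  have e1 : b / a - 1 = (b - a) / a := by field_simp
  have e2 : 1 - (b / a)⁻¹ = (b - a) / a - (b - a) ^ 2 / (a * b) := by field_simp; ring
  have e3 : (b - a) ^ 2 / (a * b) ≤ (b - a) ^ 2 / m ^ 2 := by
    gcongr
    nlinarith
  have e4 : 0 ≤ (b - a) ^ 2 / m ^ 2 := by positivity
  rw [abs_le]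
  constructor <;> linarith

theorem inv_log_one_add_close {ε : ℝ} (hε : 0 < ε) :
    0 < Real.log (1 + ε) ∧ |1 / Real.log (1 + ε) - 1 / ε| ≤ 1 := by
  have h1 := log_one_add_le hε.le
  have h2 := Real.one_sub_inv_le_log_of_pos (show 0 < 1 + ε by linarith)
  have e : 1 - (1 + ε)⁻¹ = ε / (1 + ε) := by field_simp; ring
  rw [e] at h2
  have h3 : 0 < ε / (1 + ε) := by positivity
  have h4 : 0 < Real.log (1 + ε) := by linarith
  refine ⟨h4, ?_⟩
  have h5 : 1 / ε ≤ 1 / Real.log (1 + ε) := one_div_le_one_div_of_le h4 h1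
  have h6 : 1 / Real.log (1 + ε) ≤ 1 / (ε / (1 + ε)) := one_div_le_one_div_of_le h3 h2
  have h7 : 1 / (ε / (1 + ε)) = 1 / ε + 1 := by field_simp
  rw [abs_le]
  constructor <;> linarith

theorem proxy_eq (hE : 0 < E) (hN : 1 ≤ N) (x : ℕ → ℝ) (j : ℕ) :
    proxy E N x j = 1 / Real.log (1 + E / N) * (Real.log (x j) - Real.log (x (j - 1))) := by
  have hN0 : (0 : ℝ) < N := by exact_mod_cast hN
  have hl := (inv_log_one_add_close (show 0 < E / N by positivity)).1
  unfold proxy gam gradMinus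
  field_simp
  ring

theorem proxy_sub_density_le (hE : 0 < E) (hc : 0 < c)
    (hx : IsHopfColeGrid E α β N c D x) (hD : 0 ≤ D) {j : ℕ} (hj0 : 1 ≤ j) (hj : j < N) :
    |proxy E N x j - density E α β N x j| ≤ ((1 / E + 1) * (D ^ 2 / c ^ 2) + D / c) / N := by
  have hN1 : (1 : ℝ) ≤ N := by exact_mod_cast (by omega : 1 ≤ N)
  have hN0 : (0 : ℝ) < N := by linarith
  obtain ⟨i, rfl⟩ : ∃ i, j = i + 1 := ⟨j - 1, by omega⟩
  rw [proxy_eq hE (by omega), density_succ hj, Nat.add_sub_cancel]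
  have hl := hx.lower i (by omega)
  have hxi : 0 < x i := by linarith
  have hinc : |x (i + 1) - x i| ≤ D / N := by
    have := hx.grad i hj
    rw [abs_mul, abs_of_pos hN0] at this
    rw [le_div_iff₀ hN0]
    linarith
  obtain ⟨hlog, hinv⟩ := inv_log_one_add_close (show 0 < E / N by positivity)
  have h1 := abs_log_sub_log_sub_le hc hl (hx.lower (i + 1) hj)
  set L := Real.log (1 + E / N)
  set R := Real.log (x (i + 1)) - Real.log (x i) - (x (i + 1) - x i) / x i with hR
  have e : 1 / L * (Real.log (x (i + 1)) - Real.log (x i)) - N * (x (i + 1) - x i) / (E * x i) =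
      (1 / L) * R + (1 / L - 1 / (E / N)) * ((x (i + 1) - x i) / x i) := by
    rw [hR]; field_simp; ring
  rw [e]
  have hR' : |R| ≤ D ^ 2 / c ^ 2 / N ^ 2 := by
    refine h1.trans ?_
    rw [← sq_abs]
    calc |x (i + 1) - x i| ^ 2 / c ^ 2 ≤ (D / N) ^ 2 / c ^ 2 := by gcongr
      _ = _ := by ring
  have hinv' : 1 / L ≤ (1 / E + 1) * N := by
    have h := (abs_le.1 hinv).2
    have e : 1 / (E / (N : ℝ)) = 1 / E * N := by field_simp
    rw [e] at h
    linarith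
  refine (abs_add_le _ _).trans ?_
  rw [abs_mul, abs_mul, abs_of_pos (by positivity : 0 < 1 / L), abs_div, abs_of_pos hxi]
  have q1 : 1 / L * |R| ≤ (1 / E + 1) * (D ^ 2 / c ^ 2) / N := by
    calc 1 / L * |R| ≤ (1 / E + 1) * N * (D ^ 2 / c ^ 2 / N ^ 2) := by gcongr
      _ = _ := by field_simp
  have q2 : |1 / L - 1 / (E / N)| * (|x (i + 1) - x i| / x i) ≤ D / c / N := by
    calc _ ≤ 1 * (D / N / c) := by gcongr
      _ = _ := by ring
  rw [add_div]
  linarith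

theorem abs_Omega_le (hE : 0 < E) (hN : 2 ≤ N)
    (hx : IsHopfColeGrid E α β N c D x) (hD : 0 ≤ D) {j : ℕ} (hj : j < N) :
    |Omega E α β N x j| ≤ (1 + E) * D := by
  have hN0 : (0 : ℝ) < N := by exact_mod_cast (by omega : 0 < N)
  have hED : 0 ≤ E * D := by positivity
  have hmul : ∀ z : ℝ, |z| ≤ D / N → |N * z| ≤ D := by
    intro z hz
    rw [abs_mul, abs_of_pos hN0]
    calc (N : ℝ) * |z| ≤ N * (D / N) := by gcongr
      _ = D := by field_simp
  rcases Nat.eq_zero_or_pos j with rfl | hj0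
  · rw [Omega_zero]
    refine (hmul _ hx.left).trans ?_
    linarith
  obtain ⟨i, rfl⟩ : ∃ i, j = i + 1 := ⟨j - 1, by omega⟩
  have hg : |E * (N * (x (i + 1) - x i))| ≤ E * D := by
    rw [abs_mul, abs_of_pos hE]
    gcongr
    exact hx.grad i hj
  by_cases hj1 : i + 2 < N
  · rw [Omega_interior E α β N x hj1]
    have h := hmul _ (hx.second i hj1)
    have e : (N : ℝ) ^ 2 * (x (i + 2) + x i - 2 * x (i + 1)) - E * (N * (x (i + 1) - x i)) =
      N * (N * (x (i + 2) - x (i + 1)) - N * (x (i + 1) - x i)) - E * (N * (x (i + 1) - x i)) := by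
      ring
    rw [e]
    refine (abs_sub _ _).trans ?_
    linarith
  · obtain rfl : N = i + 2 := by omega
    have hr := hx.right
    rw [show i + 2 - 1 = i + 1 from rfl, Nat.add_sub_cancel] at hr
    have h := hmul _ hr
    rw [Omega_last]
    set N' : ℝ := ((i + 2 : ℕ) : ℝ)
    have e : N' * (β * E * x (i + 1) - (1 + E / N') * (N' * (x (i + 1) - x i))) =
        -(N' * (N' * (x (i + 1) - x i) - β * E * x (i + 1))) - E * (N' * (x (i + 1) - x i)) := by
      field_simp
      ring
    rw [e]
    refine (abs_sub _ _).trans ?_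
    rw [abs_neg]
    linarith

/-- The logarithmic time derivative `Ω x / x` is the discrete current
`E (∇⁺ q - E q (1 - q))` of the density `q`, up to `O(1/N)`. -/
theorem Omega_div_sub_current_le (hE : 0 < E) (hc : 0 < c)
    (hx : IsHopfColeGrid E α β N c D x) (hD : 0 ≤ D) {j : ℕ} (hj0 : 0 < j) (hj : j + 1 < N) :
    |Omega E α β N x j / x j - (E * (N * (density E α β N x (j + 1) - density E α β N x j)) -
      E * (E * flux (density E α β N x j)))| ≤ D * (E + D / c) * (D / c ^ 2) / N := by
  have hN0 : (0 : ℝ) < N := by exact_mod_cast (by omega : 0 < N)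
  obtain ⟨i, rfl⟩ : ∃ i, j = i + 1 := ⟨j - 1, by omega⟩
  have hl0 := hx.lower i (by omega)
  have hl1 := hx.lower (i + 1) (by omega)
  have h0 : 0 < x i := by linarith
  have h1 : 0 < x (i + 1) := by linarith
  rw [density_succ hj, density_succ (by omega : i + 1 < N), Omega_interior E α β N x hj]
  unfold flux
  set g := N * (x (i + 1) - x i) with hg
  have hgD : |g| ≤ D := hx.grad i (by omega)
  have e : ((N : ℝ) ^ 2 * (x (i + 2) + x i - 2 * x (i + 1)) - E * g) / x (i + 1) -
      (E * (N * (N * (x (i + 1 + 1) - x (i + 1)) / (E * x (i + 1)) - g / (E * x i))) -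
        E * (E * (g / (E * x i) * (1 - g / (E * x i))))) =
      g * (E - g / x i) * (g / (x i * x (i + 1))) / N := by
    rw [hg]
    field_simp
    ring
  rw [e, abs_div, abs_of_pos hN0, abs_mul, abs_mul, abs_div, abs_of_pos (mul_pos h0 h1)]
  have h2 : |E - g / x i| ≤ E + D / c := by
    refine (abs_sub _ _).trans ?_
    rw [abs_of_pos hE, abs_div, abs_of_pos h0]
    gcongr
  have h3 : |g| / (x i * x (i + 1)) ≤ D / c ^ 2 := by
    have : c ^ 2 ≤ x i * x (i + 1) := by nlinarith
    gcongr
  gcongr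

end

/-- Densities on the grids of `N` and `2 * N` cells, compared through the regular function `a`: the
slope of the averages of `a` over pairs of neighbours is an average of slopes of `a`, and these vary
by `O(1/N)`. -/
theorem density_double_le {E α β c D C : ℝ} {N : ℕ} {x x' a : ℕ → ℝ} (hE : 0 < E) (hc : 0 < c)
    (hN : 2 ≤ N) (hx : IsHopfColeGrid E α β N c D x) (hx' : IsHopfColeGrid E α β (2 * N) c D x')
    (hD : 0 ≤ D) (hC : 0 ≤ C) (ha : IsRegular E α β (2 * N) C a) (hxa : IsC1Close (2 * N) C x' a)
    (hax : IsC1Close N C (fun j => (a (2 * j) + a (2 * j + 1)) / 2) x) {j : ℕ} (hj : j ≤ N) :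
    |density E α β N x j - density E α β (2 * N) x' (2 * j)| ≤
      ((3 + E) * C / (E * c) + 3 * D * E * C / (E * c) ^ 2) / N := by
  have hN0 : (0 : ℝ) < N := by exact_mod_cast (by omega : 0 < N)
  have hM : ((2 * N : ℕ) : ℝ) = 2 * N := by push_cast; ring
  have hEc : 0 < E * c := by positivity
  have hnn : 0 ≤ ((3 + E) * C / (E * c) + 3 * D * E * C / (E * c) ^ 2) / N := by positivity
  rcases Nat.eq_zero_or_pos j with rfl | hj0
  · rw [mul_zero, density_zero, density_zero, sub_self, abs_zero]; exact hnn
  rcases hj.lt_or_eq with hjN | rfl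
  swap
  · rw [density_last (by omega), density_last (by omega), sub_self, abs_zero]; exact hnn
  obtain ⟨i, rfl⟩ : ∃ i, j = i + 1 := ⟨j - 1, by omega⟩
  rw [density_succ hjN, show 2 * (i + 1) = 2 * i + 1 + 1 by ring,
    density_succ (show 2 * i + 1 + 1 < 2 * N by omega)]
  have hlow : E * c ≤ E * x i := mul_le_mul_of_nonneg_left (hx.lower i (by omega)) hE.le
  have hlow' : E * c ≤ E * x' (2 * i + 1) :=
    mul_le_mul_of_nonneg_left (hx'.lower (2 * i + 1) (by omega)) hE.le
  have k1 := hxa.grad_mul (by omega) (show 2 * i + 1 + 1 < 2 * N by omega)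
  have k2 := hax.grad_mul hN (show i + 1 < N from hjN)
  have k3 := ha.second hE (by omega) (show 2 * i + 2 < 2 * N by omega)
  have k4 := ha.second hE (by omega) (show 2 * i + 1 + 2 < 2 * N by omega)
  have k5 := hxa.close (2 * i + 1) (by omega)
  have k6 := hax.close i (by omega)
  have k7 := ha.grad (2 * i) (by omega)
  have k8 := hx'.grad (2 * i + 1) (by omega)
  rw [hM] at k1 k3 k4 k5 k7 k8 ⊢
  rw [show 2 * (i + 1) = 2 * i + 2 by ring] at k2
  simp only [add_assoc, Nat.reduceAdd] at k1 k2 k3 k4 k5 k6 k7 k8 ⊢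
  have hCN : 0 ≤ C / N := by positivity
  have hECN : 0 ≤ E * (C / N) := by positivity
  have r1 : C / (2 * (N : ℝ)) = C / N / 2 := by field_simp
  have r2 : (1 + E) * C / (2 * (N : ℝ)) = C / N / 2 + E * (C / N) / 2 := by field_simp
  rw [r1] at k1 k5 k7
  rw [r2] at k3 k4
  have hg : |N * (x (i + 1) - x i) - 2 * N * (x' (2 * i + 2) - x' (2 * i + 1))| ≤
      (3 + E) * C / N := by
    have e : (3 + E) * C / (N : ℝ) = 3 * (C / N) + E * (C / N) := by ring
    rw [e]
    rw [abs_le] at k1 k2 k3 k4 ⊢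
    constructor <;> linarith [k1.1, k1.2, k2.1, k2.2, k3.1, k3.2, k4.1, k4.2]
  have hv : |x i - x' (2 * i + 1)| ≤ 3 * C / N := by
    have e : 3 * C / (N : ℝ) = 3 * (C / N) := by ring
    rw [e]
    rw [abs_le] at k5 k6 k7 ⊢
    constructor <;> linarith [k5.1, k5.2, k6.1, k6.2, k7.1, k7.2]
  refine (abs_div_sub_div_le hEc hlow hlow').trans ?_
  rw [← mul_sub, abs_mul E, abs_of_pos hE]
  calc _ ≤ (3 + E) * C / N / (E * c) + D * (E * (3 * C / N)) / (E * c) ^ 2 := by gcongr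
    _ = _ := by ring

/-- What the passage to the limit uses of a semidiscrete solution `x = λ_t` at a fixed time:
bounds on the discrete density and its increments, its distance to the proxy, and the
identification of the logarithmic time derivative `Ω x / x` with the current. -/
structure DensityEstimates (E α β : ℝ) (N : ℕ) (C : ℝ) (x : ℕ → ℝ) : Prop where
  pos : ∀ j < N, 0 < x j
  bound : ∀ j, |density E α β N x j| ≤ C
  grad : ∀ j < N, |density E α β N x (j + 1) - density E α β N x j| ≤ C / N
  proxy : ∀ j, 1 ≤ j → j < N → |proxy E N x j - density E α β N x j| ≤ C / N
  rate : ∀ j < N, |Omega E α β N x j / x j| ≤ C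
  current : ∀ j, 0 < j → j + 1 < N → |Omega E α β N x j / x j -
    (E * (N * (density E α β N x (j + 1) - density E α β N x j)) -
      E * (E * flux (density E α β N x j)))| ≤ C / N

/-- The estimates hold with a constant that depends neither on `N` nor on `t ∈ [0, T]`, and doubling
the grid changes the density by `O(1/N)`. -/
theorem exists_densityEstimates {E α β : ℝ} (hE : 0 < E) (hα : α ∈ Ioo (0 : ℝ) 1)
    (hβ : β ∈ Ioo (0 : ℝ) 1) {ρ₀ : ℝ → ℝ} (hρ₀ : ContDiffOn ℝ 4 ρ₀ (Icc 0 1))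
    (hrange : ∀ x ∈ Icc (0 : ℝ) 1, ρ₀ x ∈ Icc (0 : ℝ) 1)
    (hleft : ρ₀ 0 = α) (hright : ρ₀ 1 = β) (T : ℝ) :
    ∃ C, 0 ≤ C ∧ ∀ N : ℕ, 2 ≤ N → ∀ lam, IsSemidiscreteSolution E α β ρ₀ N lam →
      ∀ t ∈ Icc 0 T, DensityEstimates E α β N C (lam t) ∧
        ∀ lam', IsSemidiscreteSolution E α β ρ₀ (2 * N) lam' → ∀ j ≤ N,
          |density E α β N (lam t) j - density E α β (2 * N) (lam' t) (2 * j)| ≤ C / N := by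
  obtain ⟨c, C, hc, hC, hest⟩ := exists_semidiscrete_estimates hE hα hβ hρ₀ hrange hleft hright T
  set D := 10 * (1 + E) * C with hD
  have hD0 : 0 ≤ D := by positivity
  have hgrid : ∀ N : ℕ, 2 ≤ N → ∀ lam, IsSemidiscreteSolution E α β ρ₀ N lam →
      ∀ t ∈ Icc 0 T, IsHopfColeGrid E α β N c D (lam t) := by
    intro N hN lam hlam t ht
    obtain ⟨h1, ⟨a, h2, h3⟩, -⟩ := hest N hN lam hlam t ht
    exact isHopfColeGrid_of_close hE hα hβ hN hC h1 h2 h3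
  set C₁ := 1 + D / (E * c)
  set C₂ := D / (E * c) + D * D * E / (E * c) ^ 2 + D / c
  set C₃ := (1 / E + 1) * (D ^ 2 / c ^ 2) + D / c
  set C₄ := (1 + E) * D / c
  set C₅ := D * (E + D / c) * (D / c ^ 2)
  set C₆ := (3 + E) * C / (E * c) + 3 * D * E * C / (E * c) ^ 2
  have p1 : 0 ≤ C₁ := by positivity
  have p2 : 0 ≤ C₂ := by positivity
  have p3 : 0 ≤ C₃ := by positivity
  have p4 : 0 ≤ C₄ := by positivity
  have p5 : 0 ≤ C₅ := by positivity
  have p6 : 0 ≤ C₆ := by positivity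
  have hdiv : ∀ {N : ℕ} {A : ℝ}, A ≤ C₁ + C₂ + C₃ + C₄ + C₅ + C₆ →
      A / N ≤ (C₁ + C₂ + C₃ + C₄ + C₅ + C₆) / N := fun h => by gcongr
  refine ⟨C₁ + C₂ + C₃ + C₄ + C₅ + C₆, by positivity, ?_⟩
  intro N hN lam hlam t ht
  have hx := hgrid N hN lam hlam t ht
  refine ⟨⟨fun j hj => hc.trans_le (hx.lower j hj), fun j => ?_, fun j hj => ?_,
    fun j hj0 hj => ?_, fun j hj => ?_, fun j hj0 hj => ?_⟩, fun lam' hlam' j hj => ?_⟩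
  · exact (density_abs_le hE hα hβ hc hx hD0 j).trans (by linarith)
  · exact (density_succ_sub_le hE hβ hc hN hx hD0 hj).trans (hdiv (by linarith))
  · exact (proxy_sub_density_le hE hc hx hD0 hj0 hj).trans (hdiv (by linarith))
  · have hl := hx.lower j hj
    rw [abs_div, abs_of_pos (hc.trans_le hl)]
    calc _ ≤ C₄ := by
          have := abs_Omega_le hE hN hx hD0 hj
          simp only [C₄]
          gcongr
      _ ≤ _ := by linarith
  · exact (Omega_div_sub_current_le hE hc hx hD0 hj0 hj).trans (hdiv (by linarith))
  · obtain ⟨-, -, h3⟩ := hest N hN lam hlam t ht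
    obtain ⟨a, h4, h5, h6⟩ := h3 lam' hlam'
    exact (density_double_le hE hc hN hx (hgrid (2 * N) (by omega) lam' hlam' t ht) hD0 hC h4 h5 h6
      hj).trans (hdiv (by linarith))

/-! ### Uniqueness of weak solutions -/

theorem contDiff_two_of_hasDerivAt {G P u : ℝ → ℝ} (h₁ : ∀ x, HasDerivAt G (P x) x)
    (h₂ : ∀ x, HasDerivAt P (u x) x) (hu : Continuous u) : ContDiff ℝ 2 G := by
  have e₁ : deriv G = P := funext fun x => (h₁ x).deriv
  have e₂ : deriv P = u := funext fun x => (h₂ x).deriv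
  rw [show (2 : WithTop ℕ∞) = 1 + 1 by norm_num, contDiff_succ_iff_deriv]
  refine ⟨fun x => (h₁ x).differentiableAt, by simp, ?_⟩
  rw [e₁, contDiff_one_iff_deriv, e₂]
  exact ⟨fun x => (h₂ x).differentiableAt, hu⟩

/-- Uniqueness for the linear weak equation `∂_t u = ∂_x² u - E ∂_x f` with `|f| ≤ L |u|` and zero
boundary and initial values. The mean-zero primitive `P` of `u` in `x` is, after one more
integration, an admissible test function at each time, and testing with it yields an energy
inequality for `∫ P²`. -/
theorem eq_zero_of_weak {E T L : ℝ} {u f : ℝ → ℝ → ℝ}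
    (hu : Continuous (Function.uncurry u)) (hf : Continuous (Function.uncurry f))
    (hfu : ∀ t ∈ Icc 0 T, ∀ x ∈ Icc (0 : ℝ) 1, |f t x| ≤ L * |u t x|)
    (hweak : ∀ G : ℝ → ℝ, ContDiff ℝ 2 G → G 0 = 0 → G 1 = 0 → ∀ t ∈ Icc 0 T,
      (∫ x in (0 : ℝ)..1, u t x * G x) = ∫ s in (0 : ℝ)..t,
        ((∫ x in (0 : ℝ)..1, u s x * deriv (deriv G) x) +
          E * ∫ x in (0 : ℝ)..1, f s x * deriv G x)) :
    ∀ t ∈ Icc 0 T, ∀ x ∈ Ioo (0 : ℝ) 1, u t x = 0 := by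
  have hut : ∀ t, Continuous (u t) := fun t => hu.comp (by fun_prop : Continuous fun x => (t, x))
  let p : ℝ → ℝ → ℝ := fun t x => ∫ y in (0 : ℝ)..x, u t y
  have hp : Continuous (Function.uncurry p) :=
    intervalIntegral.continuous_parametric_primitive_of_continuous hu
  let m : ℝ → ℝ := fun t => ∫ z in (0 : ℝ)..1, p t z
  have hm : Continuous m :=
    intervalIntegral.continuous_parametric_intervalIntegral_of_continuous' hp 0 1
  let P : ℝ → ℝ → ℝ := fun t x => p t x - m t
  have hP : Continuous (Function.uncurry P) := hp.sub (hm.comp continuous_fst)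
  have hPt : ∀ t, Continuous (P t) := fun t => hP.comp (by fun_prop : Continuous fun x => (t, x))
  have hpt : ∀ t, Continuous (p t) := fun t => hp.comp (by fun_prop : Continuous fun x => (t, x))
  have hPd : ∀ t x, HasDerivAt (P t) (u t x) x := fun t x =>
    (((hut t).integral_hasStrictDerivAt 0 x).hasDerivAt).sub_const _
  let G : ℝ → ℝ → ℝ := fun t x => ∫ y in (0 : ℝ)..x, P t y
  have hGd : ∀ t x, HasDerivAt (G t) (P t x) x := fun t x =>
    ((hPt t).integral_hasStrictDerivAt 0 x).hasDerivAt
  have hG0 : ∀ t, G t 0 = 0 := fun t => by simp [G]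
  have hG1 : ∀ t, G t 1 = 0 := by
    intro t
    simp only [G, P]
    rw [intervalIntegral.integral_sub ((hpt t).intervalIntegrable _ _) (by simp)]
    simp [m]
  have hdG : ∀ t, deriv (G t) = P t := fun t => funext fun x => (hGd t x).deriv
  have hdP : ∀ t, deriv (P t) = u t := fun t => funext fun x => (hPd t x).deriv
  let Φ : ℝ → ℝ → ℝ := fun s τ => (∫ x in (0 : ℝ)..1, u s x * u τ x) +
    E * ∫ x in (0 : ℝ)..1, f s x * P τ x
  have hΦ : Continuous (Function.uncurry Φ) := by
    have h1 : Continuous fun q : ℝ × ℝ => ∫ x in (0 : ℝ)..1, u q.1 x * u q.2 x := by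
      refine intervalIntegral.continuous_parametric_intervalIntegral_of_continuous' ?_ 0 1
      exact (hu.comp (by fun_prop : Continuous fun z : (ℝ × ℝ) × ℝ => (z.1.1, z.2))).mul
        (hu.comp (by fun_prop : Continuous fun z : (ℝ × ℝ) × ℝ => (z.1.2, z.2)))
    have h2 : Continuous fun q : ℝ × ℝ => ∫ x in (0 : ℝ)..1, f q.1 x * P q.2 x := by
      refine intervalIntegral.continuous_parametric_intervalIntegral_of_continuous' ?_ 0 1
      exact (hf.comp (by fun_prop : Continuous fun z : (ℝ × ℝ) × ℝ => (z.1.1, z.2))).mul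
        (hP.comp (by fun_prop : Continuous fun z : (ℝ × ℝ) × ℝ => (z.1.2, z.2)))
    exact h1.add (h2.const_mul E)
  have hΦs : ∀ τ a b, IntervalIntegrable (fun s => Φ s τ) MeasureTheory.volume a b := fun τ a b =>
    (hΦ.comp (by fun_prop : Continuous fun s => (s, τ))).intervalIntegrable a b
  let X : ℝ → ℝ := fun t => ∫ x in (0 : ℝ)..1, P t x * P t x
  -- The weak equation tested with `G τ`.
  have hB : ∀ τ, ∀ t ∈ Icc 0 T, (∫ x in (0 : ℝ)..1, P τ x * P t x) = -∫ s in (0 : ℝ)..t, Φ s τ := by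
    intro τ t ht
    have h := hweak (G τ) (contDiff_two_of_hasDerivAt (hGd τ) (hPd τ) (hut τ)) (hG0 τ) (hG1 τ) t ht
    simp only [hdG, hdP] at h
    have hparts := intervalIntegral.integral_mul_deriv_eq_deriv_mul (a := 0) (b := 1)
      (fun x _ => hGd τ x) (fun x _ => hPd t x) ((hPt τ).intervalIntegrable _ _)
      ((hut t).intervalIntegrable _ _)
    rw [hG0, hG1] at hparts
    have e : (∫ x in (0 : ℝ)..1, u t x * G τ x) = ∫ x in (0 : ℝ)..1, G τ x * u t x := by
      simp only [mul_comm]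
    rw [e, hparts] at h
    simp only [Φ]
    linarith
  have hXinc : ∀ t ∈ Icc 0 T, ∀ t' ∈ Icc 0 T,
      X t' - X t = -∫ s in t..t', (Φ s t' + Φ s t) := by
    intro t ht t' ht'
    have h1 := hB t' t' ht'
    have h2 := hB t t ht
    have h3 := hB t' t ht
    have h4 := hB t t' ht'
    have h5 : (∫ x in (0 : ℝ)..1, P t' x * P t x) = ∫ x in (0 : ℝ)..1, P t x * P t' x := by
      simp only [mul_comm]
    rw [intervalIntegral.integral_add (hΦs _ _ _) (hΦs _ _ _)]
    have h6 := intervalIntegral.integral_add_adjacent_intervals (hΦs t' 0 t) (hΦs t' t t')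
    have h7 := intervalIntegral.integral_add_adjacent_intervals (hΦs t 0 t) (hΦs t t t')
    simp only [X]
    linarith
  -- `X` is differentiable, although `u` is not known to have a time derivative.
  have hXd : ∀ t ∈ Icc 0 T, HasDerivWithinAt X (-(2 * Φ t t)) (Icc 0 T) t := by
    intro t ht
    rw [hasDerivWithinAt_iff_isLittleO, Asymptotics.isLittleO_iff]
    intro ε hε
    have hcont := (Metric.continuous_iff.1 hΦ) (t, t) (ε / 2) (by positivity)
    obtain ⟨δ, hδ, hball⟩ := hcont
    have hnear : ∀ᶠ t' in 𝓝[Icc 0 T] t, t' ∈ Metric.ball t δ ∩ Icc 0 T :=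
      inter_mem (nhdsWithin_le_nhds (Metric.ball_mem_nhds t hδ)) self_mem_nhdsWithin
    filter_upwards [hnear] with t' ht'
    have hd : |t' - t| < δ := by simpa [Real.dist_eq] using ht'.1
    have hclose : ∀ s ∈ uIoc t t', ∀ τ, |τ - t| < δ → |Φ s τ - Φ t t| ≤ ε / 2 := by
      intro s hs τ hτ
      have hs' : |s - t| ≤ |t' - t| := abs_sub_left_of_mem_uIcc (uIoc_subset_uIcc hs)
      have := hball (s, τ) (by
        rw [Prod.dist_eq, max_lt_iff, Real.dist_eq, Real.dist_eq]
        exact ⟨hs'.trans_lt hd, hτ⟩)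
      rw [Real.dist_eq] at this
      exact this.le
    have e : X t' - X t - (t' - t) • (-(2 * Φ t t)) =
        -∫ s in t..t', (Φ s t' + Φ s t - 2 * Φ t t) := by
      rw [hXinc t ht t' ht'.2,
        intervalIntegral.integral_sub ((hΦs _ _ _).add (hΦs _ _ _)) (by simp),
        intervalIntegral.integral_const, smul_eq_mul, smul_eq_mul]
      ring
    rw [e, norm_neg]
    have := intervalIntegral.norm_integral_le_of_norm_le_const (a := t) (b := t') (C := ε)
      (f := fun s => Φ s t' + Φ s t - 2 * Φ t t) (fun s hs => by
        have h1 := hclose s hs t' hd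
        have h2 := hclose s hs t (by simpa using hδ)
        rw [Real.norm_eq_abs]
        rw [abs_le] at *
        constructor <;> linarith [h1.1, h1.2, h2.1, h2.2])
    rw [Real.norm_eq_abs (t' - t)]
    exact this
  -- Young's inequality absorbs the flux term into the dissipation `2 ∫ u²`.
  set κ := (|E| * L) ^ 2 / 2 with hκ
  have hint : ∀ t, (2 * Φ t t + κ * X t) = ∫ x in (0 : ℝ)..1,
      (2 * (u t x * u t x) + 2 * (E * (f t x * P t x)) + κ * (P t x * P t x)) := by
    intro t
    have hft : Continuous (f t) := hf.comp (by fun_prop : Continuous fun x => (t, x))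
    have c1 : Continuous fun x => 2 * (u t x * u t x) := continuous_const.mul ((hut t).mul (hut t))
    have c2 : Continuous fun x => 2 * (E * (f t x * P t x)) :=
      continuous_const.mul (continuous_const.mul (hft.mul (hPt t)))
    have c3 : Continuous fun x => κ * (P t x * P t x) := continuous_const.mul ((hPt t).mul (hPt t))
    have c12 : Continuous fun x => 2 * (u t x * u t x) + 2 * (E * (f t x * P t x)) := c1.add c2
    rw [intervalIntegral.integral_add (c12.intervalIntegrable _ _)
      (c3.intervalIntegrable _ _), intervalIntegral.integral_add (c1.intervalIntegrable _ _)
      (c2.intervalIntegrable _ _)]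
    simp only [intervalIntegral.integral_const_mul, Φ, X]
    ring
  have henergy : ∀ t ∈ Icc 0 T, -(2 * Φ t t) ≤ κ * X t := by
    intro t ht
    have : 0 ≤ 2 * Φ t t + κ * X t := by
      rw [hint]
      refine intervalIntegral.integral_nonneg zero_le_one fun x hx => ?_
      have h1 := hfu t ht x hx
      have h2 : |E * (f t x * P t x)| ≤ |E| * (L * |u t x| * |P t x|) := by
        rw [abs_mul, abs_mul]
        gcongr
      have h3 := neg_abs_le (E * (f t x * P t x))
      have h4 : κ * (P t x * P t x) = ((|E| * L) * |P t x|) ^ 2 / 2 := by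
        rw [hκ, mul_pow (|E| * L), sq_abs (P t x)]; ring
      have h5 : u t x * u t x = |u t x| ^ 2 := by rw [sq_abs]; ring
      rw [h4, h5]
      nlinarith [sq_nonneg (2 * |u t x| - |E| * L * |P t x|)]
    linarith
  have hX0 : ∀ t ∈ Icc 0 T, X t ≤ 0 := by
    intro t ht
    have hT0 : (0 : ℝ) ∈ Icc 0 T := ⟨le_rfl, ht.1.trans ht.2⟩
    have hanti : AntitoneOn (fun t => X t * Real.exp (-κ * t)) (Icc 0 T) := by
      have hder : ∀ t ∈ Icc 0 T, HasDerivWithinAt (fun t => X t * Real.exp (-κ * t))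
          (-(2 * Φ t t) * Real.exp (-κ * t) + X t * (Real.exp (-κ * t) * (-κ * 1))) (Icc 0 T) t :=
        fun t ht => (hXd t ht).mul ((((hasDerivAt_id t).const_mul (-κ)).exp).hasDerivWithinAt)
      refine antitoneOn_of_hasDerivWithinAt_nonpos (convex_Icc 0 T)
        (fun t ht => (hder t ht).continuousWithinAt)
        (fun t ht => (hder t (interior_subset ht)).mono interior_subset) fun t ht => ?_
      have h1 := henergy t (interior_subset ht)
      have h2 := Real.exp_pos (-κ * t)
      nlinarith
    have h := hanti hT0 ht ht.1
    have h0 : X 0 = 0 := by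
      have := hB 0 0 hT0
      simpa [X] using this
    simp only [h0, zero_mul] at h
    by_contra hcon
    push Not at hcon
    have := mul_pos hcon (Real.exp_pos (-κ * t))
    linarith
  intro t ht x hx
  have hPzero : ∀ y ∈ Icc (0 : ℝ) 1, P t y = 0 := by
    intro y hy
    by_contra hne
    have := intervalIntegral.integral_pos (f := fun x => P t x * P t x) zero_lt_one
      ((hPt t).mul (hPt t)).continuousOn (fun z _ => mul_self_nonneg _)
      ⟨y, hy, mul_self_pos.2 hne⟩
    exact absurd this (not_lt.2 (hX0 t ht))
  have hev : P t =ᶠ[𝓝 x] fun _ => 0 := by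
    filter_upwards [Icc_mem_nhds hx.1 hx.2] with y hy using hPzero y hy
  exact (hPd t x).unique ((hasDerivAt_const x (0 : ℝ)).congr_of_eventuallyEq hev)

/-- The time integrand in the weak formulation. -/
def weakRate (E α β : ℝ) (r : ℝ → ℝ → ℝ) (G : ℝ → ℝ) (s : ℝ) : ℝ :=
  (∫ x in (0 : ℝ)..1, r s x * deriv (deriv G) x) + α * deriv G 0 - β * deriv G 1 +
    E * ∫ x in (0 : ℝ)..1, flux (r s x) * deriv G x

theorem continuous_deriv_deriv {G : ℝ → ℝ} (hG : ContDiff ℝ 2 G) :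
    Continuous (deriv G) ∧ Continuous (deriv (deriv G)) := by
  have h1 : ContDiff ℝ 1 (deriv G) := by
    rw [show (2 : WithTop ℕ∞) = 1 + 1 by norm_num, contDiff_succ_iff_deriv] at hG
    exact hG.2.2
  exact ⟨h1.continuous, (contDiff_one_iff_deriv.1 h1).2⟩

theorem continuous_weakRate (E α β : ℝ) {r : ℝ → ℝ → ℝ} (hr : Continuous (Function.uncurry r))
    {G : ℝ → ℝ} (hG : ContDiff ℝ 2 G) : Continuous (weakRate E α β r G) := by
  obtain ⟨h1, h2⟩ := continuous_deriv_deriv hG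
  have c1 : Continuous fun s => ∫ x in (0 : ℝ)..1, r s x * deriv (deriv G) x :=
    intervalIntegral.continuous_parametric_intervalIntegral_of_continuous'
      (f := fun s x => r s x * deriv (deriv G) x) (hr.mul (h2.comp continuous_snd)) 0 1
  have c2 : Continuous fun s => ∫ x in (0 : ℝ)..1, flux (r s x) * deriv G x :=
    intervalIntegral.continuous_parametric_intervalIntegral_of_continuous'
      (f := fun s x => flux (r s x) * deriv G x)
      ((hr.mul (continuous_const.sub hr)).mul (h1.comp continuous_snd)) 0 1
  unfold weakRate
  fun_prop

/-- A weak solution on `[0, ∞)` agrees on `[0, T] × (0, 1)` with every continuous function that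
satisfies the weak equation up to time `T`. -/
theorem IsWeakBurgersSolution.eq_of_weak {E α β T : ℝ} {ρ₀ : ℝ → ℝ} {ρ r : ℝ → ℝ → ℝ}
    (hρ : IsWeakBurgersSolution E α β ρ₀ ρ) (hr : Continuous (Function.uncurry r))
    (hweak : ∀ G : ℝ → ℝ, ContDiff ℝ 2 G → G 0 = 0 → G 1 = 0 → ∀ t ∈ Icc 0 T,
      (∫ x in (0 : ℝ)..1, r t x * G x) - ∫ x in (0 : ℝ)..1, ρ₀ x * G x =
        ∫ s in (0 : ℝ)..t, weakRate E α β r G s) :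
    ∀ t ∈ Icc 0 T, ∀ x ∈ Ioo (0 : ℝ) 1, ρ t x = r t x := by
  -- Freezing the values outside `[0, ∞) × [0, 1]` gives a continuous function on the plane.
  let σ : ℝ → ℝ → ℝ := fun t x => ρ (max 0 t) (projIcc (0 : ℝ) 1 zero_le_one x)
  have hσ : Continuous (Function.uncurry σ) := by
    refine hρ.continuousOn.comp_continuous
      (f := fun p : ℝ × ℝ => (max 0 p.1, (projIcc (0 : ℝ) 1 zero_le_one p.2 : ℝ))) ?_ ?_
    · have : Continuous fun p : ℝ × ℝ => (projIcc (0 : ℝ) 1 zero_le_one p.2 : ℝ) :=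
        continuous_subtype_val.comp (continuous_projIcc.comp continuous_snd)
      fun_prop
    · exact fun p => mem_prod.2 ⟨le_max_left 0 p.1, Subtype.coe_prop _⟩
  have hσeq : ∀ t, 0 ≤ t → ∀ x ∈ Icc (0 : ℝ) 1, σ t x = ρ t x := by
    intro t ht x hx
    simp only [σ]
    rw [max_eq_right ht, projIcc_of_mem zero_le_one hx]
  let u : ℝ → ℝ → ℝ := fun t x => σ t x - r t x
  let f : ℝ → ℝ → ℝ := fun t x => flux (σ t x) - flux (r t x)
  have hflux : ∀ {g : ℝ → ℝ → ℝ}, Continuous (Function.uncurry g) →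
      Continuous (Function.uncurry fun t x => flux (g t x)) := fun h =>
    h.mul (continuous_const.sub h)
  have hu : Continuous (Function.uncurry u) := hσ.sub hr
  have hf : Continuous (Function.uncurry f) := (hflux hσ).sub (hflux hr)
  obtain ⟨L, hL⟩ := (isCompact_Icc.prod isCompact_Icc :
    IsCompact (Icc (0 : ℝ) T ×ˢ Icc (0 : ℝ) 1)).exists_bound_of_continuousOn
      (f := fun p : ℝ × ℝ => 1 - σ p.1 p.2 - r p.1 p.2)
      ((continuous_const.sub hσ).sub hr).continuousOn
  have key := eq_zero_of_weak (E := E) (T := T) (L := L) hu hf (fun t ht x hx => ?_)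
    (fun G hG hG0 hG1 t ht => ?_)
  · intro t ht x hx
    have := key t ht x hx
    simp only [u] at this
    rw [← hσeq t ht.1 x ⟨hx.1.le, hx.2.le⟩]
    linarith
  · have e : f t x = (1 - σ t x - r t x) * u t x := by simp only [f, u, flux]; ring
    rw [e, abs_mul]
    gcongr
    exact hL (t, x) ⟨ht, hx⟩
  · obtain ⟨hG', hG''⟩ := continuous_deriv_deriv hG
    have hσt : ∀ s, Continuous (σ s) := fun s => hσ.comp (by fun_prop : Continuous fun x => (s, x))
    have hrt : ∀ s, Continuous (r s) := fun s => hr.comp (by fun_prop : Continuous fun x => (s, x))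
    have hfσ : ∀ s, Continuous fun x => flux (σ s x) := fun s =>
      (hσt s).mul (continuous_const.sub (hσt s))
    have hfr : ∀ s, Continuous fun x => flux (r s x) := fun s =>
      (hrt s).mul (continuous_const.sub (hrt s))
    have h1 := hρ.weak G hG hG0 hG1 t ht.1
    have h2 := hweak G hG hG0 hG1 t ht
    have e1 : (∫ x in (0 : ℝ)..1, ρ t x * G x) = ∫ x in (0 : ℝ)..1, σ t x * G x := by
      refine intervalIntegral.integral_congr fun x hx => ?_
      rw [uIcc_of_le zero_le_one] at hx
      simp only [hσeq t ht.1 x hx]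
    have e2 : (∫ s in (0 : ℝ)..t, ((∫ x in (0 : ℝ)..1, ρ s x * deriv (deriv G) x)
          + α * deriv G 0 - β * deriv G 1 + E * ∫ x in (0 : ℝ)..1, flux (ρ s x) * deriv G x)) =
        ∫ s in (0 : ℝ)..t, weakRate E α β σ G s := by
      refine intervalIntegral.integral_congr fun s hs => ?_
      rw [uIcc_of_le ht.1] at hs
      simp only [weakRate]
      congr 1
      · congr 2
        refine intervalIntegral.integral_congr fun x hx => ?_
        rw [uIcc_of_le zero_le_one] at hx
        simp only [hσeq s hs.1 x hx]
      · congr 1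
        refine intervalIntegral.integral_congr fun x hx => ?_
        rw [uIcc_of_le zero_le_one] at hx
        simp only [hσeq s hs.1 x hx]
    rw [e1, e2] at h1
    have e3 : (∫ x in (0 : ℝ)..1, u t x * G x) =
        (∫ x in (0 : ℝ)..1, σ t x * G x) - ∫ x in (0 : ℝ)..1, r t x * G x := by
      have i1 : Continuous fun x => σ t x * G x := (hσt t).mul hG.continuous
      have i2 : Continuous fun x => r t x * G x := (hrt t).mul hG.continuous
      rw [← intervalIntegral.integral_sub (i1.intervalIntegrable _ _) (i2.intervalIntegrable _ _)]
      simp only [u, sub_mul]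
    have e4 : ∀ s, ((∫ x in (0 : ℝ)..1, u s x * deriv (deriv G) x) +
          E * ∫ x in (0 : ℝ)..1, f s x * deriv G x) =
        weakRate E α β σ G s - weakRate E α β r G s := by
      intro s
      have a1 : (∫ x in (0 : ℝ)..1, u s x * deriv (deriv G) x) =
          (∫ x in (0 : ℝ)..1, σ s x * deriv (deriv G) x) -
            ∫ x in (0 : ℝ)..1, r s x * deriv (deriv G) x := by
        have i1 : Continuous fun x => σ s x * deriv (deriv G) x := (hσt s).mul hG''
        have i2 : Continuous fun x => r s x * deriv (deriv G) x := (hrt s).mul hG''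
        rw [← intervalIntegral.integral_sub (i1.intervalIntegrable _ _) (i2.intervalIntegrable _ _)]
        simp only [u, sub_mul]
      have a2 : (∫ x in (0 : ℝ)..1, f s x * deriv G x) =
          (∫ x in (0 : ℝ)..1, flux (σ s x) * deriv G x) -
            ∫ x in (0 : ℝ)..1, flux (r s x) * deriv G x := by
        have i1 : Continuous fun x => flux (σ s x) * deriv G x := (hfσ s).mul hG'
        have i2 : Continuous fun x => flux (r s x) * deriv G x := (hfr s).mul hG'
        rw [← intervalIntegral.integral_sub (i1.intervalIntegrable _ _) (i2.intervalIntegrable _ _)]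
        simp only [f, sub_mul]
      rw [a1, a2]
      simp only [weakRate]
      ring
    simp only [e4]
    rw [intervalIntegral.integral_sub ((continuous_weakRate E α β hσ hG).intervalIntegrable _ _)
      ((continuous_weakRate E α β hr hG).intervalIntegrable _ _), e3]
    linarith

/-! ### Limits along dyadic refinements -/

theorem abs_sub_le_of_adjacent {q : ℕ → ℝ} {δ : ℝ} {M : ℕ} (hδ : 0 ≤ δ)
    (hq : ∀ j < M, |q (j + 1) - q j| ≤ δ) {i j : ℕ} (hi : i ≤ M) (hj : j ≤ M)
    (hij : i ≤ j + 1) (hji : j ≤ i + 1) : |q i - q j| ≤ δ := by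
  rcases (by omega : i = j ∨ i = j + 1 ∨ j = i + 1) with rfl | rfl | rfl
  · simpa using hδ
  · exact hq j (by omega)
  · rw [abs_sub_comm]; exact hq i (by omega)

/-- Grid functions on the grids of `N * 2 ^ k` cells that are uniformly Lipschitz in space and whose
values on successive grids differ by at most a multiple of the mesh size converge, at the rate of
the mesh size, to a continuous function. -/
theorem exists_dyadic_limit {N : ℕ} (hN : 0 < N) {C : ℝ} (hC : 0 ≤ C) {q : ℕ → ℝ → ℕ → ℝ}
    (hcont : ∀ k, ∀ j ≤ N * 2 ^ k, Continuous fun t => q k t j)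
    (hgrad : ∀ k t, ∀ j < N * 2 ^ k, |q k t (j + 1) - q k t j| ≤ C / (N * 2 ^ k : ℕ))
    (hdouble : ∀ k t, ∀ j ≤ N * 2 ^ k, |q k t j - q (k + 1) t (2 * j)| ≤ C / (N * 2 ^ k : ℕ)) :
    ∃ r : ℝ → ℝ → ℝ, Continuous (Function.uncurry r) ∧ ∀ k t, ∀ j ≤ N * 2 ^ k,
      ∀ x ∈ Icc (0 : ℝ) 1, |x * (N * 2 ^ k : ℕ) - j| ≤ 1 →
        |q k t j - r t x| ≤ 5 * C / (N * 2 ^ k : ℕ) := by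
  have hN0 : (0 : ℝ) < N := by exact_mod_cast hN
  have hM : ∀ k, (0 : ℝ) < (N * 2 ^ k : ℕ) := fun k => by positivity
  have hδ : ∀ k, 0 ≤ C / ((N * 2 ^ k : ℕ) : ℝ) := fun k => by have := hM k; positivity
  -- The site to the left of `x`, with `x` frozen outside `[0, 1]`.
  let n : ℕ → ℝ → ℕ := fun k x => ⌊(projIcc (0 : ℝ) 1 zero_le_one x : ℝ) * (N * 2 ^ k : ℕ)⌋₊
  have hproj : ∀ x, (0 : ℝ) ≤ projIcc (0 : ℝ) 1 zero_le_one x ∧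
      (projIcc (0 : ℝ) 1 zero_le_one x : ℝ) ≤ 1 := fun x => (projIcc (0 : ℝ) 1 zero_le_one x).2
  have hnn : ∀ k x, 0 ≤ (projIcc (0 : ℝ) 1 zero_le_one x : ℝ) * (N * 2 ^ k : ℕ) := fun k x =>
    mul_nonneg (hproj x).1 (hM k).le
  have hnle : ∀ k x, n k x ≤ N * 2 ^ k := by
    intro k x
    refine Nat.floor_le_of_le ?_
    nlinarith [(hproj x).2, hM k]
  have hnlo : ∀ k x, (n k x : ℝ) ≤ (projIcc (0 : ℝ) 1 zero_le_one x : ℝ) * (N * 2 ^ k : ℕ) :=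
    fun k x => Nat.floor_le (hnn k x)
  have hnhi : ∀ k x, (projIcc (0 : ℝ) 1 zero_le_one x : ℝ) * (N * 2 ^ k : ℕ) < n k x + 1 :=
    fun k x => Nat.lt_floor_add_one _
  have hstep : ∀ k t x, dist (q k t (n k x)) (q (k + 1) t (n (k + 1) x)) ≤
      4 * C / N / 2 / 2 ^ k := by
    intro k t x
    have h1 := hdouble k t (n k x) (hnle k x)
    have e : ((N * 2 ^ (k + 1) : ℕ) : ℝ) = 2 * (N * 2 ^ k : ℕ) := by push_cast; ring
    have hlo := hnlo k x
    have hhi := hnhi k x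
    have hlo' := hnlo (k + 1) x
    have hhi' := hnhi (k + 1) x
    rw [e] at hlo' hhi'
    have b1 : 2 * n k x < n (k + 1) x + 1 := by
      have : (2 * n k x : ℝ) < n (k + 1) x + 1 := by linarith
      exact_mod_cast this
    have b2 : n (k + 1) x < 2 * n k x + 2 := by
      have : (n (k + 1) x : ℝ) < 2 * n k x + 2 := by linarith
      exact_mod_cast this
    have h2 := abs_sub_le_of_adjacent (hδ (k + 1)) (hgrad (k + 1) t) (i := 2 * n k x)
      (j := n (k + 1) x) (by have := hnle k x; rw [pow_succ, ← mul_assoc]; omega) (hnle (k + 1) x)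
      (by omega) (by omega)
    have h3 : C / ((N * 2 ^ (k + 1) : ℕ) : ℝ) ≤ C / (N * 2 ^ k : ℕ) := by
      rw [e]
      have := hM k
      gcongr
      linarith
    rw [Real.dist_eq]
    calc _ ≤ _ := abs_sub_le _ (q (k + 1) t (2 * n k x)) _
      _ ≤ C / (N * 2 ^ k : ℕ) + C / (N * 2 ^ k : ℕ) := add_le_add h1 (h2.trans h3)
      _ = _ := by push_cast; field_simp; ring
  -- Successive approximations differ by a geometric sequence of ratio `1 / 2`.
  choose r hr using fun t x => cauchySeq_tendsto_of_complete
    (cauchySeq_of_le_geometric_two (fun k => hstep k t x))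
  have hclose : ∀ k t x, |q k t (n k x) - r t x| ≤ 4 * C / (N * 2 ^ k : ℕ) := by
    intro k t x
    have := dist_le_of_le_geometric_two_of_tendsto (fun k => hstep k t x) (hr t x) k
    rw [Real.dist_eq] at this
    refine this.trans (le_of_eq ?_)
    push_cast
    rw [div_div]
  refine ⟨r, ?_, ?_⟩
  · rw [Metric.continuous_iff]
    rintro ⟨t, x⟩ ε hε
    obtain ⟨k, hk⟩ : ∃ k : ℕ, 9 * C / ((N * 2 ^ k : ℕ) : ℝ) < ε / 2 := by
      obtain ⟨k, hk⟩ := pow_unbounded_of_one_lt (18 * C / ε) (one_lt_two (α := ℝ))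
      refine ⟨k, ?_⟩
      rw [div_lt_iff₀ hε] at hk
      rw [div_lt_iff₀ (hM k)]
      push_cast
      have h1 : (1 : ℝ) ≤ N := by exact_mod_cast hN
      have h2 : ε * 2 ^ k ≤ ε * (N * 2 ^ k) := by
        gcongr
        nlinarith [pow_pos (two_pos (α := ℝ)) k]
      linarith
    obtain ⟨δ, hδ0, hδt⟩ := Metric.continuous_iff.1 (hcont k (n k x) (hnle k x)) t (ε / 2)
      (by positivity)
    refine ⟨min δ (1 / (N * 2 ^ k : ℕ)), lt_min hδ0 (by have := hM k; positivity), ?_⟩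
    rintro ⟨t', x'⟩ hd
    rw [Prod.dist_eq, max_lt_iff] at hd
    have hdt := hδt t' (hd.1.trans_le (min_le_left _ _))
    have hdx : |x' - x| < 1 / (N * 2 ^ k : ℕ) := by
      have := hd.2.trans_le (min_le_right _ _)
      rwa [Real.dist_eq] at this
    have hpx : |(projIcc (0 : ℝ) 1 zero_le_one x' : ℝ) - projIcc (0 : ℝ) 1 zero_le_one x| *
        (N * 2 ^ k : ℕ) < 1 := by
      rw [← lt_div_iff₀ (hM k)]
      exact (abs_projIcc_sub_projIcc zero_le_one).trans_lt hdx
    rw [← abs_of_pos (hM k), ← abs_mul, sub_mul, abs_lt] at hpx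
    have l1 := hnlo k x
    have l2 := hnhi k x
    have l3 := hnlo k x'
    have l4 := hnhi k x'
    have b1 : n k x' < n k x + 2 := by
      have : (n k x' : ℝ) < n k x + 2 := by linarith [hpx.2]
      exact_mod_cast this
    have b2 : n k x < n k x' + 2 := by
      have : (n k x : ℝ) < n k x' + 2 := by linarith [hpx.1]
      exact_mod_cast this
    have h1 := abs_sub_le_of_adjacent (hδ k) (hgrad k t') (hnle k x') (hnle k x)
      (by omega) (by omega)
    have h2 := hclose k t' x'
    have h3 := hclose k t x
    rw [Real.dist_eq] at hdt ⊢
    simp only [Function.uncurry]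
    have e : 9 * C / ((N * 2 ^ k : ℕ) : ℝ) = 4 * C / (N * 2 ^ k : ℕ) + C / (N * 2 ^ k : ℕ) +
      4 * C / (N * 2 ^ k : ℕ) := by ring
    rw [e] at hk
    rw [abs_le] at h1 h2 h3
    rw [abs_lt] at hdt ⊢
    constructor <;> linarith [h1.1, h1.2, h2.1, h2.2, h3.1, h3.2, hdt.1, hdt.2]
  · intro k t j hj x hx hjx
    have hp : (projIcc (0 : ℝ) 1 zero_le_one x : ℝ) = x := by rw [projIcc_of_mem zero_le_one hx]
    have l1 := hnlo k x
    have l2 := hnhi k x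
    rw [hp] at l1 l2
    rw [abs_le] at hjx
    have b1 : j < n k x + 2 := by
      have : (j : ℝ) < n k x + 2 := by linarith [hjx.1]
      exact_mod_cast this
    have b2 : n k x ≤ j + 1 := by
      have : (n k x : ℝ) ≤ j + 1 := by linarith [hjx.2]
      exact_mod_cast this
    have h1 := abs_sub_le_of_adjacent (hδ k) (hgrad k t) hj (hnle k x) (by omega) b2
    calc _ ≤ _ := abs_sub_le _ (q k t (n k x)) _
      _ ≤ C / (N * 2 ^ k : ℕ) + 4 * C / (N * 2 ^ k : ℕ) := add_le_add h1 (hclose k t x)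
      _ = _ := by ring

/-! ### Summation by parts and quadrature -/

theorem sum_by_parts (u g : ℕ → ℝ) (m : ℕ) :
    ∑ j ∈ Finset.range m, (u (j + 1) - u j) * g (j + 1) =
      u m * g (m + 1) - u 0 * g 0 - ∑ j ∈ Finset.range (m + 1), u j * (g (j + 1) - g j) := by
  induction m with
  | zero => simp; ring
  | succ m ih => rw [Finset.sum_range_succ, ih, Finset.sum_range_succ _ (m + 1)]; ring

theorem abs_sub_sub_deriv_mul_le {W w w' : ℝ → ℝ} {K : ℝ}
    (h₁ : ∀ x, HasDerivAt W (w x) x) (h₂ : ∀ x, HasDerivAt w (w' x) x)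
    (hK : ∀ x ∈ Icc (0 : ℝ) 1, |w' x| ≤ K) {x y : ℝ} (hx : x ∈ Icc (0 : ℝ) 1)
    (hy : y ∈ Icc (0 : ℝ) 1) : |W y - W x - w x * (y - x)| ≤ K * (y - x) ^ 2 := by
  have hsub : uIcc x y ⊆ Icc 0 1 := uIcc_subset_Icc hx hy
  have hK0 : 0 ≤ K := (abs_nonneg _).trans (hK x hx)
  have h := (convex_uIcc x y).norm_image_sub_le_of_norm_hasDerivWithin_le
    (f := fun z => W z - w x * z) (f' := fun z => w z - w x * 1) (C := K * |y - x|)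
    (fun z _ => ((h₁ z).sub ((hasDerivAt_id z).const_mul _)).hasDerivWithinAt) (fun z hz => ?_)
    left_mem_uIcc right_mem_uIcc
  · rw [Real.norm_eq_abs, Real.norm_eq_abs, mul_assoc, abs_mul_abs_self] at h
    calc _ = |W y - w x * y - (W x - w x * x)| := by congr 1; ring
      _ ≤ _ := h
      _ = _ := by ring
  · rw [mul_one, Real.norm_eq_abs]
    have h1 := lipschitz_of_bound (fun z _ => (h₂ z).hasDerivWithinAt) hK hx (hsub hz)
    have h2 : |z - x| ≤ |y - x| := abs_sub_left_of_mem_uIcc hz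
    exact h1.trans (by gcongr)

/-- Quadrature with exact weights: if `a j` is within `η` of `f` on the `j`-th cell, then
`∑ a j * (W((j+1)/M) - W(j/M))` is within `η * sup |W'|` of `∫ f * W'`. -/
theorem abs_sum_mul_sub_integral_le {M : ℕ} (hM : 0 < M) {W w f : ℝ → ℝ} {a : ℕ → ℝ} {η K : ℝ}
    (hW : ∀ x, HasDerivAt W (w x) x) (hw : Continuous w) (hf : ContinuousOn f (Icc 0 1))
    (hK : ∀ x ∈ Icc (0 : ℝ) 1, |w x| ≤ K) (hη : 0 ≤ η)
    (ha : ∀ j < M, ∀ x ∈ Icc ((j : ℝ) / M) ((j + 1 : ℕ) / M), |a j - f x| ≤ η) :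
    |∑ j ∈ Finset.range M, a j * (W ((j + 1 : ℕ) / M) - W ((j : ℝ) / M)) -
      ∫ x in (0 : ℝ)..1, f x * w x| ≤ η * K := by
  have hM0 : (0 : ℝ) < M := by exact_mod_cast hM
  have hmono : ∀ j : ℕ, (j : ℝ) / M ≤ ((j + 1 : ℕ) : ℝ) / M := fun j => by
    gcongr; exact_mod_cast Nat.le_succ j
  have hcell : ∀ j < M, Icc ((j : ℝ) / M) ((j + 1 : ℕ) / M) ⊆ Icc (0 : ℝ) 1 := by
    intro j hj
    refine Icc_subset_Icc (by positivity) ?_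
    rw [div_le_one hM0]
    exact_mod_cast hj
  have hint : ∀ j < M, IntervalIntegrable (fun x => f x * w x) MeasureTheory.volume
      ((j : ℝ) / M) ((j + 1 : ℕ) / M) := fun j hj => by
    refine ContinuousOn.intervalIntegrable ?_
    rw [uIcc_of_le (hmono j)]
    exact (hf.mono (hcell j hj)).mul hw.continuousOn
  have hsum := intervalIntegral.sum_integral_adjacent_intervals
    (a := fun j : ℕ => (j : ℝ) / M) (n := M) hint
  simp only [Nat.cast_zero, zero_div, div_self hM0.ne'] at hsum
  rw [← hsum, ← Finset.sum_sub_distrib]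
  refine (Finset.abs_sum_le_sum_abs _ _).trans ?_
  have hbound : ∀ j ∈ Finset.range M, |a j * (W ((j + 1 : ℕ) / M) - W ((j : ℝ) / M)) -
      ∫ x in ((j : ℝ) / M)..((j + 1 : ℕ) / M), f x * w x| ≤ η * K / M := by
    intro j hj
    have hj' := Finset.mem_range.1 hj
    have hFTC : ∫ x in ((j : ℝ) / M)..((j + 1 : ℕ) / M), w x =
        W ((j + 1 : ℕ) / M) - W ((j : ℝ) / M) :=
      intervalIntegral.integral_eq_sub_of_hasDerivAt (fun x _ => hW x) (hw.intervalIntegrable _ _)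
    rw [← hFTC, ← intervalIntegral.integral_const_mul, ← intervalIntegral.integral_sub
      ((hw.intervalIntegrable _ _).const_mul _) (hint j hj')]
    have := intervalIntegral.norm_integral_le_of_norm_le_const (a := (j : ℝ) / M)
      (b := ((j + 1 : ℕ) : ℝ) / M) (C := η * K) (f := fun x => a j * w x - f x * w x)
      (fun x hx => by
        rw [uIoc_of_le (hmono j)] at hx
        have hx' : x ∈ Icc ((j : ℝ) / M) ((j + 1 : ℕ) / M) := ⟨hx.1.le, hx.2⟩
        rw [← sub_mul, Real.norm_eq_abs, abs_mul]
        exact mul_le_mul (ha j hj' x hx') (hK x (hcell j hj' hx')) (abs_nonneg _) hη)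
    have e : |((j + 1 : ℕ) : ℝ) / M - j / M| = 1 / M := by
      rw [← sub_div]; push_cast; rw [add_sub_cancel_left, abs_of_pos (by positivity)]
    rw [e, Real.norm_eq_abs] at this
    calc _ ≤ _ := this
      _ = _ := by ring
  calc _ ≤ ∑ _j ∈ Finset.range M, η * K / M := Finset.sum_le_sum hbound
    _ = _ := by rw [Finset.sum_const, Finset.card_range, nsmul_eq_mul]; field_simp

/-! ### The weak equation satisfied by the semidiscrete solutions -/

/-- The Riemann sum of the proxy of `l` against `G`, summed by parts: it involves `l` only through
the values of its logarithm (see `moment_eq`). -/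
def moment (E : ℝ) (M : ℕ) (l : ℕ → ℝ) (G : ℝ → ℝ) : ℝ :=
  -(∑ j ∈ Finset.range M, Real.log (l j) * (G ((j + 1 : ℕ) / M) - G ((j : ℝ) / M))) /
    (M * Real.log (1 + E / M))

/-- The value `a 0` is irrelevant, because `G 0 = 0`. -/
theorem moment_eq {E : ℝ} (hE : 0 < E) {M : ℕ} (hM : 0 < M) (l : ℕ → ℝ) {G : ℝ → ℝ}
    (hG0 : G 0 = 0) (hG1 : G 1 = 0) {a : ℕ → ℝ}
    (ha : ∀ j, 1 ≤ j → j < M → proxy E M l j = a j) :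
    moment E M l G = ∑ j ∈ Finset.range M, a j * (G ((j : ℝ) / M) / M) := by
  obtain ⟨m, rfl⟩ : ∃ m, M = m + 1 := ⟨M - 1, by omega⟩
  have hM0 : (0 : ℝ) < (m + 1 : ℕ) := by exact_mod_cast hM
  have hl := (inv_log_one_add_close (show 0 < E / ((m + 1 : ℕ) : ℝ) by positivity)).1
  have h := sum_by_parts (fun j => Real.log (l j)) (fun j => G ((j : ℝ) / (m + 1 : ℕ))) m
  rw [div_self hM0.ne', hG1] at h
  simp only [Nat.cast_zero, zero_div, hG0, mul_zero, sub_zero, zero_sub] at h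
  rw [moment, ← h, Finset.sum_range_succ', Finset.sum_div]
  simp only [Nat.cast_zero, zero_div, hG0, mul_zero, add_zero]
  refine Finset.sum_congr rfl fun j hj => ?_
  rw [← ha (j + 1) (by omega) (by have := Finset.mem_range.1 hj; omega), proxy_eq hE hM,
    Nat.add_sub_cancel]
  field_simp

theorem abs_moment_sub_integral_le {E : ℝ} (hE : 0 < E) {M : ℕ} (hM : 0 < M) {l : ℕ → ℝ}
    {G G' : ℝ → ℝ} (hG : ∀ x, HasDerivAt G (G' x) x) (hG0 : G 0 = 0) (hG1 : G 1 = 0) {K : ℝ}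
    (hK : ∀ x ∈ Icc (0 : ℝ) 1, |G x| ≤ K) (hK' : ∀ x ∈ Icc (0 : ℝ) 1, |G' x| ≤ K)
    {a : ℕ → ℝ} {f : ℝ → ℝ} (hf : ContinuousOn f (Icc 0 1))
    (hp : ∀ j, 1 ≤ j → j < M → proxy E M l j = a j) {η B : ℝ} (hη : 0 ≤ η)
    (ha : ∀ j < M, ∀ x ∈ Icc ((j : ℝ) / M) ((j + 1 : ℕ) / M), |a j - f x| ≤ η)
    (hB : ∀ j < M, |a j| ≤ B) :
    |moment E M l G - ∫ x in (0 : ℝ)..1, f x * G x| ≤ η * K + B * K / M := by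
  have hM0 : (0 : ℝ) < M := by exact_mod_cast hM
  have hGc : Continuous G := continuous_iff_continuousAt.2 fun x => (hG x).continuousAt
  have hK0 : 0 ≤ K := (abs_nonneg _).trans (hK 0 (by simp))
  let W : ℝ → ℝ := fun x => ∫ y in (0 : ℝ)..x, G y
  have hW : ∀ x, HasDerivAt W (G x) x := fun x => (hGc.integral_hasStrictDerivAt 0 x).hasDerivAt
  have h1 := abs_sum_mul_sub_integral_le hM hW hGc hf hK hη ha
  have h2 : |∑ j ∈ Finset.range M, a j * (G ((j : ℝ) / M) / M) -
      ∑ j ∈ Finset.range M, a j * (W ((j + 1 : ℕ) / M) - W ((j : ℝ) / M))| ≤ B * K / M := by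
    rw [← Finset.sum_sub_distrib]
    refine (Finset.abs_sum_le_sum_abs _ _).trans ?_
    have hbound : ∀ j ∈ Finset.range M, |a j * (G ((j : ℝ) / M) / M) -
        a j * (W ((j + 1 : ℕ) / M) - W ((j : ℝ) / M))| ≤ B * (K * (1 / M) ^ 2) := by
      intro j hj
      have hj' := Finset.mem_range.1 hj
      have m1 : (j : ℝ) / M ∈ Icc (0 : ℝ) 1 :=
        ⟨by positivity, by rw [div_le_one hM0]; exact_mod_cast hj'.le⟩
      have m2 : ((j + 1 : ℕ) : ℝ) / M ∈ Icc (0 : ℝ) 1 :=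
        ⟨by positivity, by rw [div_le_one hM0]; exact_mod_cast hj'⟩
      have h := abs_sub_sub_deriv_mul_le hW hG hK' m1 m2
      have e : ((j + 1 : ℕ) : ℝ) / M - j / M = 1 / M := by push_cast; ring
      rw [e] at h
      rw [← mul_sub, abs_mul, abs_sub_comm, div_eq_mul_one_div (G _)]
      exact mul_le_mul (hB j hj') h (abs_nonneg _) ((abs_nonneg _).trans (hB j hj'))
    calc _ ≤ ∑ _j ∈ Finset.range M, B * (K * (1 / M : ℝ) ^ 2) := Finset.sum_le_sum hbound
      _ = _ := by rw [Finset.sum_const, Finset.card_range, nsmul_eq_mul]; field_simp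
  rw [moment_eq hE hM l hG0 hG1 hp]
  calc _ ≤ _ := abs_sub_le _ (∑ j ∈ Finset.range M, a j * (W ((j + 1 : ℕ) / M) - W ((j : ℝ) / M))) _
    _ ≤ B * K / M + η * K := add_le_add h2 h1
    _ = _ := by ring

theorem hasDerivWithinAt_moment {E α β T : ℝ} {ρ₀ : ℝ → ℝ} {M : ℕ} {lam : ℝ → ℕ → ℝ}
    (hlam : IsSemidiscreteSolution E α β ρ₀ M lam) (G : ℝ → ℝ) {t : ℝ} (ht : t ∈ Icc 0 T)
    (hpos : ∀ j < M, 0 < lam t j) :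
    HasDerivWithinAt (fun τ => moment E M (lam τ) G)
      (-(∑ j ∈ Finset.range M, Omega E α β M (lam t) j / lam t j *
        (G ((j + 1 : ℕ) / M) - G ((j : ℝ) / M))) / (M * Real.log (1 + E / M))) (Icc 0 T) t := by
  unfold moment
  refine HasDerivWithinAt.div_const (HasDerivWithinAt.neg ?_) _
  refine HasDerivWithinAt.fun_sum fun j hj => ?_
  have hj' := Finset.mem_range.1 hj
  exact ((((hlam.evolution t ht.1 j hj').log (hpos j hj').ne').mul_const _).mono
    Icc_subset_Ici_self)

/-- The rate of change of the moments is, up to the order of the mesh size, the right-hand side of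
the weak equation for any function `f` close to the discrete density. The current is inserted for
`Ω x / x`, and a summation by parts moves the differences of the density onto `G'`. -/
theorem abs_momentRate_sub_le {E α β : ℝ} (hE : 0 < E) {M : ℕ} (hM : 2 ≤ M) {C C₁ : ℝ}
    (hC : 0 ≤ C) (hC₁ : 0 ≤ C₁) {x : ℕ → ℝ} (hx : DensityEstimates E α β M C x) {f : ℝ → ℝ}
    (hf : ContinuousOn f (Icc 0 1))
    (hfq : ∀ j ≤ M, ∀ y ∈ Icc (0 : ℝ) 1, |y * M - j| ≤ 1 →
      |density E α β M x j - f y| ≤ C₁ / M)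
    {G G' G'' : ℝ → ℝ} {K : ℝ} (h₁ : ∀ x, HasDerivAt G (G' x) x)
    (h₂ : ∀ x, HasDerivAt G' (G'' x) x) (hc : Continuous G'')
    (hK₁ : ∀ x ∈ Icc (0 : ℝ) 1, |G' x| ≤ K) (hK₂ : ∀ x ∈ Icc (0 : ℝ) 1, |G'' x| ≤ K) :
    |-(∑ j ∈ Finset.range M, Omega E α β M x j / x j *
        (G ((j + 1 : ℕ) / M) - G ((j : ℝ) / M))) / (M * Real.log (1 + E / M)) -
      ((∫ y in (0 : ℝ)..1, f y * G'' y) + α * G' 0 - β * G' 1 +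
        E * ∫ y in (0 : ℝ)..1, flux (f y) * G' y)| ≤
      (C + (C + 2 * (C + E * C + E * (E * (C * (1 + C))))) / E + C + C₁ +
        E * (C₁ * (1 + 2 * C + C₁))) * K / M := by
  have hM0 : (0 : ℝ) < M := by exact_mod_cast (by omega : 0 < M)
  have hM1 : (1 : ℝ) ≤ M := by exact_mod_cast (by omega : 1 ≤ M)
  have hK0 : 0 ≤ K := (abs_nonneg _).trans (hK₁ 0 (by simp))
  have hG'c : Continuous G' := continuous_iff_continuousAt.2 fun x => (h₂ x).continuousAt
  set q := density E α β M x with hq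
  set v : ℕ → ℝ := fun j => Omega E α β M x j / x j with hv
  set d : ℕ → ℝ := fun j => G ((j + 1 : ℕ) / M) - G ((j : ℝ) / M) with hd
  set b : ℕ → ℝ := fun j => E * (M * (q (j + 1) - q j)) - E * (E * flux (q j)) with hb
  set C₂ := C + E * C + E * (E * (C * (1 + C))) with hC₂
  have hnode : ∀ j ≤ M, (j : ℝ) / M ∈ Icc (0 : ℝ) 1 := fun j hj =>
    ⟨by positivity, by rw [div_le_one hM0]; exact_mod_cast hj⟩
  have hmesh : ∀ j : ℕ, ((j + 1 : ℕ) : ℝ) / M - j / M = 1 / M := fun j => by push_cast; ring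
  have hdK : ∀ j < M, |d j| ≤ K / M := by
    intro j hj
    have := lipschitz_of_bound (fun z _ => (h₁ z).hasDerivWithinAt) hK₁ (hnode j hj.le)
      (hnode (j + 1) hj)
    rw [hmesh, abs_of_pos (show (0 : ℝ) < 1 / M by positivity), ← div_eq_mul_one_div] at this
    exact this
  have hcellM : ∀ j < M, ∀ y ∈ Icc ((j : ℝ) / M) ((j + 1 : ℕ) / M),
      y ∈ Icc (0 : ℝ) 1 ∧ |y * M - j| ≤ 1 ∧ |y * M - (j + 1 : ℕ)| ≤ 1 := by
    intro j hj y hy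
    have l1 := (div_le_iff₀ hM0).1 hy.1
    have l2 := (le_div_iff₀ hM0).1 hy.2
    push_cast at l2 ⊢
    refine ⟨⟨(hnode j hj.le).1.trans hy.1, hy.2.trans (hnode (j + 1) hj).2⟩, ?_, ?_⟩ <;>
      rw [abs_le] <;> constructor <;> linarith
  have hvb : |∑ j ∈ Finset.range M, v j * d j - ∑ j ∈ Finset.range M, b j * d j| ≤
      (C + 2 * C₂) * (K / M) := by
    have hfl : ∀ j, |flux (q j)| ≤ C * (1 + C) := fun j => by
      have hqj := hx.bound j
      rw [flux, abs_mul]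
      have : |1 - q j| ≤ 1 + C := (abs_sub _ _).trans (by rw [abs_one]; linarith)
      exact mul_le_mul hqj this (abs_nonneg _) hC
    have hbC : ∀ j < M, |v j - b j| ≤ C₂ := by
      intro j hj
      have g1 := hx.rate j hj
      have g2 : |E * (M * (q (j + 1) - q j))| ≤ E * C := by
        rw [abs_mul, abs_mul, abs_of_pos hE, abs_of_pos hM0]
        have := (le_div_iff₀' hM0).1 (hx.grad j hj)
        gcongr
      have g3 : |E * (E * flux (q j))| ≤ E * (E * (C * (1 + C))) := by
        rw [abs_mul, abs_mul, abs_of_pos hE]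
        have := hfl j
        gcongr
      simp only [hb]
      rw [abs_le] at g1 g2 g3 ⊢
      constructor <;> linarith [g1.1, g1.2, g2.1, g2.2, g3.1, g3.2]
    have hC₂0 : 0 ≤ C₂ := by positivity
    have hCM : 0 ≤ C / M := by positivity
    -- At the two end points the current is not identified, but a bounded error is harmless.
    have hpt : ∀ j ∈ Finset.range M, |v j * d j - b j * d j| ≤
        (C / M + ((if j = 0 then C₂ else 0) + if j = M - 1 then C₂ else 0)) * (K / M) := by
      intro j hj
      have hj' := Finset.mem_range.1 hj
      rw [← sub_mul, abs_mul]
      refine mul_le_mul ?_ (hdK j hj') (abs_nonneg _) (by split_ifs <;> positivity)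
      have := hbC j hj'
      split_ifs with c1 c2 c2
      · linarith
      · linarith
      · linarith
      · have := hx.current j (by omega) (by omega)
        simpa [hv, hb] using this
    rw [← Finset.sum_sub_distrib]
    refine (Finset.abs_sum_le_sum_abs _ _).trans ((Finset.sum_le_sum hpt).trans (le_of_eq ?_))
    rw [← Finset.sum_mul, Finset.sum_add_distrib, Finset.sum_add_distrib, Finset.sum_ite_eq',
      Finset.sum_ite_eq', if_pos (Finset.mem_range.2 (by omega)),
      if_pos (Finset.mem_range.2 (by omega)), Finset.sum_const, Finset.card_range, nsmul_eq_mul]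
    field_simp
    ring
  have hvK : |∑ j ∈ Finset.range M, v j * d j| ≤ C * K := by
    refine (Finset.abs_sum_le_sum_abs _ _).trans ?_
    calc _ ≤ ∑ _j ∈ Finset.range M, C * (K / M) := Finset.sum_le_sum fun j hj => by
          have hj' := Finset.mem_range.1 hj
          rw [abs_mul]
          exact mul_le_mul (hx.rate j hj') (hdK j hj') (abs_nonneg _) hC
      _ = _ := by rw [Finset.sum_const, Finset.card_range, nsmul_eq_mul]; field_simp
  -- The normalisation of the moments tends to `1 / E`.
  have hlog : |1 / (M * Real.log (1 + E / M)) - 1 / E| ≤ 1 / M := by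
    obtain ⟨l1, l2⟩ := inv_log_one_add_close (show 0 < E / (M : ℝ) by positivity)
    have e : 1 / (M * Real.log (1 + E / M)) - 1 / E =
        (1 / Real.log (1 + E / M) - 1 / (E / M)) * (1 / M) := by field_simp
    rw [e, abs_mul, abs_of_pos (show (0 : ℝ) < 1 / M by positivity)]
    exact mul_le_of_le_one_left (by positivity) l2
  -- The difference quotients of `G` may be replaced by `G'`, since the density varies by `O(1/M)`.
  have hdiff : |∑ j ∈ Finset.range M, M * (q (j + 1) - q j) * d j -
      ∑ j ∈ Finset.range M, (q (j + 1) - q j) * G' ((j : ℝ) / M)| ≤ C * K / M := by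
    rw [← Finset.sum_sub_distrib]
    refine (Finset.abs_sum_le_sum_abs _ _).trans ?_
    calc _ ≤ ∑ _j ∈ Finset.range M, C / M * (K / M) := Finset.sum_le_sum fun j hj => by
          have hj' := Finset.mem_range.1 hj
          have h := abs_sub_sub_deriv_mul_le h₁ h₂ hK₂ (hnode j hj'.le) (hnode (j + 1) hj')
          rw [hmesh] at h
          have e : M * (q (j + 1) - q j) * d j - (q (j + 1) - q j) * G' ((j : ℝ) / M) =
              (q (j + 1) - q j) * (M * (G ((j + 1 : ℕ) / M) - G ((j : ℝ) / M) -
                G' ((j : ℝ) / M) * (1 / M))) := by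
            simp only [hd]; field_simp
          rw [e, abs_mul, abs_mul, abs_of_pos hM0]
          refine mul_le_mul (hx.grad j hj') ?_ (by positivity) (by positivity)
          calc _ ≤ M * (K * (1 / M) ^ 2) := by gcongr
            _ = _ := by field_simp
      _ = _ := by rw [Finset.sum_const, Finset.card_range, nsmul_eq_mul]; field_simp
  have habel : ∑ j ∈ Finset.range M, (q (j + 1) - q j) * G' ((j : ℝ) / M) =
      β * G' 1 - α * G' 0 -
        ∑ j ∈ Finset.range M, q (j + 1) * (G' ((j + 1 : ℕ) / M) - G' ((j : ℝ) / M)) := by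
    have h := Finset.sum_range_sub (fun j : ℕ => q j * G' ((j : ℝ) / M)) M
    rw [div_self hM0.ne', hq, density_last (by omega), density_zero, ← hq] at h
    simp only [Nat.cast_zero, zero_div] at h
    rw [← h, ← Finset.sum_sub_distrib]
    exact Finset.sum_congr rfl fun j _ => by ring
  have hsecond := abs_sum_mul_sub_integral_le (by omega : 0 < M) h₂ hc hf hK₂
    (a := fun j => q (j + 1)) (η := C₁ / M) (by positivity) fun j hj y hy => by
      obtain ⟨m1, -, m3⟩ := hcellM j hj y hy
      exact hfq (j + 1) hj y m1 m3
  have hfluxc : ContinuousOn (fun y => flux (f y)) (Icc 0 1) := hf.mul (continuousOn_const.sub hf)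
  have hfirst := abs_sum_mul_sub_integral_le (by omega : 0 < M) h₁ hG'c hfluxc hK₁
    (a := fun j => flux (q j)) (η := C₁ / M * (1 + 2 * C + C₁)) (by positivity) fun j hj y hy => by
      obtain ⟨m1, m2, -⟩ := hcellM j hj y hy
      have g1 := hfq j hj.le y m1 m2
      have g2 := hx.bound j
      have g3 : C₁ / M ≤ C₁ := div_le_self hC₁ hM1
      have e : flux (q j) - flux (f y) = (q j - f y) * (1 - 2 * q j + (q j - f y)) := by
        simp only [flux]; ring
      rw [e, abs_mul]
      refine mul_le_mul g1 ?_ (abs_nonneg _) (by positivity)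
      rw [abs_le] at g1 g2 ⊢
      constructor <;> linarith [g1.1, g1.2, g2.1, g2.2]
  have hbsum : ∑ j ∈ Finset.range M, b j * d j =
      E * ∑ j ∈ Finset.range M, M * (q (j + 1) - q j) * d j -
        E * (E * ∑ j ∈ Finset.range M, flux (q j) * d j) := by
    rw [Finset.mul_sum, Finset.mul_sum, Finset.mul_sum, ← Finset.sum_sub_distrib]
    exact Finset.sum_congr rfl fun j _ => by simp only [hb]; ring
  set Sv := ∑ j ∈ Finset.range M, v j * d j
  set Sb := ∑ j ∈ Finset.range M, b j * d j
  set S₁ := ∑ j ∈ Finset.range M, M * (q (j + 1) - q j) * d j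
  set S₂ := ∑ j ∈ Finset.range M, flux (q j) * d j with hS₂
  set S₃ := ∑ j ∈ Finset.range M, (q (j + 1) - q j) * G' ((j : ℝ) / M)
  set S₄ := ∑ j ∈ Finset.range M, q (j + 1) * (G' ((j + 1 : ℕ) / M) - G' ((j : ℝ) / M))
  set I₁ := ∫ y in (0 : ℝ)..1, flux (f y) * G' y
  set I₂ := ∫ y in (0 : ℝ)..1, f y * G'' y
  have t1 : |Sv * (1 / (M * Real.log (1 + E / M)) - 1 / E)| ≤ C * K * (1 / M) := by
    rw [abs_mul]
    exact mul_le_mul hvK hlog (abs_nonneg _) (by positivity)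
  have t2 : |(Sv - Sb) / E| ≤ (C + 2 * C₂) * (K / M) / E := by
    rw [abs_div, abs_of_pos hE]
    gcongr
  have t3 : |E * (S₂ - I₁)| ≤ E * (C₁ / M * (1 + 2 * C + C₁) * K) := by
    rw [abs_mul, abs_of_pos hE]
    exact mul_le_mul_of_nonneg_left hfirst hE.le
  have e : -Sv / (M * Real.log (1 + E / M)) - (I₂ + α * G' 0 - β * G' 1 + E * I₁) =
      -(Sv * (1 / (M * Real.log (1 + E / M)) - 1 / E)) - (Sv - Sb) / E - (S₁ - S₃) +
        (S₄ - I₂) + E * (S₂ - I₁) := by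
    have h4 : Sb / E = S₁ - E * S₂ := by rw [hbsum]; field_simp
    have h5 : (Sv - Sb) / E = Sv * (1 / E) - (S₁ - E * S₂) := by rw [← h4]; ring
    rw [h5, habel]
    ring
  have e2 : (C + (C + 2 * C₂) / E + C + C₁ + E * (C₁ * (1 + 2 * C + C₁))) * K / M =
      C * K * (1 / M) + (C + 2 * C₂) * (K / M) / E + C * K / M + C₁ / M * K +
        E * (C₁ / M * (1 + 2 * C + C₁) * K) := by ring
  rw [e, e2]
  rw [abs_le] at t1 t2 t3 hdiff hsecond ⊢
  constructor <;> linarith [t1.1, t1.2, t2.1, t2.2, t3.1, t3.2, hdiff.1, hdiff.2, hsecond.1,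
    hsecond.2]

theorem proxy_initial {E α β : ℝ} (hE : 0 < E) {ρ₀ : ℝ → ℝ} {M : ℕ} {lam : ℝ → ℕ → ℝ}
    (hlam : IsSemidiscreteSolution E α β ρ₀ M lam) {j : ℕ} (hj0 : 1 ≤ j) (hj : j < M) :
    proxy E M (lam 0) j = ρ₀ ((j : ℝ) / M) := by
  have hM0 : (0 : ℝ) < M := by exact_mod_cast (by omega : 0 < M)
  have hl := (inv_log_one_add_close (show 0 < E / (M : ℝ) by positivity)).1
  obtain ⟨i, rfl⟩ : ∃ i, j = i + 1 := ⟨j - 1, by omega⟩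
  rw [proxy_eq hE (by omega), Nat.add_sub_cancel, hlam.initial _ hj, hlam.initial i (by omega),
    Real.log_exp, Real.log_exp, Finset.sum_Icc_succ_top (by omega)]
  simp only [gam]
  generalize Real.log (1 + E / M) = ℓ at hl
  field_simp
  ring

/-! ### Identification of the limit -/

theorem exists_lipschitz_bound {f : ℝ → ℝ} (hf : ContDiffOn ℝ 4 f (Icc 0 1)) :
    ∃ L, 0 ≤ L ∧ ∀ x ∈ Icc (0 : ℝ) 1, ∀ y ∈ Icc (0 : ℝ) 1, |f y - f x| ≤ L * |y - x| := by
  have hcont := hf.continuousOn_derivWithin (uniqueDiffOn_Icc zero_lt_one) (by norm_num)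
  obtain ⟨L, hL⟩ := isCompact_Icc.exists_bound_of_continuousOn hcont
  have hd := hf.differentiableOn (by norm_num)
  exact ⟨L, (norm_nonneg _).trans (hL 0 (by simp)), fun x hx y hy =>
    lipschitz_of_bound (fun z hz => (hd z hz).hasDerivWithinAt)
      (fun z hz => by simpa using hL z hz) hx hy⟩

/-- A continuous function approximated by the discrete densities along a sequence of grids satisfies
the weak equation: all errors are of the order of the mesh size. -/
theorem weak_equation_of_close {E α β T : ℝ} (hE : 0 < E) {ρ₀ : ℝ → ℝ}
    (hρ₀ : ContDiffOn ℝ 4 ρ₀ (Icc 0 1)) (hrange : ∀ x ∈ Icc (0 : ℝ) 1, ρ₀ x ∈ Icc (0 : ℝ) 1)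
    {M : ℕ → ℕ} (hM : ∀ k, 2 ≤ M k) (hMtop : Tendsto M atTop atTop) {lam : ℕ → ℝ → ℕ → ℝ}
    (hlam : ∀ k, IsSemidiscreteSolution E α β ρ₀ (M k) (lam k)) {C C₁ : ℝ} (hC : 0 ≤ C)
    (hC₁ : 0 ≤ C₁) (hest : ∀ k, ∀ t ∈ Icc 0 T, DensityEstimates E α β (M k) C (lam k t))
    {r : ℝ → ℝ → ℝ} (hr : Continuous (Function.uncurry r))
    (hclose : ∀ k, ∀ t ∈ Icc 0 T, ∀ j ≤ M k, ∀ y ∈ Icc (0 : ℝ) 1, |y * M k - j| ≤ 1 →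
      |density E α β (M k) (lam k t) j - r t y| ≤ C₁ / M k)
    {G : ℝ → ℝ} (hG : ContDiff ℝ 2 G) (hG0 : G 0 = 0) (hG1 : G 1 = 0) {t : ℝ}
    (ht : t ∈ Icc 0 T) :
    (∫ x in (0 : ℝ)..1, r t x * G x) - ∫ x in (0 : ℝ)..1, ρ₀ x * G x =
      ∫ s in (0 : ℝ)..t, weakRate E α β r G s := by
  obtain ⟨hc₁, hc₂⟩ := continuous_deriv_deriv hG
  have h₁ : ∀ x, HasDerivAt G (deriv G x) x := fun x =>
    (hG.differentiable (by norm_num) x).hasDerivAt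
  have h₂ : ∀ x, HasDerivAt (deriv G) (deriv (deriv G) x) x := by
    have hG' : ContDiff ℝ 1 (deriv G) := by
      rw [show (2 : WithTop ℕ∞) = 1 + 1 by norm_num, contDiff_succ_iff_deriv] at hG
      exact hG.2.2
    exact fun x => (hG'.differentiable (by norm_num) x).hasDerivAt
  obtain ⟨K, hK⟩ : ∃ K, ∀ x ∈ Icc (0 : ℝ) 1,
      |G x| ≤ K ∧ |deriv G x| ≤ K ∧ |deriv (deriv G) x| ≤ K := by
    obtain ⟨K₀, h0⟩ := isCompact_Icc.exists_bound_of_continuousOn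
      (hG.continuous.continuousOn (s := Icc (0 : ℝ) 1))
    obtain ⟨K₁, h1⟩ := isCompact_Icc.exists_bound_of_continuousOn
      (hc₁.continuousOn (s := Icc (0 : ℝ) 1))
    obtain ⟨K₂, h2⟩ := isCompact_Icc.exists_bound_of_continuousOn
      (hc₂.continuousOn (s := Icc (0 : ℝ) 1))
    exact ⟨max K₀ (max K₁ K₂), fun x hx => ⟨(h0 x hx).trans (le_max_left _ _),
      (h1 x hx).trans ((le_max_left _ _).trans (le_max_right _ _)),
      (h2 x hx).trans ((le_max_right _ _).trans (le_max_right _ _))⟩⟩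
  obtain ⟨L, hL0, hL⟩ := exists_lipschitz_bound hρ₀
  have hrt : ∀ s, Continuous (r s) := fun s => hr.comp (by fun_prop : Continuous fun x => (s, x))
  have hrate := continuous_weakRate E α β hr hG
  have hT : (0 : ℝ) ∈ Icc 0 T := ⟨le_rfl, ht.1.trans ht.2⟩
  set Γ := (C + (C + 2 * (C + E * C + E * (E * (C * (1 + C))))) / E + C + C₁ +
    E * (C₁ * (1 + 2 * C + C₁))) * K with hΓ
  set Λ := (C + C₁) * K + 2 * C * K + (L * K + 1 * K) + Γ * t with hΛ
  have hbound : ∀ k, |(∫ x in (0 : ℝ)..1, r t x * G x) - (∫ x in (0 : ℝ)..1, ρ₀ x * G x) -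
      ∫ s in (0 : ℝ)..t, weakRate E α β r G s| ≤ Λ / M k := by
    intro k
    have hMk : 0 < M k := by have := hM k; omega
    have hM0 : (0 : ℝ) < M k := by exact_mod_cast hMk
    have hM1 : (1 : ℝ) ≤ M k := by exact_mod_cast hMk
    have hnode : ∀ j ≤ M k, (j : ℝ) / M k ∈ Icc (0 : ℝ) 1 := fun j hj =>
      ⟨by positivity, by rw [div_le_one hM0]; exact_mod_cast hj⟩
    have hcell : ∀ j < M k, ∀ y ∈ Icc ((j : ℝ) / M k) ((j + 1 : ℕ) / M k),
        y ∈ Icc (0 : ℝ) 1 ∧ |y * M k - j| ≤ 1 := by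
      intro j hj y hy
      have l1 := (div_le_iff₀ hM0).1 hy.1
      have l2 := (le_div_iff₀ hM0).1 hy.2
      push_cast at l2
      refine ⟨⟨(hnode j hj.le).1.trans hy.1, hy.2.trans (hnode (j + 1) hj).2⟩, ?_⟩
      rw [abs_le]
      constructor <;> linarith
    -- The moment at time `t` is close to `∫ r t * G`.
    have hfinal : |moment E (M k) (lam k t) G - ∫ x in (0 : ℝ)..1, r t x * G x| ≤
        (C + C₁) / M k * K + 2 * C * K / M k := by
      have hD := hest k t ht
      have hp : ∀ j < M k, |(if j = 0 then α else proxy E (M k) (lam k t) j) -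
          density E α β (M k) (lam k t) j| ≤ C / M k := by
        intro j hj
        split_ifs with h0
        · rw [h0, density_zero, sub_self, abs_zero]; positivity
        · exact hD.proxy j (by omega) hj
      refine abs_moment_sub_integral_le hE hMk h₁ hG0 hG1 (fun x hx => (hK x hx).1)
        (fun x hx => (hK x hx).2.1) (hrt t).continuousOn
        (a := fun j => if j = 0 then α else proxy E (M k) (lam k t) j)
        (fun j hj0 _ => by simp only [if_neg (by omega : ¬ j = 0)]) (by positivity)
        (fun j hj y hy => ?_) (fun j hj => ?_)
      · obtain ⟨m1, m2⟩ := hcell j hj y hy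
        calc _ ≤ _ := abs_sub_le _ (density E α β (M k) (lam k t) j) _
          _ ≤ C / M k + C₁ / M k := add_le_add (hp j hj) (hclose k t ht j hj.le y m1 m2)
          _ = _ := by ring
      · have g1 := hp j hj
        have g2 := hD.bound j
        have g3 : C / M k ≤ C := div_le_self hC hM1
        rw [abs_le] at g1 g2 ⊢
        constructor <;> linarith [g1.1, g1.2, g2.1, g2.2]
    -- At time zero the proxy takes the values of `ρ₀`.
    have hinit : |moment E (M k) (lam k 0) G - ∫ x in (0 : ℝ)..1, ρ₀ x * G x| ≤
        L / M k * K + 1 * K / M k := by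
      refine abs_moment_sub_integral_le hE hMk h₁ hG0 hG1 (fun x hx => (hK x hx).1)
        (fun x hx => (hK x hx).2.1) hρ₀.continuousOn (a := fun j => ρ₀ ((j : ℝ) / M k))
        (fun j hj0 hj => proxy_initial hE (hlam k) hj0 hj) (by positivity)
        (fun j hj y hy => ?_) (fun j hj => ?_)
      · obtain ⟨m1, m2⟩ := hcell j hj y hy
        refine (hL y m1 _ (hnode j hj.le)).trans ?_
        rw [div_eq_mul_one_div L]
        refine mul_le_mul_of_nonneg_left ?_ hL0
        have e : (j : ℝ) / M k - y = -((y * M k - j) / M k) := by field_simp; ring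
        rw [e, abs_neg, abs_div, abs_of_pos hM0]
        gcongr
      · obtain ⟨g1, g2⟩ := hrange _ (hnode j hj.le)
        rw [abs_of_nonneg g1]
        exact g2
    -- In between, the moment grows at the rate prescribed by the weak equation.
    have hmove : |(moment E (M k) (lam k t) G - ∫ s in (0 : ℝ)..t, weakRate E α β r G s) -
        moment E (M k) (lam k 0) G| ≤ Γ / M k * t := by
      have h := (convex_Icc (0 : ℝ) T).norm_image_sub_le_of_norm_hasDerivWithin_le
        (f := fun τ => moment E (M k) (lam k τ) G - ∫ s in (0 : ℝ)..τ, weakRate E α β r G s)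
        (C := Γ / M k) (fun τ hτ => (hasDerivWithinAt_moment (hlam k) G hτ (hest k τ hτ).pos).sub
          (hrate.integral_hasStrictDerivAt 0 τ).hasDerivAt.hasDerivWithinAt) (fun τ hτ => ?_) hT ht
      · simpa [abs_of_nonneg ht.1] using h
      · exact abs_momentRate_sub_le hE (hM k) hC hC₁ (hest k τ hτ) (hrt τ).continuousOn
          (hclose k τ hτ) h₁ h₂ hc₂ (fun x hx => (hK x hx).2.1) (fun x hx => (hK x hx).2.2)
    have e : Λ / M k = (C + C₁) / M k * K + 2 * C * K / M k + (L / M k * K + 1 * K / M k) +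
        Γ / M k * t := by rw [hΛ]; ring
    rw [e]
    rw [abs_le] at hfinal hinit hmove ⊢
    constructor <;> linarith [hfinal.1, hfinal.2, hinit.1, hinit.2, hmove.1, hmove.2]
  have hlim : Tendsto (fun k => Λ / (M k : ℝ)) atTop (𝓝 0) :=
    (tendsto_natCast_atTop_atTop.comp hMtop).const_div_atTop Λ
  have := ge_of_tendsto' hlim hbound
  exact sub_eq_zero.1 (abs_nonpos_iff.1 this)

theorem continuous_density {E α β : ℝ} (hE : 0 < E) {M : ℕ} {x : ℝ → ℕ → ℝ}
    (hx : ∀ j < M, Continuous fun t => x t j) (hpos : ∀ t, ∀ j < M, 0 < x t j) (j : ℕ) :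
    Continuous fun t => density E α β M (x t) j := by
  unfold density
  split_ifs with h1 h2
  · exact continuous_const
  · exact continuous_const
  · exact (continuous_const.mul ((hx j (by omega)).sub (hx (j - 1) (by omega)))).div
      (continuous_const.mul (hx (j - 1) (by omega)))
      fun t => (mul_pos hE (hpos t (j - 1) (by omega))).ne'

/-- The discrete densities on the grids of `N * 2 ^ k` cells converge to the weak solution, which is
therefore within `5 * C / N` of the discrete density on the first of these grids. -/
theorem abs_density_sub_le {E α β T : ℝ} (hE : 0 < E) {ρ₀ : ℝ → ℝ}
    (hρ₀ : ContDiffOn ℝ 4 ρ₀ (Icc 0 1)) (hrange : ∀ x ∈ Icc (0 : ℝ) 1, ρ₀ x ∈ Icc (0 : ℝ) 1)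
    {ρ : ℝ → ℝ → ℝ} (hρ : IsWeakBurgersSolution E α β ρ₀ ρ) (hT : 0 ≤ T) {C : ℝ} (hC : 0 ≤ C)
    (hest : ∀ N : ℕ, 2 ≤ N → ∀ lam, IsSemidiscreteSolution E α β ρ₀ N lam →
      ∀ t ∈ Icc 0 T, DensityEstimates E α β N C (lam t) ∧
        ∀ lam', IsSemidiscreteSolution E α β ρ₀ (2 * N) lam' → ∀ j ≤ N,
          |density E α β N (lam t) j - density E α β (2 * N) (lam' t) (2 * j)| ≤ C / N)
    {N : ℕ} (hN : 2 ≤ N) {lam : ℝ → ℕ → ℝ} (hlam : IsSemidiscreteSolution E α β ρ₀ N lam)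
    {t : ℝ} (ht : t ∈ Icc 0 T) {j : ℕ} (hj0 : 0 < j) (hj : j < N) :
    |density E α β N (lam t) j - ρ t ((j : ℝ) / N)| ≤ 5 * C / N := by
  have hN0 : (0 : ℝ) < N := by exact_mod_cast (by omega : 0 < N)
  choose s hs using exists_semidiscreteSolution E α β ρ₀
  let ℓ : ℕ → ℝ → ℕ → ℝ := fun k => if k = 0 then lam else s (N * 2 ^ k)
  have hℓ : ∀ k, IsSemidiscreteSolution E α β ρ₀ (N * 2 ^ k) (ℓ k) := by
    intro k
    simp only [ℓ]
    split_ifs with h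
    · rw [h, pow_zero, mul_one]; exact hlam
    · exact hs _
  have hM : ∀ k, 2 ≤ N * 2 ^ k := fun k => hN.trans (Nat.le_mul_of_pos_right N (by positivity))
  -- Freezing the time variable outside `[0, T]` makes the densities continuous on the line.
  let π : ℝ → ℝ := fun t => projIcc 0 T hT t
  have hπ : ∀ t, π t ∈ Icc 0 T := fun t => (projIcc 0 T hT t).2
  have hπeq : ∀ t ∈ Icc 0 T, π t = t := fun t ht => by simp only [π]; rw [projIcc_of_mem hT ht]
  have hπc : Continuous π := continuous_subtype_val.comp continuous_projIcc
  obtain ⟨r, hr, hclose⟩ := exists_dyadic_limit (by omega : 0 < N) hC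
    (q := fun k t j => density E α β (N * 2 ^ k) (ℓ k (π t)) j)
    (fun k j _ => continuous_density hE
      (fun i hi => ContinuousOn.comp_continuous (s := Ici 0)
        (fun τ hτ => ((hℓ k).evolution τ hτ i hi).continuousWithinAt) hπc fun τ => (hπ τ).1)
      (fun τ => (hest _ (hM k) _ (hℓ k) (π τ) (hπ τ)).1.pos) j)
    (fun k τ => (hest _ (hM k) _ (hℓ k) (π τ) (hπ τ)).1.grad)
    (fun k τ i hi => by
      have h := (hest _ (hM k) _ (hℓ k) (π τ) (hπ τ)).2 (ℓ (k + 1))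
      rw [show N * 2 ^ (k + 1) = 2 * (N * 2 ^ k) by ring]
      exact h (by rw [show 2 * (N * 2 ^ k) = N * 2 ^ (k + 1) by ring]; exact hℓ (k + 1)) i hi)
  have htop : Tendsto (fun k => N * 2 ^ k) atTop atTop :=
    tendsto_atTop_mono (fun k => (Nat.lt_two_pow_self).le.trans
      (Nat.le_mul_of_pos_left _ (by omega : 0 < N))) tendsto_id
  have huniq := hρ.eq_of_weak hr (T := T) (fun G hG hG0 hG1 τ hτ =>
    weak_equation_of_close hE hρ₀ hrange hM htop hℓ hC (show 0 ≤ 5 * C by positivity)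
      (fun k σ hσ => (hest _ (hM k) _ (hℓ k) σ hσ).1) hr (fun k σ hσ i hi y hy hiy => by
        have := hclose k σ i hi y hy hiy
        rwa [hπeq σ hσ] at this) hG hG0 hG1 hτ)
  have hjR : (j : ℝ) < N := by exact_mod_cast hj
  have hjpos : (0 : ℝ) < j := by exact_mod_cast hj0
  have hy : (j : ℝ) / N ∈ Ioo (0 : ℝ) 1 := ⟨by positivity, by rwa [div_lt_one hN0]⟩
  rw [huniq t ht _ hy]
  have := hclose 0 t j (by simpa using hj.le) _ ⟨hy.1.le, hy.2.le⟩
    (by rw [pow_zero, mul_one, div_mul_cancel₀ _ hN0.ne', sub_self, abs_zero]; exact zero_le_one)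
  simpa only [pow_zero, mul_one, hπeq t ht, ℓ, if_true] using this

end BurgersProxy

end

theorem mainTheorem4 (E α β : ℝ) (hE : 0 < E)
    (hα : α ∈ Set.Ioo (0 : ℝ) 1) (hβ : β ∈ Set.Ioo (0 : ℝ) 1)
    (ρ₀ : ℝ → ℝ) (hρ₀ : ContDiffOn ℝ 4 ρ₀ (Set.Icc 0 1))
    (hρ₀_range : ∀ x ∈ Set.Icc (0 : ℝ) 1, ρ₀ x ∈ Set.Icc (0 : ℝ) 1)
    (hρ₀_left : ρ₀ 0 = α) (hρ₀_right : ρ₀ 1 = β)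
    (ρ : ℝ → ℝ → ℝ) (hρ : BurgersProxy.IsWeakBurgersSolution E α β ρ₀ ρ)
    (T : ℝ) (hT : 0 < T) :
    ∃ C : ℝ, ∀ N : ℕ, 1 ≤ N →
      ∀ lam : ℝ → ℕ → ℝ, BurgersProxy.IsSemidiscreteSolution E α β ρ₀ N lam →
        ∀ t ∈ Set.Icc (0 : ℝ) T, ∀ j ∈ Finset.Icc 1 (N - 1),
          (N : ℝ) * |BurgersProxy.proxy E N (lam t) j - ρ t ((j : ℝ) / N)| ≤ C := by
  obtain ⟨C, hC, hest⟩ :=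
    BurgersProxy.exists_densityEstimates hE hα hβ hρ₀ hρ₀_range hρ₀_left hρ₀_right T
  refine ⟨6 * C, fun N _ lam hlam t ht j hj => ?_⟩
  obtain ⟨hj1, hj2⟩ := Finset.mem_Icc.1 hj
  have hN : 2 ≤ N := by omega
  have hN0 : (0 : ℝ) < N := by exact_mod_cast (by omega : 0 < N)
  have h1 := (hest N hN lam hlam t ht).1.proxy j hj1 (by omega)
  have h2 := BurgersProxy.abs_density_sub_le hE hρ₀ hρ₀_range hρ hT.le hC hest hN hlam ht hj1
    (show j < N by omega)
  rw [← le_div_iff₀' hN0]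
  calc _ ≤ _ := abs_sub_le _ (BurgersProxy.density E α β N (lam t) j) _
    _ ≤ C / N + 5 * C / N := add_le_add h1 h2
    _ = _ := by ring
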